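/- Let $d\ge 1$ and let $Q$ be a Laurent polynomial in $d$ variables with complex coefficients. Write $\mathbb C_*=\mathbb C\setminus\{0\}$, $\mathcal V=\{z\in\mathbb C_*^d: Q(z)=0\}$, $\mathbf L(z)=(\log|z_1|,\dots,\log|z_d|)$, $\mathbf T(x)=\mathbf L^{-1}(x)$ for $x\in\mathbb R^d$, and $\mathrm{amoeba}(Q)=\mathbf L(\mathcal V)$. For $c\in\mathbb C$ let $\mathcal V_c=\{z\in\mathbb C_*^d:Q(z)=c\}$ and $\mathcal M_c=\mathbb C_*^d\setminus\mathcal V_c$. The recession cone of a set $A\subseteq\mathbb R^d$ is $\{v: A+tv\subseteq A\text{ for all }t\ge 0\}$. Let $B$ and $B'$ be connected components of $\mathrm{amoeba}(Q)^c$ such that $B'$ is descending with respect to $B$, that is, there is $v\ne 0$ in the recession cone of $B$ such that $-v$ lies in the recession cone of $B'$. Let $u_*\in\partial B$ and $z_*=(e^{u_{*,1}},\dots,e^{u_{*,d}})$. Assume: (a) $\mathbf T(u_*)\cap\mathcal V=\{z_*\}$; (b) $Q$ has a real hyperbolic quadratic singularity at $z_*$: $Q(z_*)=0$, $dQ(z_*)=0$,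 and there is an invertible real $d\times d$ matrix $A$ with $Q(z_*+Aw)=w_1^2-\sum_{j=2}^d w_j^2+O(|w|^3)$ as $w\to 0$ in $\mathbb C^d$; (c) $r\in\mathbb R^d$ is supporting: the linear function $x\mapsto -r\cdot x$ attains its minimum over $\overline B$ at $u_*$, and $r\cdot v\neq 0$ for every nonzero $v$ in the closure of the tangent cone $\{v: u_*+tv\in B\text{ for all sufficiently small }t>0\}$. Put $|r|=\sum_j|r_j|$, $h(z)=-\sum_{j}\frac{r_j}{|r|}\log|z_j|$, $h_*=h(z_*)$, and let $x\in B$, $y\in B'$. Then for every $\rho>0$ there are $\varepsilon>0$ and $c_*>0$ such that for all real $c\in(0,c_*)$: $\mathcal V_c$ is smooth, $\mathbf T(x)$ and $\mathbf T(y)$ are contained in $\mathcal M_c$, there is a unique class $\mathcal I\in H_{d-1}(\mathcal V_c;\mathbb Z)$ with $$[\mathbf T(x)]-[\mathbf T(y)]=\mathtt o\,\mathcal I\quad\text{in } H_d(\mathcal M_c;\mathbb Z)$$ (the intersection class of $\mathbf T(x)$ and $\mathbf T(y)$; here $\mathtt o:H_{d-1}(\mathcal V_c;\mathbb Z)\to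 H_d(\mathcal M_c;\mathbb Z)$ is the tube map, which takes the boundary circles of a tubular neighbourhood of $\mathcal V_c$ over a cycle, and the two tori carry the same orientation), and $\mathcal I$ is represented by a singular cycle supported in $$\mathcal V_c\cap\bigl(B_\rho(z_*)\cup\{h\le h_*-\varepsilon\}\bigr).$$ -/

import Mathlib

noncomputable section

namespace ConePoint

open CategoryTheory AlgebraicTopology

/-! ### Singular homology and the class swept out by a loop of maps -/

/-- The singular chain complex of a space, with integer coefficients. -/
abbrev chains (X : TopCat.{0}) : ChainComplex (ModuleCat.{0} ℤ) ℕ :=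
  ((singularChainComplexFunctor (ModuleCat.{0} ℤ)).obj (ModuleCat.of ℤ ℤ)).obj X

/-- The singular homology group `H_k(X; ℤ)`. -/
abbrev HZ (k : ℕ) (X : TopCat.{0}) : ModuleCat.{0} ℤ :=
  ((singularHomologyFunctor (ModuleCat.{0} ℤ) k).obj (ModuleCat.of ℤ ℤ)).obj X

/-- The map on homology induced by a continuous map. -/
abbrev pushforward (k : ℕ) {X Y : TopCat.{0}} (f : X ⟶ Y) : HZ k X ⟶ HZ k Y :=
  ((singularHomologyFunctor (ModuleCat.{0} ℤ) k).obj (ModuleCat.of ℤ ℤ)).map f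

/-- The prism operator `C_k(X) ⟶ C_{k+1}(Y)` of a homotopy from a map to itself. -/
def prism {X Y : TopCat.{0}} {f : X ⟶ Y} (F : TopCat.Homotopy f f) (k : ℕ) :
    (chains X).X k ⟶ (chains Y).X (k + 1) :=
  (F.singularChainComplexFunctorObjMap (ModuleCat.of ℤ ℤ)).hom k (k + 1)

/-- As the two ends of the homotopy agree, the prism operator anticommutes with the boundary. -/
lemma d_prism {X Y : TopCat.{0}} {f : X ⟶ Y} (F : TopCat.Homotopy f f) (k : ℕ) :
    (chains X).d (k + 1) k ≫ prism F k + prism F (k + 1) ≫ (chains Y).d (k + 2) (k + 1) = 0 := by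
  have h := (F.singularChainComplexFunctorObjMap (ModuleCat.of ℤ ℤ)).comm (k + 1)
  rw [dNext_eq _ (show (ComplexShape.down ℕ).Rel (k + 1) k by simp),
    prevD_eq _ (show (ComplexShape.down ℕ).Rel (k + 2) (k + 1) by simp)] at h
  simpa [prism] using right_eq_add.mp h

lemma iCycles_prism_d {X Y : TopCat.{0}} {f : X ⟶ Y} (F : TopCat.Homotopy f f) (k : ℕ) :
    ((chains X).iCycles k ≫ prism F k) ≫ (chains Y).d (k + 1) k = 0 := by
  have h := (F.singularChainComplexFunctorObjMap (ModuleCat.of ℤ ℤ)).comm k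
  rw [prevD_eq _ (show (ComplexShape.down ℕ).Rel (k + 1) k by simp)] at h
  have h2 := right_eq_add.mp h
  have h3 := congrArg (fun g => (chains X).iCycles k ≫ g) h2
  simpa [prism, dNext, Preadditive.comp_add] using h3

/-- The prism operator on cycles. -/
def prismCycles {X Y : TopCat.{0}} {f : X ⟶ Y} (F : TopCat.Homotopy f f) (k : ℕ) :
    (chains X).cycles k ⟶ (chains Y).cycles (k + 1) :=
  (chains Y).liftCycles ((chains X).iCycles k ≫ prism F k) k (by simp) (iCycles_prism_d F k)

lemma toCycles_prismCycles {X Y : TopCat.{0}} {f : X ⟶ Y} (F : TopCat.Homotopy f f) (k : ℕ) :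
    (chains X).toCycles (k + 1) k ≫ prismCycles F k ≫ (chains Y).homologyπ (k + 1) = 0 := by
  have h : (chains X).toCycles (k + 1) k ≫ prismCycles F k =
      (chains Y).liftCycles ((-prism F (k + 1)) ≫ (chains Y).d (k + 2) (k + 1)) k (by simp)
        (by simp) := by
    rw [← cancel_mono ((chains Y).iCycles (k + 1))]
    have := d_prism F k
    simp only [prismCycles, Category.assoc, HomologicalComplex.liftCycles_i,
      HomologicalComplex.toCycles_i_assoc, Preadditive.neg_comp]
    exact eq_neg_of_add_eq_zero_left this
  rw [← Category.assoc, h]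
  exact (chains Y).liftCycles_homologyπ_eq_zero_of_boundary _ k (by simp) _ rfl

/-- For a homotopy `F : X × [0,1] → Y` whose two ends agree, i.e. a map `X × S¹ → Y`, this is the
map `H_k(X) ⟶ H_{k+1}(Y)`, `a ↦ F_*(a × [S¹])`, up to a universal sign depending only on `k`. It is
induced by the prism operator of `F`. -/
def sweep {X Y : TopCat.{0}} {f : X ⟶ Y} (F : TopCat.Homotopy f f) (k : ℕ) :
    HZ k X ⟶ HZ (k + 1) Y :=
  ((chains X).homologyIsCokernel (k + 1) k (by simp)).desc
    (Limits.CokernelCofork.ofπ (prismCycles F k ≫ (chains Y).homologyπ (k + 1))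
      (toCycles_prismCycles F k))

/-- `sweep` is computed on representatives by the prism operator. -/
lemma homologyπ_sweep {X Y : TopCat.{0}} {f : X ⟶ Y} (F : TopCat.Homotopy f f) (k : ℕ) :
    (chains X).homologyπ k ≫ sweep F k = prismCycles F k ≫ (chains Y).homologyπ (k + 1) :=
  ((chains X).homologyIsCokernel (k + 1) k (by simp)).fac _ Limits.WalkingParallelPair.one

/-- A class is represented by a chain supported on `S` if it comes from the homology of `S`. -/
def IsSupportedOn {E : Type} [TopologicalSpace E] {V : Set E} {k : ℕ}
    (a : HZ k (TopCat.of V)) (S : Set E) : Prop :=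
  ∃ b : HZ k (TopCat.of {v : V // (v : E) ∈ S}),
    pushforward k (TopCat.ofHom ⟨Subtype.val, continuous_subtype_val⟩) b = a

/-! ### The fundamental class of the standard torus -/

/-- The standard torus `(S¹)^d`. -/
abbrev stdTorus (d : ℕ) : TopCat.{0} := TopCat.of (Fin d → Circle)

/-- The full rotation of the `j`-th coordinate, as a homotopy from the identity to itself. -/
def rotation (d : ℕ) (j : Fin d) : TopCat.Homotopy (𝟙 (stdTorus d)) (𝟙 (stdTorus d)) where
  toFun p := fun i => if i = j then Circle.exp (2 * Real.pi * (p.1 : ℝ)) * p.2 i else p.2 i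
  continuous_toFun := by
    refine continuous_pi fun i => ?_
    by_cases h : i = j
    · simp only [h, if_true]; fun_prop
    · simp only [h, if_false]; fun_prop
  map_zero_left x := by
    funext i; by_cases h : i = j <;> simp [h]
  map_one_left x := by
    funext i; by_cases h : i = j <;> simp [h]

/-- The class of the subtorus in the first `k` coordinates: the class of the point `1` swept
successively by the rotations of the first `k` coordinates. -/
def subtorusClass (d : ℕ) : (k : ℕ) → k ≤ d → HZ k (stdTorus d)
  | 0, _ => (TopCat.singularHomology₀Iso (stdTorus d) (ModuleCat.of ℤ ℤ)).inv
      (Limits.Sigma.ι (fun _ : ZerothHomotopy (stdTorus d) => ModuleCat.of ℤ ℤ)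
        (Quotient.mk _ 1) (1 : ℤ))
  | k + 1, h => sweep (rotation d ⟨k, h⟩) k (subtorusClass d k (Nat.le_of_succ_le h))

/-- The fundamental class of the standard torus. -/
def torusClass (d : ℕ) : HZ d (stdTorus d) := subtorusClass d d le_rfl

/-! ### Laurent polynomials, their zero sets and amoebas -/

/-- Laurent polynomials in `d` variables with complex coefficients. -/
abbrev Laurent (d : ℕ) : Type := AddMonoidAlgebra ℂ (Fin d → ℤ)

/-- The space `ℂ^d`, with its Hermitian norm. -/
abbrev Cd (d : ℕ) : Type := EuclideanSpace ℂ (Fin d)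

variable {d : ℕ}

/-- The value of a Laurent polynomial. -/
def eval (Q : Laurent d) (z : Cd d) : ℂ := Q.coeff.sum fun m a => a * ∏ i, z i ^ m i

/-- The algebraic torus `(ℂ \ {0})^d`. -/
def cstar (d : ℕ) : Set (Cd d) := {z | ∀ i, z i ≠ 0}

/-- The zero set of `Q` in `(ℂ \ {0})^d`. -/
def variety (Q : Laurent d) : Set (Cd d) := {z | z ∈ cstar d ∧ eval Q z = 0}

/-- The complement of the zero set of `Q` in `(ℂ \ {0})^d`. -/
def complement (Q : Laurent d) : Set (Cd d) := {z | z ∈ cstar d ∧ eval Q z ≠ 0}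

/-- The Laurent polynomial `Q - c`. -/
def perturb (Q : Laurent d) (c : ℂ) : Laurent d := Q - AddMonoidAlgebra.single 0 c

/-- The coordinatewise log-modulus map. -/
def logMod (z : Cd d) : Fin d → ℝ := fun i => Real.log ‖z i‖

/-- The point `(e^{u_1}, …, e^{u_d})`. -/
def expPoint (u : Fin d → ℝ) : Cd d := WithLp.toLp 2 fun i => (Real.exp (u i) : ℂ)

/-- The amoeba of `Q`. -/
def amoeba (Q : Laurent d) : Set (Fin d → ℝ) := logMod '' variety Q

/-- `B` is a connected component of the complement of the amoeba of `Q`. -/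
def IsAmoebaComplementComponent (Q : Laurent d) (B : Set (Fin d → ℝ)) : Prop :=
  ∃ x ∈ (amoeba Q)ᶜ, B = connectedComponentIn (amoeba Q)ᶜ x

/-- The recession cone of a set. -/
def recessionCone (B : Set (Fin d → ℝ)) : Set (Fin d → ℝ) :=
  {v | ∀ x ∈ B, ∀ t : ℝ, 0 ≤ t → x + t • v ∈ B}

/-- `B'` is descending with respect to `B`: some nonzero `v` lies in the recession cone of `B`
while `-v` lies in that of `B'`. -/
def IsDescending (B B' : Set (Fin d → ℝ)) : Prop :=
  ∃ v ∈ recessionCone B, v ≠ 0 ∧ -v ∈ recessionCone B'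

/-- The open tangent cone to `B` at `u`. -/
def tangentCone (B : Set (Fin d → ℝ)) (u : Fin d → ℝ) : Set (Fin d → ℝ) :=
  {v | ∀ᶠ t in nhdsWithin (0 : ℝ) (Set.Ioi 0), u + t • v ∈ B}

/-- `r` is supporting for `B` at `u`: the linear functional `x ↦ -r·x`, which is `h_r` in
logarithmic coordinates, is minimal on the closure of `B` at `u`, and its kernel meets the closed
tangent cone to `B` at `u` only in the origin. -/
def IsSupporting (r : Fin d → ℝ) (B : Set (Fin d → ℝ)) (u : Fin d → ℝ) : Prop :=
  (∀ x ∈ closure B, -(r ⬝ᵥ u) ≤ -(r ⬝ᵥ x)) ∧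
    ∀ v ∈ closure (tangentCone B u), r ⬝ᵥ v = 0 → v = 0

/-- The normalization `r / |r|`, where `|r| = ∑ |r_j|`. -/
def direction (r : Fin d → ℝ) : Fin d → ℝ := (∑ j, |r j|)⁻¹ • r

/-- The height function `h_s(z) = - ∑ s_j log |z_j|`. -/
def height (s : Fin d → ℝ) (z : Cd d) : ℝ := -∑ j, s j * Real.log ‖z j‖

/-- `Q` has a real hyperbolic quadratic singularity at `z`: it vanishes there with its
differential, and after a real linear change of coordinates its quadratic part at `z` is
`u_0² - u_1² - … - u_n²`. -/
def HasRealHyperbolicQuadraticSingularity {n : ℕ} (Q : Laurent (n + 1)) (z : Cd (n + 1)) : Prop :=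
  eval Q z = 0 ∧ fderiv ℂ (eval Q) z = 0 ∧
    ∃ A : Matrix (Fin (n + 1)) (Fin (n + 1)) ℝ, IsUnit A.det ∧
      (fun u : Fin (n + 1) → ℂ =>
        eval Q (z + WithLp.toLp 2 ((A.map Complex.ofReal).mulVec u)) -
          (u 0 ^ 2 - ∑ j : Fin n, u j.succ ^ 2)) =O[nhds 0] fun u => ‖u‖ ^ 3

/-! ### Tubes and the intersection class -/

lemma isOpen_cstar : IsOpen (cstar d) := by
  have : cstar d = ⋂ i, {z : Cd d | z i ≠ 0} := by ext; simp [cstar]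
  rw [this]
  exact isOpen_iInter_of_finite fun i => isOpen_ne_fun (by fun_prop) (by fun_prop)

lemma analyticAt_eval (Q : Laurent d) {z : Cd d} (hz : z ∈ cstar d) :
    AnalyticAt ℂ (eval Q) z := by
  unfold eval Finsupp.sum
  refine Finset.analyticAt_fun_sum _ fun m _ => analyticAt_const.mul ?_
  refine Finset.analyticAt_fun_prod _ fun i _ => ?_
  exact AnalyticAt.fun_zpow
    ((EuclideanSpace.proj (𝕜 := ℂ) i : Cd d →L[ℂ] ℂ).analyticAt z) (hz i)

/-- The gradient of `Q` (the vector of conjugated partial derivatives) spans the Hermitian normal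
space of the zero set at its smooth points; it depends continuously on the point. -/
lemma continuous_gradient (Q : Laurent d) :
    Continuous fun v : variety Q => gradient (eval Q) (v : Cd d) := by
  refine continuous_iff_continuousAt.2 fun v => ?_
  have h := (analyticAt_eval Q v.2.1).fderiv.continuousAt
  have h2 : ContinuousAt (gradient (eval Q)) (v : Cd d) :=
    (InnerProductSpace.toDual ℂ (Cd d)).symm.continuous.continuousAt.comp h
  exact h2.comp continuous_subtype_val.continuousAt

/-- A tubular neighbourhood of the zero set `V` of `Q` in `(ℂ \ {0})^d`: a continuous positive
radius function on `V` such that `(v, w) ↦ v + w ∇Q(v)` maps the bundle of discs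
`{(v, w) : |w| ≤ radius v}` injectively into `(ℂ \ {0})^d`. (This forces `∇Q ≠ 0` on `V`, so that
only smooth `V` have tubular neighbourhoods.) -/
structure TubularNhd (Q : Laurent d) where
  /-- The radius function. -/
  radius : C(variety Q, ℝ)
  radius_pos : ∀ v, 0 < radius v
  mem_cstar : ∀ (v : variety Q) (w : ℂ), ‖w‖ ≤ radius v →
    (v : Cd d) + w • gradient (eval Q) (v : Cd d) ∈ cstar d
  injective : ∀ (v v' : variety Q) (w w' : ℂ), ‖w‖ ≤ radius v → ‖w'‖ ≤ radius v' →
    (v : Cd d) + w • gradient (eval Q) (v : Cd d) =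
      (v' : Cd d) + w' • gradient (eval Q) (v' : Cd d) → v = v' ∧ w = w'

namespace TubularNhd

variable {Q : Laurent d} (N : TubularNhd Q)

lemma mem_complement (v : variety Q) (w : ℂ) (hw : ‖w‖ = N.radius v) :
    (v : Cd d) + w • gradient (eval Q) (v : Cd d) ∈ complement Q := by
  refine ⟨N.mem_cstar v w hw.le, fun h0 => ?_⟩
  have hp := N.radius_pos v
  have h := (N.injective v ⟨_, N.mem_cstar v w hw.le, h0⟩ w 0 hw.le
    (by simpa using (N.radius_pos _).le) (by simp)).2
  rw [h, norm_zero] at hw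
  exact hp.ne hw

lemma norm_circle (v : variety Q) (t : ℝ) :
    ‖(N.radius v : ℂ) * (Circle.exp (2 * Real.pi * t) : ℂ)‖ = N.radius v := by
  rw [norm_mul, Circle.norm_coe, mul_one, Complex.norm_real, Real.norm_of_nonneg (N.radius_pos v).le]

/-- The point with angle `2πt` on the boundary of the normal disc at `v`. -/
def point (v : variety Q) (t : ℝ) : complement Q :=
  ⟨(v : Cd d) + ((N.radius v : ℂ) * (Circle.exp (2 * Real.pi * t) : ℂ)) •
    gradient (eval Q) (v : Cd d), N.mem_complement v _ (N.norm_circle v t)⟩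

lemma continuous_point : Continuous fun p : ℝ × variety Q => N.point p.2 p.1 := by
  refine Continuous.subtype_mk ?_ _
  have h : Continuous fun p : ℝ × variety Q => gradient (eval Q) (p.2 : Cd d) :=
    (continuous_gradient Q).comp continuous_snd
  have hr : Continuous fun p : ℝ × variety Q =>
      (N.radius p.2 : ℂ) * (Circle.exp (2 * Real.pi * p.1) : ℂ) :=
    (Complex.continuous_ofReal.comp (N.radius.continuous.comp continuous_snd)).mul (by fun_prop)
  exact (continuous_subtype_val.comp continuous_snd).add (hr.smul h)

/-- The section of the circle bundle at angle `0`. -/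
def section₀ : TopCat.of (variety Q) ⟶ TopCat.of (complement Q) :=
  TopCat.ofHom ⟨fun v => N.point v 0,
    N.continuous_point.comp (g := fun p : ℝ × variety Q => N.point p.2 p.1)
      (f := fun v => ((0 : ℝ), v)) (by fun_prop)⟩

/-- The loop of sections that runs once, positively, around the normal circles. -/
def loop : TopCat.Homotopy N.section₀ N.section₀ where
  toFun p := N.point p.2 p.1
  continuous_toFun := by
    exact N.continuous_point.comp (g := fun p : ℝ × variety Q => N.point p.2 p.1)
      (f := fun p : unitInterval × variety Q => ((p.1 : ℝ), p.2)) (by fun_prop)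
  map_zero_left v := by simp [section₀]
  map_one_left v := by
    apply Subtype.ext
    simp [section₀, point]

/-- The tube operator `H_k(V) ⟶ H_{k+1}((ℂ \ {0})^d \ V)`, which takes the bundle of boundary
circles over a cycle. -/
def tube (k : ℕ) : HZ k (TopCat.of (variety Q)) ⟶ HZ (k + 1) (TopCat.of (complement Q)) :=
  sweep N.loop k

end TubularNhd

/-- The parametrization `θ ↦ (e^{u_j} θ_j)_j` of the torus over a point `u` off the amoeba. -/
def torusMap (Q : Laurent d) (u : Fin d → ℝ) (hu : u ∉ amoeba Q) :
    stdTorus d ⟶ TopCat.of (complement Q) :=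
  TopCat.ofHom
    { toFun := fun θ => ⟨WithLp.toLp 2 fun i => (Real.exp (u i) : ℂ) * (θ i : ℂ), by
        have h0 : (WithLp.toLp 2 fun i => (Real.exp (u i) : ℂ) * (θ i : ℂ)) ∈ cstar d := by
          intro i
          simp [Complex.exp_ne_zero]
        refine ⟨h0, fun h => hu ⟨_, ⟨h0, h⟩, ?_⟩⟩
        funext i
        simp only [logMod, norm_mul, Circle.norm_coe, mul_one, Complex.norm_real, Real.norm_eq_abs,
          Real.abs_exp, Real.log_exp]⟩
      continuous_toFun := by
        refine Continuous.subtype_mk ?_ _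
        fun_prop }

/-- The class of the torus over `u` in the homology of the complement of the zero set. -/
def torusOver (Q : Laurent d) (u : Fin d → ℝ) (hu : u ∉ amoeba Q) :
    HZ d (TopCat.of (complement Q)) :=
  pushforward d (torusMap Q u hu) (torusClass d)

/-- `I` is an intersection class of the tori `T(x)`, `T(y)` with the zero set `V` of `Q`: the two
tori avoid `V`, and `[T(x)] - [T(y)]` is the class of the tube around `I`, in the homology of
`(ℂ \ {0})^{n+1} \ V`. -/
def IsIntersectionClass {n : ℕ} (Q : Laurent (n + 1)) (x y : Fin (n + 1) → ℝ)
    (I : HZ n (TopCat.of (variety Q))) : Prop :=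
  ∃ (hx : x ∉ amoeba Q) (hy : y ∉ amoeba Q) (N : TubularNhd Q),
    torusOver Q x hx - torusOver Q y hy = N.tube n I

end ConePoint

end

open ConePoint

/-! Everything rests on a path of tori. For small `c` there is a path from `x` to `y` in logarithmic
space over which `V_c` is met only in an open set `W`, the union of the ball `B_ρ(z_*)` and a region
of height below `h_* - ε`. The path has four pieces. A segment in `B` leads from `x` to a point near
`u`. A path in a small ball around `u` leads to `u + s r`, where the height is already below `h_* -
ε`. A path inside the half-space of such heights leads to a point `y - t v`. A segment in `B'` leads
back to `y`. Here `r · v < 0`, because `r` is supporting and `v` lies in the recession cone of `B`,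
so the height tends to `-∞` along `y - t v`. The components are convex, so the two segments are
compact sets off the amoeba of `Q`, hence off that of `Q - c` for small `c`. Over the ball,
assumption (a) and compactness confine `V_c` to `B_ρ(z_*)` (`exists_perturb_near`).

Let `T = V_c ∩ W`. The tori over the path form a homotopy in `M_c ∪ T`, so `[T(x)] - [T(y)]` dies in
the homology of `M_c ∪ T`. Exactness of the Gysin sequence of the pair `T ⊆ M_c ∪ T`
(`GysinSquare.exists_sweep_eq`) then makes the difference the tube of a class of `T`, which gives
existence and support together. For uniqueness the same sequence is used with `T = V_c`: the kernel
of the tube map comes from `H_{n+2}` of the whole algebraic torus of complex dimension `n + 1`, and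
this group vanishes because that space retracts to a compact torus (`tube_injective`).

The Gysin sequence is proved on chains. Mayer-Vietoris comes from barycentric subdivision. The
normal bundle is trivialized by the gradient, so the intersection is a product with a circle up to
homotopy, and the homology of `Y × S¹` is controlled by the covering `Y × ℝ`. It needs a tubular
neighbourhood of the smooth set `V_c`. Smoothness for small `c > 0` holds since a Laurent polynomial
has finitely many critical values: on each irreducible component of the critical locus its
differential vanishes, so it is constant there.

Convexity of the components is a winding number argument: along an integral direction the winding of
`Q` counts roots of a polynomial inside a circle, so it changes strictly on crossing a point of the
amoeba where `Q` vanishes on the chosen orbit. -/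

noncomputable section

namespace ConePoint

/-! ### Singular chains as finitely supported functions -/

section

open CategoryTheory AlgebraicTopology Simplicial

section Chains

variable {X Y Z : Type} [TopologicalSpace X] [TopologicalSpace Y] [TopologicalSpace Z]

/-- The singular `k`-simplices of a space. -/
abbrev Simp (k : ℕ) (X : Type) [TopologicalSpace X] : Type := C(stdSimplex ℝ (Fin (k + 1)), X)

/-- The group of singular `k`-chains, as finitely supported functions on simplices. -/
abbrev Ch (k : ℕ) (X : Type) [TopologicalSpace X] : Type := Simp k X →₀ ℤ

/-- The map induced on chains by a continuous map. -/
def mp (f : C(X, Y)) {k : ℕ} : Ch k X →ₗ[ℤ] Ch k Y := Finsupp.lmapDomain ℤ ℤ fun σ => f.comp σ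

@[simp] lemma mp_single (f : C(X, Y)) {k : ℕ} (σ : Simp k X) (n : ℤ) :
    mp f (Finsupp.single σ n) = Finsupp.single (f.comp σ) n := by
  simp [mp]

lemma mp_comp (g : C(Y, Z)) (f : C(X, Y)) {k : ℕ} (c : Ch k X) :
    mp (g.comp f) c = mp g (mp f c) := by
  change Finsupp.mapDomain _ c = Finsupp.mapDomain _ (Finsupp.mapDomain _ c)
  rw [← Finsupp.mapDomain_comp]
  rfl

@[simp] lemma mp_id {k : ℕ} (c : Ch k X) : mp (ContinuousMap.id X) c = c :=
  Finsupp.mapDomain_id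

/-- The inclusion of the `i`-th face in the standard simplex. -/
def faceMap (k : ℕ) (i : Fin (k + 2)) :
    C(stdSimplex ℝ (Fin (k + 1)), stdSimplex ℝ (Fin (k + 2))) :=
  ⟨stdSimplex.map (Fin.succAbove i), stdSimplex.continuous_map _⟩

/-- The boundary of a simplex. -/
def bdSimp {k : ℕ} (σ : Simp (k + 1) X) : Ch k X :=
  ∑ i : Fin (k + 2), (-1 : ℤ) ^ (i : ℕ) • Finsupp.single (σ.comp (faceMap k i)) 1

/-- The boundary operator. -/
def bd {k : ℕ} : Ch (k + 1) X →ₗ[ℤ] Ch k X := Finsupp.lift (Ch k X) ℤ _ bdSimp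

lemma bd_single {k : ℕ} (σ : Simp (k + 1) X) :
    bd (Finsupp.single σ 1) = bdSimp σ := by
  simp [bd]

lemma bd_mp (f : C(X, Y)) {k : ℕ} (c : Ch (k + 1) X) : bd (mp f c) = mp f (bd c) := by
  have : bd ∘ₗ mp f = mp f ∘ₗ (bd (X := X) (k := k)) := by
    refine Finsupp.lhom_ext' fun σ => LinearMap.ext_ring ?_
    simp only [LinearMap.comp_apply, Finsupp.lsingle_apply, mp_single, bd_single, bdSimp, map_sum,
      map_smul]
    rfl
  exact LinearMap.congr_fun this c

/-- The singular simplicial set of a space. -/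
abbrev sset (X : Type) [TopologicalSpace X] : SSet.{0} := TopCat.toSSet.obj (TopCat.of X)

/-- Simplices of the singular simplicial set as continuous maps. -/
def simpEquiv (k : ℕ) (X : Type) [TopologicalSpace X] : (sset X) _⦋k⦌ ≃ Simp k X :=
  TopCat.toSSetObjEquiv (TopCat.of X) _

/-- Mathlib's singular chains. -/
abbrev MCh (k : ℕ) (X : Type) [TopologicalSpace X] : Type := (chains (TopCat.of X)).X k

/-- The generator given by a simplex. -/
def gen {k : ℕ} (σ : (sset X) _⦋k⦌) : MCh k X :=
  ((sset X).ιChainComplex (R := ModuleCat.of ℤ ℤ) σ).hom (1 : ℤ)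

/-- Comparison of Mathlib's chains with finitely supported functions. -/
def toCh (k : ℕ) (X : Type) [TopologicalSpace X] : MCh k X →ₗ[ℤ] Ch k X :=
  (((sset X).isColimitChainComplexXCofan (ModuleCat.of ℤ ℤ) k).desc
    (Limits.Cofan.mk (ModuleCat.of ℤ (Ch k X))
      fun σ => ModuleCat.ofHom (Finsupp.lsingle (simpEquiv k X σ)))).hom

lemma toCh_gen {k : ℕ} (σ : (sset X) _⦋k⦌) :
    toCh k X (gen σ) = Finsupp.single (simpEquiv k X σ) 1 := by
  have := ((sset X).isColimitChainComplexXCofan (ModuleCat.of ℤ ℤ) k).fac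
    (Limits.Cofan.mk _ fun σ => ModuleCat.ofHom (Finsupp.lsingle (simpEquiv k X σ))) ⟨σ⟩
  exact congrArg (fun g => g.hom (1 : ℤ)) this

/-- The inverse comparison. -/
def ofCh (k : ℕ) (X : Type) [TopologicalSpace X] : Ch k X →ₗ[ℤ] MCh k X :=
  Finsupp.linearCombination ℤ fun σ => gen ((simpEquiv k X).symm σ)

lemma ofCh_single {k : ℕ} (σ : Simp k X) :
    ofCh k X (Finsupp.single σ 1) = gen ((simpEquiv k X).symm σ) := by
  rw [ofCh, Finsupp.linearCombination_single]
  exact (Module.toDistribMulAction (R := ℤ) (M := MCh k X)).one_smul _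

lemma chains_ext {k : ℕ} {M : Type} [AddCommGroup M] [Module ℤ M]
    {f g : MCh k X →ₗ[ℤ] M} (h : ∀ σ, f (gen σ) = g (gen σ)) : f = g := by
  have : ModuleCat.ofHom f = ModuleCat.ofHom g := by
    refine SSet.chainComplex_hom_ext (X := sset X) (R := ModuleCat.of ℤ ℤ)
      (T := ModuleCat.of ℤ M) fun σ => ?_
    refine ModuleCat.hom_ext (LinearMap.ext_ring ?_)
    exact h σ
  exact congrArg ModuleCat.Hom.hom this

/-- Mathlib's group of singular chains is the group of finitely supported functions. -/
def chEquiv (k : ℕ) (X : Type) [TopologicalSpace X] : MCh k X ≃ₗ[ℤ] Ch k X :=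
  LinearEquiv.ofLinearMap (toCh k X) (ofCh k X)
    (by
      refine Finsupp.lhom_ext' fun σ => LinearMap.ext_ring ?_
      simp only [LinearMap.comp_apply, Finsupp.lsingle_apply, ofCh_single, toCh_gen]
      simp)
    (by
      refine chains_ext fun σ => ?_
      simp only [LinearMap.comp_apply, toCh_gen, ofCh_single]
      simp)

lemma chEquiv_gen {k : ℕ} (σ : (sset X) _⦋k⦌) :
    chEquiv k X (gen σ) = Finsupp.single (simpEquiv k X σ) 1 := toCh_gen σ

/-- Mathlib's boundary operator. -/
abbrev md (k : ℕ) (X : Type) [TopologicalSpace X] : MCh (k + 1) X →ₗ[ℤ] MCh k X :=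
  ((chains (TopCat.of X)).d (k + 1) k).hom

/-- Mathlib's map on chains. -/
abbrev mmap (k : ℕ) (f : C(X, Y)) : MCh k X →ₗ[ℤ] MCh k Y :=
  ((((singularChainComplexFunctor (ModuleCat.{0} ℤ)).obj
      (ModuleCat.of ℤ ℤ)).map (TopCat.ofHom f)).f k).hom

lemma d_gen {k : ℕ} (σ : (sset X) _⦋k + 1⦌) :
    md k X (gen σ) = ∑ i : Fin (k + 2), (-1 : ℤ) ^ (i : ℕ) • gen ((sset X).δ i σ) := by
  have := SSet.ιChainComplex_d (sset X) (ModuleCat.of ℤ ℤ) σ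
  have := congrArg (fun g => g.hom (1 : ℤ)) this
  refine Eq.trans this ?_
  simp only [ModuleCat.hom_sum, LinearMap.sum_apply]
  rfl

lemma chEquiv_d {k : ℕ} (c : MCh (k + 1) X) :
    chEquiv k X (md k X c) = bd (chEquiv (k + 1) X c) := by
  have : (chEquiv k X).toLinearMap ∘ₗ md k X = bd ∘ₗ (chEquiv (k + 1) X).toLinearMap := by
    refine chains_ext fun σ => ?_
    simp only [LinearMap.comp_apply, LinearEquiv.coe_coe, d_gen, chEquiv_gen, bd_single, map_sum,
      map_zsmul, bdSimp]
    rfl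
  exact LinearMap.congr_fun this c

lemma map_gen {k : ℕ} (f : C(X, Y)) (σ : (sset X) _⦋k⦌) :
    mmap k f (gen σ) = gen ((TopCat.toSSet.map (TopCat.ofHom f)).app _ σ) := by
  have := SSet.ι_chainComplexMap_f _ _ (TopCat.toSSet.map (TopCat.ofHom f)) (ModuleCat.of ℤ ℤ) σ
  exact congrArg (fun g => g.hom (1 : ℤ)) this

lemma chEquiv_map {k : ℕ} (f : C(X, Y)) (c : MCh k X) :
    chEquiv k Y (mmap k f c) = mp f (chEquiv k X c) := by
  have : (chEquiv k Y).toLinearMap ∘ₗ mmap k f = mp f ∘ₗ (chEquiv k X).toLinearMap := by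
    refine chains_ext fun σ => ?_
    simp only [LinearMap.comp_apply, LinearEquiv.coe_coe, map_gen, chEquiv_gen, mp_single]
    rfl
  exact LinearMap.congr_fun this c

-- Transported from the relation `d ∘ d = 0` of the singular chain complex along `chEquiv`, which
-- avoids the face identities.
@[simp] lemma bd_bd {k : ℕ} (c : Ch (k + 1 + 1) X) : bd (bd c) = 0 := by
  obtain ⟨c, rfl⟩ := (chEquiv (k + 1 + 1) X).surjective c
  rw [← chEquiv_d, ← chEquiv_d, ← LinearMap.comp_apply, ← ModuleCat.hom_comp,
    HomologicalComplex.d_comp_d]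
  simp

/-- The prism operator of a homotopy. -/
def prismOp {f g : C(X, Y)} (F : f.Homotopy g) (k : ℕ) : Ch k X →ₗ[ℤ] Ch (k + 1) Y :=
  (chEquiv (k + 1) Y).toLinearMap ∘ₗ
    ((TopCat.Homotopy.singularChainComplexFunctorObjMap (f := TopCat.ofHom f) (g := TopCat.ofHom g)
      F (ModuleCat.of ℤ ℤ)).hom k (k + 1)).hom ∘ₗ (chEquiv k X).symm.toLinearMap

lemma bd_prismOp_zero {f g : C(X, Y)} (F : f.Homotopy g) (c : Ch 0 X) :
    bd (prismOp F 0 c) = mp f c - mp g c := by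
  obtain ⟨c, rfl⟩ := (chEquiv 0 X).surjective c
  have h := (TopCat.Homotopy.singularChainComplexFunctorObjMap (f := TopCat.ofHom f)
    (g := TopCat.ofHom g) F (ModuleCat.of ℤ ℤ)).comm 0
  rw [prevD_eq _ (show (ComplexShape.down ℕ).Rel 1 0 by simp), dNext_eq_zero _ _ (by simp),
    zero_add] at h
  have h := congrArg (fun g => chEquiv 0 Y (g.hom c)) h
  simp only [ModuleCat.hom_add, LinearMap.add_apply, map_add, ModuleCat.hom_comp,
    LinearMap.comp_apply] at h
  erw [chEquiv_map, chEquiv_d, chEquiv_map] at h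
  rw [h]
  simp [prismOp]

/-- The sign convention of a chain homotopy, `f = h d + d h + g`. In degree zero the term `h d` is
absent, hence the separate lemma above. -/
lemma bd_prismOp_succ {f g : C(X, Y)} (F : f.Homotopy g) {k : ℕ} (c : Ch (k + 1) X) :
    bd (prismOp F (k + 1) c) = mp f c - mp g c - prismOp F k (bd c) := by
  obtain ⟨c, rfl⟩ := (chEquiv (k + 1) X).surjective c
  have h := (TopCat.Homotopy.singularChainComplexFunctorObjMap (f := TopCat.ofHom f)
    (g := TopCat.ofHom g) F (ModuleCat.of ℤ ℤ)).comm (k + 1)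
  rw [dNext_eq _ (show (ComplexShape.down ℕ).Rel (k + 1) k by simp),
    prevD_eq _ (show (ComplexShape.down ℕ).Rel (k + 2) (k + 1) by simp)] at h
  have h := congrArg (fun g => chEquiv (k + 1) Y (g.hom c)) h
  simp only [ModuleCat.hom_add, LinearMap.add_apply, map_add, ModuleCat.hom_comp,
    LinearMap.comp_apply] at h
  erw [chEquiv_map, chEquiv_d, chEquiv_map] at h
  rw [h]
  simp [prismOp, ← chEquiv_d]

end Chains

end

/-! ### Naturality of the prism operator -/

section

open CategoryTheory AlgebraicTopology Simplicial
section Chains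

variable {X Y Z : Type} [TopologicalSpace X] [TopologicalSpace Y] [TopologicalSpace Z]

/-- The simplices of the prism over a simplex. -/
def prismSimp {f g : C(X, Y)} (F : f.Homotopy g) {k : ℕ} (i : Fin (k + 1)) (σ : (sset X) _⦋k⦌) :
    (sset Y) _⦋k + 1⦌ :=
  (TopCat.Homotopy.toSSet (f := TopCat.ofHom f) (g := TopCat.ofHom g)
    F).toSimplicialObjectHomotopy.h i σ

/-- An explicit formula on generators. Naturality in both variables is read off from it, since the
prism operator itself is only given through a simplicial homotopy. -/
lemma prismOp_single {f g : C(X, Y)} (F : f.Homotopy g) {k : ℕ} (σ : (sset X) _⦋k⦌) :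
    prismOp F k (Finsupp.single (simpEquiv k X σ) 1) =
      -∑ i : Fin (k + 1), (-1 : ℤ) ^ (i : ℕ) •
        Finsupp.single (simpEquiv (k + 1) Y (prismSimp F i σ)) 1 := by
  let L (i : Fin (k + 1)) : MCh k X →ₗ[ℤ] MCh (k + 1) Y :=
    (Limits.Sigma.map' (f := fun _ : (sset X) _⦋k⦌ => ModuleCat.of ℤ ℤ)
      (g := fun _ : (sset Y) _⦋k + 1⦌ => ModuleCat.of ℤ ℤ)
      (fun σ => prismSimp F i σ) (fun _ => 𝟙 _)).hom
  have hL (i : Fin (k + 1)) : L i (gen σ) = gen (prismSimp F i σ) :=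
    congrArg (fun g => g.hom (1 : ℤ)) (Limits.Sigma.ι_comp_map'
      (f := fun _ : (sset X) _⦋k⦌ => ModuleCat.of ℤ ℤ)
      (g := fun _ : (sset Y) _⦋k + 1⦌ => ModuleCat.of ℤ ℤ)
      (fun σ => prismSimp F i σ) (fun _ => 𝟙 _) σ)
  have h1 : ((TopCat.Homotopy.singularChainComplexFunctorObjMap (f := TopCat.ofHom f)
      (g := TopCat.ofHom g) F (ModuleCat.of ℤ ℤ)).hom k (k + 1)).hom =
      -∑ i : Fin (k + 1), (-1 : ℤ) ^ (i : ℕ) • L i := by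
    have h2 := SimplicialObject.Homotopy.ToChainHomotopy.hom_eq
      ((TopCat.Homotopy.toSSet (f := TopCat.ofHom f) (g := TopCat.ofHom g)
        F).toSimplicialObjectHomotopy.whiskerRight (Limits.sigmaConst.obj (ModuleCat.of ℤ ℤ))) k
    refine (congrArg ModuleCat.Hom.hom h2).trans ?_
    simp only [ModuleCat.hom_neg, ModuleCat.hom_sum, ModuleCat.hom_zsmul]
    rfl
  have h3 : (chEquiv k X).symm (Finsupp.single (simpEquiv k X σ) 1) = gen σ :=
    (LinearEquiv.symm_apply_eq _).2 (chEquiv_gen σ).symm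
  rw [prismOp, h1, LinearMap.comp_apply, LinearMap.comp_apply, LinearEquiv.coe_coe,
    LinearEquiv.coe_coe, h3, LinearMap.neg_apply, LinearMap.sum_apply, map_neg, map_sum]
  congr 1
  refine Finset.sum_congr rfl fun i _ => ?_
  refine (map_zsmul (chEquiv (k + 1) Y) _ (L i (gen σ))).trans ?_
  rw [hL, chEquiv_gen]

lemma toSSet_comp_h {f g : C(X, Y)} (F : f.Homotopy g) (q : C(Z, X)) :
    (TopCat.Homotopy.toSSet (f := TopCat.ofHom (f.comp q)) (g := TopCat.ofHom (g.comp q))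
      (ContinuousMap.Homotopy.comp F (.refl q))).h =
      MonoidalCategoryStruct.whiskerRight (TopCat.toSSet.map (TopCat.ofHom q)) _ ≫
        (TopCat.Homotopy.toSSet (f := TopCat.ofHom f) (g := TopCat.ofHom g) F).h := by
  have h : TopCat.Homotopy.h (f₀ := TopCat.ofHom (f.comp q)) (f₁ := TopCat.ofHom (g.comp q))
      (ContinuousMap.Homotopy.comp F (.refl q)) =
      MonoidalCategoryStruct.whiskerRight (TopCat.ofHom q) _ ≫
        TopCat.Homotopy.h (f₀ := TopCat.ofHom f) (f₁ := TopCat.ofHom g) F := rfl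
  dsimp only [TopCat.Homotopy.toSSet]
  rw [h, Functor.map_comp, ← MonoidalCategory.whisker_exchange_assoc,
    Functor.LaxMonoidal.μ_natural_left_assoc]

lemma prismSimp_map {f g : C(X, Y)} (F : f.Homotopy g)
    (q : C(Z, X)) {k : ℕ} (i : Fin (k + 1)) (σ : (sset Z) _⦋k⦌) :
    prismSimp F i ((TopCat.toSSet.map (TopCat.ofHom q)).app _ σ) =
      prismSimp (ContinuousMap.Homotopy.comp F (.refl q)) i σ := by
  simp only [prismSimp, SSet.Homotopy.toSimplicialObjectHomotopy]
  have := SSet.yonedaEquiv_symm_comp σ (TopCat.toSSet.map (TopCat.ofHom q))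
  simp only [TypeCat.hom_ofHom, TypeCat.Fun.coe_mk]
  rw [← this, toSSet_comp_h, ← Category.assoc, ← MonoidalCategory.comp_whiskerRight]

/-- Postcomposition of a homotopy with a map. -/
def postHom {f g : C(X, Y)} (F : f.Homotopy g) (q : C(Y, Z)) : (q.comp f).Homotopy (q.comp g) :=
  ContinuousMap.Homotopy.comp (.refl q) F

/-- Precomposition of a homotopy with a map. -/
def preHom {f g : C(X, Y)} (q : C(Z, X)) (F : f.Homotopy g) : (f.comp q).Homotopy (g.comp q) :=
  ContinuousMap.Homotopy.comp F (.refl q)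

/-- With `prismOp_mp` and `prismOp_congr`, this turns identities between swept chains into pointwise
identities between homotopies. -/
lemma mp_prismOp {f g : C(X, Y)} (F : f.Homotopy g) (q : C(Y, Z)) {k : ℕ} (c : Ch k X) :
    mp q (prismOp F k c) = prismOp (postHom F q) k c := by
  have : mp q ∘ₗ prismOp F k = prismOp (postHom F q) k := by
    refine Finsupp.lhom_ext' fun σ => LinearMap.ext_ring ?_
    obtain ⟨σ, rfl⟩ := (simpEquiv k X).surjective σ
    simp only [LinearMap.comp_apply, Finsupp.lsingle_apply, prismOp_single, map_neg, map_sum,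
      map_zsmul, mp_single]
    rfl
  exact LinearMap.congr_fun this c

lemma prismOp_mp {f g : C(X, Y)} (F : f.Homotopy g) (q : C(Z, X)) {k : ℕ} (c : Ch k Z) :
    prismOp F k (mp q c) = prismOp (preHom q F) k c := by
  have : prismOp F k ∘ₗ mp q = prismOp (preHom q F) k := by
    refine Finsupp.lhom_ext' fun σ => LinearMap.ext_ring ?_
    obtain ⟨σ, rfl⟩ := (simpEquiv k Z).surjective σ
    have : q.comp (simpEquiv k Z σ) = simpEquiv k X ((TopCat.toSSet.map (TopCat.ofHom q)).app _ σ) :=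
      rfl
    simp only [LinearMap.comp_apply, Finsupp.lsingle_apply, prismOp_single, mp_single, this, prismSimp_map]
    rfl
  exact LinearMap.congr_fun this c
end Chains

end

/-! ### Homology classes through representing cycles -/

section

open CategoryTheory AlgebraicTopology Simplicial
section Chains

variable {X Y Z : Type} [TopologicalSpace X] [TopologicalSpace Y] [TopologicalSpace Z]

/-- Cycles. -/
def IsCyc {k : ℕ} (c : Ch k X) : Prop :=
  match k, c with
  | 0, _ => True
  | _ + 1, c => bd c = 0

@[simp] lemma isCyc_succ {k : ℕ} (c : Ch (k + 1) X) : IsCyc c ↔ bd c = 0 := Iff.rfl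

lemma IsCyc.mp {k : ℕ} {c : Ch k X} (hc : IsCyc c) (f : C(X, Y)) : IsCyc (mp f c) := by
  cases k with
  | zero => trivial
  | succ k => rw [isCyc_succ] at hc ⊢; rw [bd_mp, hc, map_zero]

lemma isCyc_bd {k : ℕ} (c : Ch (k + 1) X) : IsCyc (bd c) := by
  cases k with
  | zero => trivial
  | succ k => exact bd_bd c

lemma IsCyc.sub {k : ℕ} {c c' : Ch k X} (h : IsCyc c) (h' : IsCyc c') : IsCyc (c - c') := by
  cases k with
  | zero => trivial
  | succ k => rw [isCyc_succ] at *; rw [map_sub, h, h', sub_zero]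

lemma IsCyc.neg {k : ℕ} {c : Ch k X} (h : IsCyc c) : IsCyc (-c) := by
  cases k with
  | zero => trivial
  | succ k => rw [isCyc_succ] at *; rw [map_neg, h, neg_zero]

/-- On cycles, the prism operator is a homotopy between the two ends. -/
lemma bd_prismOp {f g : C(X, Y)} (F : f.Homotopy g) {k : ℕ} {c : Ch k X} (hc : IsCyc c) :
    bd (prismOp F k c) = mp f c - mp g c := by
  cases k with
  | zero => exact bd_prismOp_zero F c
  | succ k => rw [bd_prismOp_succ, (isCyc_succ c).1 hc, map_zero, sub_zero]

/-- The class `a` is represented by the cycle `c`. -/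
def Rep {k : ℕ} (c : Ch k X) (a : HZ k (TopCat.of X)) : Prop :=
  ∃ z : (chains (TopCat.of X)).cycles k,
    chEquiv k X (((chains (TopCat.of X)).iCycles k).hom z) = c ∧
      ((chains (TopCat.of X)).homologyπ k).hom z = a

lemma Rep.isCyc {k : ℕ} {c : Ch k X} {a : HZ k (TopCat.of X)} (h : Rep c a) : IsCyc c := by
  obtain ⟨z, rfl, -⟩ := h
  cases k with
  | zero => trivial
  | succ k =>
    rw [isCyc_succ, ← chEquiv_d]
    have := congrArg (fun g => g.hom z) ((chains (TopCat.of X)).iCycles_d (k + 1) k)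
    exact (congrArg (chEquiv k X) this).trans (map_zero _)

lemma exists_rep {k : ℕ} (a : HZ k (TopCat.of X)) : ∃ c, Rep c a := by
  have : Function.Surjective ((chains (TopCat.of X)).homologyπ k).hom :=
    (ModuleCat.epi_iff_surjective _).1 inferInstance
  obtain ⟨z, rfl⟩ := this a
  exact ⟨_, z, rfl, rfl⟩

/-- A cycle is a morphism from `ℤ` to the chains killed by the boundary, so it lifts to the object
of cycles. -/
lemma IsCyc.exists_rep {k : ℕ} {c : Ch k X} (hc : IsCyc c) : ∃ a, Rep c a := by
  let f : ModuleCat.of ℤ ℤ ⟶ (chains (TopCat.of X)).X k :=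
    ModuleCat.ofHom (LinearMap.toSpanSingleton ℤ _ ((chEquiv k X).symm c))
  have hf1 : f.hom (1 : ℤ) = (chEquiv k X).symm c :=
    (Module.toDistribMulAction (R := ℤ) (M := MCh k X)).one_smul _
  have key : ∀ j, (ComplexShape.down ℕ).next k = j → f ≫ (chains (TopCat.of X)).d k j = 0 := by
    rintro j rfl
    cases k with
    | zero => rw [(chains (TopCat.of X)).shape _ _ (by simp), Limits.comp_zero]
    | succ k =>
      rw [ChainComplex.next_nat_succ]
      refine ModuleCat.hom_ext (LinearMap.ext_ring ?_)
      change md k X (f.hom (1 : ℤ)) = 0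
      rw [hf1, ← (chEquiv k X).map_eq_zero_iff, chEquiv_d, LinearEquiv.apply_symm_apply]
      exact hc
  let z := ((chains (TopCat.of X)).liftCycles f _ rfl (key _ rfl)).hom (1 : ℤ)
  refine ⟨_, z, ?_, rfl⟩
  have := congrArg (fun g => g.hom (1 : ℤ))
    ((chains (TopCat.of X)).liftCycles_i f _ rfl (key _ rfl))
  have h2 : ((chains (TopCat.of X)).iCycles k).hom z = f.hom (1 : ℤ) := this
  rw [h2, hf1, LinearEquiv.apply_symm_apply]

lemma Rep.add {k : ℕ} {c c' : Ch k X} {a a' : HZ k (TopCat.of X)} (h : Rep c a) (h' : Rep c' a') :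
    Rep (c + c') (a + a') := by
  obtain ⟨z, rfl, rfl⟩ := h
  obtain ⟨z', rfl, rfl⟩ := h'
  exact ⟨z + z', by rw [map_add, map_add], by rw [map_add]; rfl⟩

lemma Rep.neg {k : ℕ} {c : Ch k X} {a : HZ k (TopCat.of X)} (h : Rep c a) : Rep (-c) (-a) := by
  obtain ⟨z, rfl, rfl⟩ := h
  exact ⟨-z, by rw [map_neg, map_neg], by rw [map_neg]; rfl⟩

lemma Rep.sub {k : ℕ} {c c' : Ch k X} {a a' : HZ k (TopCat.of X)} (h : Rep c a) (h' : Rep c' a') :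
    Rep (c - c') (a - a') := by
  rw [sub_eq_add_neg, sub_eq_add_neg]
  exact h.add h'.neg

/-- A cycle represents zero if and only if it is a boundary. -/
lemma Rep.eq_zero_iff {k : ℕ} {c : Ch k X} {a : HZ k (TopCat.of X)} (h : Rep c a) :
    a = 0 ↔ ∃ e : Ch (k + 1) X, bd e = c := by
  obtain ⟨z, rfl, rfl⟩ := h
  have hw := (chains (TopCat.of X)).toCycles_comp_homologyπ (k + 1) k
  -- Homology is the cokernel of the map from chains to cycles, so its kernel consists of
  -- boundaries.
  have hex : (ShortComplex.mk _ _ hw).Exact :=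
    ShortComplex.exact_of_g_is_cokernel _ ((chains (TopCat.of X)).homologyIsCokernel (k + 1) k
      (by simp))
  rw [ShortComplex.moduleCat_exact_iff] at hex
  have hi (y : MCh (k + 1) X) : ((chains (TopCat.of X)).iCycles k).hom
      (((chains (TopCat.of X)).toCycles (k + 1) k).hom y) = md k X y :=
    congrArg (fun g => g.hom y) ((chains (TopCat.of X)).toCycles_i (k + 1) k)
  constructor
  · intro h0
    obtain ⟨y, hy⟩ := hex z h0
    refine ⟨chEquiv (k + 1) X y, ?_⟩
    rw [← chEquiv_d, ← hi]
    exact congrArg _ (congrArg _ hy)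
  · rintro ⟨e, he⟩
    obtain ⟨y, rfl⟩ := (chEquiv (k + 1) X).surjective e
    rw [← chEquiv_d, EmbeddingLike.apply_eq_iff_eq, ← hi] at he
    have hinj : Function.Injective ((chains (TopCat.of X)).iCycles k).hom :=
      (ModuleCat.mono_iff_injective _).1 inferInstance
    rw [← hinj he]
    exact congrArg (fun g => g.hom y) hw

lemma Rep.unique {k : ℕ} {c : Ch k X} {a a' : HZ k (TopCat.of X)} (h : Rep c a) (h' : Rep c a') :
    a = a' := by
  rw [← sub_eq_zero, (h.sub h').eq_zero_iff]
  exact ⟨0, by simp⟩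

lemma Rep.congr {k : ℕ} {c c' : Ch k X} {a : HZ k (TopCat.of X)} (h : Rep c a)
    (e : Ch (k + 1) X) (he : bd e = c - c') : Rep c' a := by
  have hc' : IsCyc c' := by
    have := h.isCyc.sub (isCyc_bd e)
    rwa [he, sub_sub_cancel] at this
  obtain ⟨a', ha'⟩ := hc'.exists_rep
  have := (h.sub ha').eq_zero_iff.2 ⟨e, he⟩
  rwa [sub_eq_zero.1 this]

lemma Rep.pushforward {k : ℕ} {c : Ch k X} {a : HZ k (TopCat.of X)} (h : Rep c a)
    (f : C(X, Y)) : Rep (ConePoint.mp f c) ((pushforward k (TopCat.ofHom f)).hom a) := by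
  obtain ⟨z, rfl, rfl⟩ := h
  let φ := ((singularChainComplexFunctor (ModuleCat.{0} ℤ)).obj
      (ModuleCat.of ℤ ℤ)).map (TopCat.ofHom f)
  refine ⟨(HomologicalComplex.cyclesMap φ k).hom z, ?_, ?_⟩
  · rw [← chEquiv_map]
    exact congrArg _ (congrArg (fun g => g.hom z) (HomologicalComplex.cyclesMap_i φ k))
  · exact (congrArg (fun g => g.hom z) (HomologicalComplex.homologyπ_naturality φ k)).symm

lemma Rep.sweep {k : ℕ} {c : Ch k X} {a : HZ k (TopCat.of X)} (h : Rep c a) {f : C(X, Y)}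
    (F : TopCat.Homotopy (TopCat.ofHom f) (TopCat.ofHom f)) :
    Rep (prismOp F k c) ((sweep F k).hom a) := by
  obtain ⟨z, rfl, rfl⟩ := h
  refine ⟨(prismCycles F k).hom z, ?_, ?_⟩
  · have : ((chains (TopCat.of Y)).iCycles (k + 1)).hom ((prismCycles F k).hom z) =
        (prism F k).hom (((chains (TopCat.of X)).iCycles k).hom z) :=
      congrArg (fun g => g.hom z) ((chains (TopCat.of Y)).liftCycles_i _ k (by simp)
        (iCycles_prism_d F k))
    rw [this, prismOp, LinearMap.comp_apply, LinearMap.comp_apply, LinearEquiv.coe_coe,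
      LinearEquiv.coe_coe, LinearEquiv.symm_apply_apply]
    rfl
  · exact (congrArg (fun g => g.hom z) (homologyπ_sweep F k)).symm

end Chains

end

/-! ### Natural operators and acyclic models -/

section

open CategoryTheory AlgebraicTopology Simplicial
section NaturalOperators

variable {X Y Z : Type} [TopologicalSpace X] [TopologicalSpace Y] [TopologicalSpace Z]

lemma exists_bd_of_unit {k : ℕ} (c : Ch (k + 1) Unit) (hc : bd c = 0) : ∃ e, bd e = c := by
  obtain ⟨a, ha⟩ := IsCyc.exists_rep (c := c) hc
  have hz := isZero_singularHomologyFunctor_of_totallyDisconnectedSpace (ModuleCat.{0} ℤ) (k + 1)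
    (ModuleCat.of ℤ ℤ) (TopCat.of Unit) (by simp)
  have := ModuleCat.subsingleton_of_isZero hz
  exact ha.eq_zero_iff.1 (Subsingleton.elim (α := HZ (k + 1) (TopCat.of Unit)) _ _)

/-- Homotopic maps agree on cycles up to boundaries. -/
lemma exists_bd_of_homotopic {f g : C(X, Y)} (h : f.Homotopic g) {k : ℕ} {c : Ch k X}
    (hc : IsCyc c) : ∃ e, bd e = mp f c - mp g c :=
  h.elim fun F => ⟨_, bd_prismOp F hc⟩

/-- Contractible spaces have no homology in positive degrees. -/
lemma exists_bd_of_contractible [ContractibleSpace X] {k : ℕ} (c : Ch (k + 1) X)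
    (hc : bd c = 0) : ∃ e, bd e = c := by
  obtain ⟨x, hx⟩ := id_nullhomotopic X
  obtain ⟨e, he⟩ := exists_bd_of_homotopic hx (c := c) hc
  have h1 : ContinuousMap.const X x = (ContinuousMap.const Unit x).comp (ContinuousMap.const X ()) :=
    rfl
  obtain ⟨e', he'⟩ := exists_bd_of_unit (mp (ContinuousMap.const X ()) c) (by rw [bd_mp, hc, map_zero])
  refine ⟨e + mp (ContinuousMap.const Unit x) e', ?_⟩
  rw [map_add, he, bd_mp, he', mp_id, h1, mp_comp]
  abel

/-- The standard simplex. -/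
abbrev Δs (k : ℕ) : Type := stdSimplex ℝ (Fin (k + 1))

instance (k : ℕ) : ContractibleSpace (Δs k) :=
  (convex_stdSimplex ℝ _).contractibleSpace ⟨_, single_mem_stdSimplex ℝ (0 : Fin (k + 1))⟩

/-- The tautological simplex of the standard simplex. -/
def ident (k : ℕ) : Ch k (Δs k) := Finsupp.single (ContinuousMap.id _) 1

/-- The natural operator on chains given by a chain of the standard simplex. -/
def nat {k m : ℕ} (u : Ch m (Δs k)) : Ch k X →ₗ[ℤ] Ch m X :=
  Finsupp.linearCombination ℤ fun σ : Simp k X => mp σ u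

@[simp] lemma nat_single {k m : ℕ} (u : Ch m (Δs k)) (σ : Simp k X) :
    nat u (Finsupp.single σ 1) = mp σ u := by
  simp [nat]

@[simp] lemma mp_ident {k : ℕ} (σ : Simp k X) : mp σ (ident k) = Finsupp.single σ 1 := by
  simp [ident]

/-- Every singular simplex is the image of the tautological one, so natural operators need only be
compared there. -/
lemma Ch.hom_ext {k : ℕ} {M : Type} [AddCommGroup M] {f g : Ch k X →ₗ[ℤ] M}
    (h : ∀ σ : Simp k X, f (mp σ (ident k)) = g (mp σ (ident k))) (c : Ch k X) : f c = g c := by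
  have : f = g := by
    refine Finsupp.lhom_ext' fun σ => LinearMap.ext_ring ?_
    simpa using h σ
  rw [this]

@[simp] lemma nat_ident {k m : ℕ} (u : Ch m (Δs k)) : nat u (ident k) = u := by
  rw [ident, nat_single, mp_id]

lemma mp_nat {k m : ℕ} (u : Ch m (Δs k)) (f : C(X, Y)) (c : Ch k X) :
    mp f (nat u c) = nat u (mp f c) := by
  refine Ch.hom_ext (f := mp f ∘ₗ nat u) (g := nat u ∘ₗ mp f) (fun σ => ?_) c
  simp [mp_comp]

lemma bd_nat {k m : ℕ} (u : Ch (m + 1) (Δs k)) (c : Ch k X) : bd (nat u c) = nat (bd u) c := by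
  refine Ch.hom_ext (f := bd ∘ₗ nat u) (g := nat (bd u)) (fun σ => ?_) c
  simp [bd_mp]

@[simp] lemma nat_id {k : ℕ} (c : Ch k X) : nat (ident k) c = c :=
  Ch.hom_ext (f := nat (ident k)) (g := LinearMap.id) (fun σ => by simp) c

lemma nat_sub {k m : ℕ} (u v : Ch m (Δs k)) (c : Ch k X) : nat (u - v) c = nat u c - nat v c :=
  Ch.hom_ext (f := nat (u - v)) (g := nat u - nat v) (fun σ => by simp) c

@[simp] lemma nat_zero {k m : ℕ} (c : Ch k X) : nat (0 : Ch m (Δs k)) c = 0 :=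
  Ch.hom_ext (f := nat (0 : Ch m (Δs k))) (g := 0) (fun σ => by simp) c

/-- A sequence in which each term is chosen to satisfy a relation with the preceding one. -/
lemma exists_seq_rel {T : ℕ → Type} (z : T 0) (R : ∀ k, T k → T (k + 1) → Prop)
    (h0 : ∃ w, R 0 z w)
    (hs : ∀ k (a : T k) (b : T (k + 1)), R k a b → ∃ w, R (k + 1) b w) :
    ∃ w : ∀ k, T k, w 0 = z ∧ ∀ k, R k (w k) (w (k + 1)) := by
  classical
  -- The choice at each stage must be total. Where the relation has no solution an arbitrary element
  -- is taken; one exists, as every stage is reached by some solvable chain of relations.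
  have key : ∀ k, ∀ a : T k, ∃ w : T (k + 1), (∃ w', R k a w') → R k a w := fun k a => by
    by_cases h : ∃ w', R k a w'
    · exact ⟨h.choose, fun _ => h.choose_spec⟩
    · by_cases h' : Nonempty (T (k + 1))
      · exact ⟨h'.some, fun h'' => absurd h'' h⟩
      · have : ∃ a b, R k a b := by
          clear h h' a
          induction k with
          | zero => exact ⟨z, h0⟩
          | succ k ih => obtain ⟨a, b, hab⟩ := ih; exact ⟨b, hs k a b hab⟩
        obtain ⟨_, b, -⟩ := this
        exact absurd ⟨b⟩ h'
  choose st hst using key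
  refine ⟨fun k => Nat.rec z (fun k a => st k a) k, rfl, fun k => ?_⟩
  induction k with
  | zero => exact hst 0 z h0
  | succ k ih => exact hst (k + 1) _ (hs k _ _ ih)

/-- A natural endomorphism of the singular chains that vanishes in degree `0` is zero in
homology. -/
lemma exists_bd_nat (u : ∀ k, Ch k (Δs k)) (h0 : u 0 = 0)
    (hu : ∀ k, bd (u (k + 1)) = nat (u k) (bd (ident (k + 1)))) {k : ℕ} {c : Ch k X}
    (hc : IsCyc c) : ∃ e, bd e = nat (u k) c := by
  -- The acyclic models argument: a natural null-homotopy is built on the standard simplices, each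
  -- step solvable because the simplex is contractible and the right side is a cycle.
  obtain ⟨w, w0, hw⟩ := exists_seq_rel (T := fun k => Ch (k + 1) (Δs k)) 0
    (fun k a b => bd b = u (k + 1) - nat a (bd (ident (k + 1))))
    (by
      refine exists_bd_of_contractible _ ?_
      simp [hu, h0])
    (fun k a b h => by
      refine exists_bd_of_contractible _ ?_
      rw [map_sub, hu, bd_nat, h, nat_sub]
      have : nat (nat a (bd (ident (k + 1)))) (bd (ident (k + 1 + 1))) = 0 := by
        have (c : Ch (k + 1) (Δs (k + 1 + 1))) : nat (nat a (bd (ident (k + 1)))) c =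
            nat a (bd c) := Ch.hom_ext (f := nat (nat a (bd (ident (k + 1)))))
              (g := nat a ∘ₗ bd) (fun σ => by
                rw [mp_ident, nat_single, ← mp_ident, LinearMap.comp_apply, bd_mp, mp_nat]) c
        rw [this, bd_bd, map_zero]
      rw [this, sub_zero, sub_self])
  refine ⟨nat (w k) c, ?_⟩
  cases k with
  | zero => rw [w0, h0]; simp
  | succ k =>
    have : nat (nat (w k) (bd (ident (k + 1)))) c = nat (w k) (bd c) :=
      Ch.hom_ext (f := nat (nat (w k) (bd (ident (k + 1)))))
        (g := nat (w k) ∘ₗ bd) (fun σ => by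
          rw [mp_ident, nat_single, ← mp_ident, LinearMap.comp_apply, bd_mp, mp_nat]) c
    rw [bd_nat, hw, nat_sub, this, (isCyc_succ c).1 hc, map_zero, sub_zero]

/-- A natural transformation of degree `1` of the singular chains is zero in homology. -/
lemma exists_bd_nat_one (u : ∀ k, Ch (k + 1) (Δs k)) (h0 : bd (u 0) = 0)
    (hu : ∀ k, bd (u (k + 1)) = -nat (u k) (bd (ident (k + 1)))) {k : ℕ} {c : Ch k X}
    (hc : IsCyc c) : ∃ e, bd e = nat (u k) c := by
  obtain ⟨w₀, hw₀⟩ := exists_bd_of_contractible _ h0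
  have aux : ∀ {k : ℕ} {Y : Type} [TopologicalSpace Y] (a : Ch (k + 2) (Δs k)) (c : Ch (k + 1) Y),
      nat (nat a (bd (ident (k + 1)))) c = nat a (bd c) := fun {k Y} _ a c =>
    Ch.hom_ext (f := nat (nat a (bd (ident (k + 1))))) (g := nat a ∘ₗ bd) (fun σ => by
      rw [mp_ident, nat_single, ← mp_ident, LinearMap.comp_apply, bd_mp, mp_nat]) c
  -- The operator sought has degree two and should satisfy `d w - w d = u`, which accounts for the
  -- sign of `a`. The start `w₀` is a filling of `u 0`, which need not vanish here.
  obtain ⟨w, w0, hw⟩ := exists_seq_rel (T := fun k => Ch (k + 2) (Δs k)) w₀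
    (fun k a b => bd b = u (k + 1) - nat (-a) (bd (ident (k + 1))))
    (by
      refine exists_bd_of_contractible _ ?_
      rw [map_sub, bd_nat, map_neg, hw₀, hu, sub_eq_zero]
      exact (Ch.hom_ext (f := -nat (u 0)) (g := nat (-u 0)) (fun σ => by simp) _))
    (fun k a b h => by
      refine exists_bd_of_contractible _ ?_
      rw [map_sub, bd_nat, map_neg, h, neg_sub, nat_sub, aux, bd_bd, map_zero, zero_sub, hu,
        sub_self])
  refine ⟨nat (w k) c, ?_⟩
  cases k with
  | zero => rw [w0, bd_nat, hw₀]
  | succ k =>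
    rw [bd_nat, hw, nat_sub, aux, (isCyc_succ c).1 hc, map_zero, sub_zero]

/-- The prism operator of a constant homotopy is zero in homology. -/
lemma exists_bd_prismOp_refl {k : ℕ} {c : Ch k X} (hc : IsCyc c) :
    ∃ e, bd e = prismOp (ContinuousMap.Homotopy.refl (ContinuousMap.id X)) k c := by
  have key : ∀ {k : ℕ} {Y : Type} [TopologicalSpace Y] (c : Ch k Y),
      prismOp (ContinuousMap.Homotopy.refl (ContinuousMap.id Y)) k c =
        nat (prismOp (ContinuousMap.Homotopy.refl (ContinuousMap.id _)) k (ident k)) c :=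
    fun {k Y} _ c => Ch.hom_ext (f := prismOp (ContinuousMap.Homotopy.refl (ContinuousMap.id Y)) k)
      (fun σ => by
        rw [mp_ident, nat_single, ← mp_ident, prismOp_mp, mp_prismOp]
        rfl) c
  obtain ⟨e, he⟩ := exists_bd_nat_one
    (fun k => prismOp (ContinuousMap.Homotopy.refl (ContinuousMap.id _)) k (ident k))
    (by rw [bd_prismOp_zero, sub_self])
    (fun k => by rw [bd_prismOp_succ, sub_self, zero_sub, key]) hc
  exact ⟨e, by rw [he, ← key]⟩

end NaturalOperators

end

/-! ### Barycentric subdivision -/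

section

open CategoryTheory AlgebraicTopology Simplicial
section Subdivision

variable {E E' : Type} {K : Set E} {K' : Set E'}

/-- Chains of affine simplices of a convex set, given by their vertices. -/
abbrev AC (j : ℕ) (K : Set E) : Type := (Fin (j + 1) → K) →₀ ℤ

/-- The boundary of a chain of affine simplices. -/
def abd {j : ℕ} : AC (j + 1) K →ₗ[ℤ] AC j K :=
  Finsupp.linearCombination ℤ fun v : Fin (j + 2) → K =>
    ∑ i : Fin (j + 2), (-1 : ℤ) ^ (i : ℕ) • Finsupp.single (fun l => v (i.succAbove l)) (1 : ℤ)

/-- The map on affine chains induced by a map on vertices. -/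
def acm (f : K → K') {j : ℕ} : AC j K →ₗ[ℤ] AC j K' := Finsupp.lmapDomain ℤ ℤ fun v l => f (v l)

/-- The join of affine chains with a point. -/
def acone (b : K) {j : ℕ} : AC j K →ₗ[ℤ] AC (j + 1) K :=
  Finsupp.lmapDomain ℤ ℤ fun v => (Fin.cons b v : Fin (j + 2) → K)

@[simp] lemma abd_single {j : ℕ} (v : Fin (j + 2) → K) : abd (Finsupp.single v 1) =
    ∑ i : Fin (j + 2), (-1 : ℤ) ^ (i : ℕ) • Finsupp.single (fun l => v (i.succAbove l)) 1 := by
  simp [abd]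

@[simp] lemma acm_single (f : K → K') {j : ℕ} (v : Fin (j + 1) → K) (n : ℤ) :
    acm f (Finsupp.single v n) = Finsupp.single (fun l => f (v l)) n := by
  simp [acm]

@[simp] lemma acone_single (b : K) {j : ℕ} (v : Fin (j + 1) → K) (n : ℤ) :
    acone b (Finsupp.single v n) = Finsupp.single (Fin.cons b v : Fin (j + 2) → K) n := by
  simp [acone]

lemma AC.hom_ext {j : ℕ} {M : Type} [AddCommGroup M] {f g : AC j K →ₗ[ℤ] M}
    (h : ∀ v, f (Finsupp.single v 1) = g (Finsupp.single v 1)) (c : AC j K) : f c = g c := by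
  have : f = g := Finsupp.lhom_ext' fun σ => LinearMap.ext_ring (h σ)
  rw [this]

lemma abd_acm (f : K → K') {j : ℕ} (c : AC (j + 1) K) : abd (acm f c) = acm f (abd c) :=
  AC.hom_ext (f := abd ∘ₗ acm f) (g := acm f ∘ₗ abd) (fun v => by simp) c

lemma acm_acone (f : K → K') (b : K) {j : ℕ} (c : AC j K) :
    acm f (acone b c) = acone (f b) (acm f c) := by
  refine AC.hom_ext (f := acm f ∘ₗ acone b) (g := acone (f b) ∘ₗ acm f) (fun v => ?_) c
  simp only [LinearMap.comp_apply, acone_single, acm_single]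
  congr 1
  funext l
  refine Fin.cases ?_ (fun l => ?_) l <;> simp

lemma abd_acone_single (b : K) {j : ℕ} (v : Fin (j + 1) → K) :
    abd (acone b (Finsupp.single v 1)) = Finsupp.single v 1 -
      ∑ i : Fin (j + 1), (-1 : ℤ) ^ (i : ℕ) •
        Finsupp.single (fun l => (Fin.cons b v : Fin (j + 2) → K) (i.succ.succAbove l)) 1 := by
  rw [acone_single, abd_single, Fin.sum_univ_succ]
  simp [pow_succ, sub_eq_add_neg, Finset.sum_neg_distrib]

lemma abd_acone_succ (b : K) {j : ℕ} (c : AC (j + 1) K) :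
    abd (acone b c) = c - acone b (abd c) := by
  refine AC.hom_ext (f := abd ∘ₗ acone b) (g := LinearMap.id - acone b ∘ₗ abd) (fun v => ?_) c
  rw [LinearMap.comp_apply, abd_acone_single, LinearMap.sub_apply, LinearMap.id_apply,
    LinearMap.comp_apply, abd_single, map_sum]
  simp only [map_zsmul, acone_single]
  congr 1
  refine Finset.sum_congr rfl fun i _ => ?_
  congr 2
  funext l
  refine Fin.cases ?_ (fun l => ?_) l <;> simp

/-- In degree zero the cone formula has an augmentation term, the cone point. In `abd_Sd` it cancels
because the two ends of an edge carry opposite signs. -/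
lemma abd_acone_zero (b : K) (v : Fin 1 → K) :
    abd (acone b (Finsupp.single v 1)) = Finsupp.single v 1 - Finsupp.single (fun _ => b) 1 := by
  rw [abd_acone_single]
  congr 1
  refine (Fin.sum_univ_one _).trans ?_
  rw [Fin.val_zero, pow_zero, one_smul]
  congr 1
  funext l
  obtain rfl : l = 0 := Fin.fin_one_eq_zero l
  rfl

variable [NormedAddCommGroup E] [NormedSpace ℝ E] [NormedAddCommGroup E'] [NormedSpace ℝ E']
  (hK : Convex ℝ K) (hK' : Convex ℝ K')

/-- The affine simplex with given vertices. -/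
def aff {j : ℕ} (v : Fin (j + 1) → K) : Simp j K where
  toFun t := ⟨∑ i, t i • (v i : E), hK.sum_mem (fun i _ => stdSimplex.zero_le t i)
    (stdSimplex.sum_eq_one t) fun i _ => (v i).2⟩
  continuous_toFun := by
    refine Continuous.subtype_mk (continuous_finsetSum _ fun i _ => ?_) _
    have : Continuous fun t : stdSimplex ℝ (Fin (j + 1)) => t i :=
      (continuous_apply i).comp continuous_subtype_val
    exact this.smul continuous_const

lemma aff_apply {j : ℕ} (v : Fin (j + 1) → K) (t : Δs j) :
    (aff hK v t : E) = ∑ i, t i • (v i : E) := rfl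

lemma aff_vertex {j : ℕ} (v : Fin (j + 1) → K) (i : Fin (j + 1)) :
    aff hK v (stdSimplex.vertex i) = v i := by
  apply Subtype.ext
  rw [aff_apply, Finset.sum_eq_single i]
  · simp
  · intro l _ hl
    simp [Pi.single_eq_of_ne hl]
  · simp

lemma aff_injective {j : ℕ} : Function.Injective (aff hK (j := j)) := fun v w h => by
  funext i
  rw [← aff_vertex hK v, h, aff_vertex]

lemma aff_face {j : ℕ} (v : Fin (j + 2) → K) (i : Fin (j + 2)) :
    (aff hK v).comp (faceMap j i) = aff hK fun l => v (i.succAbove l) := by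
  ext t
  change ∑ l, (stdSimplex.map i.succAbove t) l • (v l : E) = ∑ l, t l • (v (i.succAbove l) : E)
  simp only [stdSimplex.map_coe, FunOnFinite.linearMap_apply_apply, Finset.sum_smul]
  rw [Finset.sum_sigma']
  refine Finset.sum_bij' (fun p _ => p.2) (fun l _ => ⟨i.succAbove l, l⟩) ?_ ?_ ?_ ?_ ?_ <;>
    simp +contextual

/-- The singular chain of an affine chain. -/
def affCh {j : ℕ} : AC j K →ₗ[ℤ] Ch j K := Finsupp.lmapDomain ℤ ℤ (aff hK)

@[simp] lemma affCh_single {j : ℕ} (v : Fin (j + 1) → K) (n : ℤ) :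
    affCh hK (Finsupp.single v n) = Finsupp.single (aff hK v) n := by
  simp [affCh]

lemma bd_affCh {j : ℕ} (c : AC (j + 1) K) : bd (affCh hK c) = affCh hK (abd c) :=
  AC.hom_ext (f := bd ∘ₗ affCh hK) (g := affCh hK ∘ₗ abd) (fun v => by
    simp [bd_single, bdSimp, aff_face]) c

/-- Affine chains embed in singular chains, as an affine simplex determines its vertices, so `bd_bd`
applies. -/
lemma abd_abd (hK : Convex ℝ K) {j : ℕ} (c : AC (j + 1 + 1) K) : abd (abd c) = 0 := by
  have : Function.Injective (affCh hK (j := j)) := Finsupp.mapDomain_injective (aff_injective hK)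
  apply this
  rw [← bd_affCh, ← bd_affCh, bd_bd, map_zero]

/-- The barycenter of a simplex. -/
def bary {j : ℕ} (v : Fin (j + 1) → K) : K := aff hK v stdSimplex.barycenter

/-- Barycentric subdivision of affine chains. -/
def Sd (j : ℕ) : AC j K →ₗ[ℤ] AC j K :=
  match j with
  | 0 => LinearMap.id
  | j + 1 => Finsupp.linearCombination ℤ fun v : Fin (j + 2) → K =>
      acone (bary hK v) (Sd j (abd (Finsupp.single v 1)))

lemma Sd_zero (c : AC 0 K) : Sd hK 0 c = c := rfl

lemma Sd_single {j : ℕ} (v : Fin (j + 2) → K) : Sd hK (j + 1) (Finsupp.single v 1) =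
    acone (bary hK v) (Sd hK j (abd (Finsupp.single v 1))) := by
  rw [Sd, Finsupp.linearCombination_single, one_smul]

lemma abd_Sd {j : ℕ} (c : AC (j + 1) K) : abd (Sd hK (j + 1) c) = Sd hK j (abd c) := by
  induction j with
  | zero =>
    refine AC.hom_ext (f := abd ∘ₗ Sd hK 1) (g := Sd hK 0 ∘ₗ abd) (fun v => ?_) c
    simp only [LinearMap.comp_apply, Sd_single, Sd_zero, abd_single, map_sum, map_zsmul]
    simp only [abd_acone_zero]
    simp [sub_eq_add_neg]
    abel
  | succ j ih =>
    refine AC.hom_ext (f := abd ∘ₗ Sd hK (j + 2)) (g := Sd hK (j + 1) ∘ₗ abd) (fun v => ?_) c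
    simp only [LinearMap.comp_apply]
    rw [Sd_single, abd_acone_succ, ih, abd_abd hK, map_zero, map_zero, sub_zero]

/-- A map of convex sets is affine if it takes affine simplices to affine simplices. -/
def IsAffineMap (f : K → K') : Prop :=
  ∀ (j : ℕ) (v : Fin (j + 1) → K) (t : Δs j), f (aff hK v t) = aff hK' (fun l => f (v l)) t

lemma isAffineMap_aff {k : ℕ} (v : Fin (k + 1) → K) :
    IsAffineMap (convex_stdSimplex ℝ (Fin (k + 1))) hK (aff hK v) := by
  intro j w t
  apply Subtype.ext
  simp only [aff_apply, Finset.smul_sum]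
  rw [Finset.sum_comm]
  refine Finset.sum_congr rfl fun i _ => ?_
  have : aff (convex_stdSimplex ℝ (Fin (k + 1))) w t i = ∑ l, t l * w l i := by
    have := congrFun (aff_apply (convex_stdSimplex ℝ (Fin (k + 1))) w t) i
    rw [Finset.sum_apply] at this
    exact this
  rw [this, Finset.sum_smul]
  simp [mul_smul]

lemma acm_Sd {f : K → K'} (hf : IsAffineMap hK hK' f) {j : ℕ} (c : AC j K) :
    acm f (Sd hK j c) = Sd hK' j (acm f c) := by
  induction j with
  | zero => rfl
  | succ j ih =>
    refine AC.hom_ext (f := acm f ∘ₗ Sd hK (j + 1)) (g := Sd hK' (j + 1) ∘ₗ acm f) (fun v => ?_) c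
    simp only [LinearMap.comp_apply]
    rw [Sd_single, acm_acone, ih, ← abd_acm, acm_single, Sd_single, bary, hf]
    rfl

lemma mp_affCh {f : C(K, K')} (hf : IsAffineMap hK hK' f) {j : ℕ} (c : AC j K) :
    mp f (affCh hK c) = affCh hK' (acm f c) := by
  refine AC.hom_ext (f := mp f ∘ₗ affCh hK) (g := affCh hK' ∘ₗ acm f) (fun v => ?_) c
  simp only [LinearMap.comp_apply, affCh_single, mp_single, acm_single]
  congr 1
  ext t
  exact congrArg _ (hf j v t)

/-- The vertices of the standard simplex. -/
def vert (k : ℕ) (i : Fin (k + 1)) : Δs k := stdSimplex.vertex i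

lemma aff_vert (k : ℕ) : aff (convex_stdSimplex ℝ (Fin (k + 1))) (vert k) = .id _ := by
  ext t i
  refine (congrFun (aff_apply (convex_stdSimplex ℝ (Fin (k + 1))) (vert k) t) i).trans ?_
  rw [Finset.sum_apply]
  simp [vert, Pi.single_apply]

/-- The barycentric subdivision of the standard simplex. -/
def sdIdent (k : ℕ) : Ch k (Δs k) :=
  affCh (convex_stdSimplex ℝ (Fin (k + 1)))
    (Sd (convex_stdSimplex ℝ (Fin (k + 1))) k (Finsupp.single (vert k) 1))

/-- Barycentric subdivision commutes with the passage from affine to singular chains. -/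
lemma nat_sdIdent_affCh {k : ℕ} (c : AC k K) :
    nat (sdIdent k) (affCh hK c) = affCh hK (Sd hK k c) := by
  refine AC.hom_ext (f := nat (sdIdent k) ∘ₗ affCh hK) (g := affCh hK ∘ₗ Sd hK k) (fun v => ?_) c
  simp only [LinearMap.comp_apply, affCh_single, nat_single]
  rw [sdIdent, mp_affCh _ hK (isAffineMap_aff hK v), acm_Sd _ hK (isAffineMap_aff hK v), acm_single]
  congr 4
  funext l
  exact aff_vertex hK v l

lemma affCh_vert (k : ℕ) :
    affCh (convex_stdSimplex ℝ (Fin (k + 1))) (Finsupp.single (vert k) 1) = ident k := by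
  rw [affCh_single, aff_vert, ident]

lemma bd_sdIdent (k : ℕ) : bd (sdIdent (k + 1)) = nat (sdIdent k) (bd (ident (k + 1))) := by
  rw [← affCh_vert, bd_affCh, nat_sdIdent_affCh, sdIdent, bd_affCh, abd_Sd]

variable {X Y : Type} [TopologicalSpace X] [TopologicalSpace Y]

/-- Barycentric subdivision of singular chains. -/
abbrev sd {k : ℕ} : Module.End ℤ (Ch k X) := nat (sdIdent k)

lemma bd_sd {k : ℕ} (c : Ch (k + 1) X) : bd (sd c) = sd (bd c) :=
  Ch.hom_ext (f := bd ∘ₗ sd) (g := sd ∘ₗ bd) (fun σ => by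
    rw [LinearMap.comp_apply, LinearMap.comp_apply, bd_mp, ← mp_nat, ← mp_nat, bd_mp, nat_ident,
      bd_sdIdent]) c

lemma bd_sd_pow {k : ℕ} (m : ℕ) (c : Ch (k + 1) X) : bd ((sd ^ m) c) = (sd ^ m) (bd c) := by
  induction m with
  | zero => simp
  | succ m ih => rw [pow_succ', Module.End.mul_apply, bd_sd, ih, pow_succ', Module.End.mul_apply]

lemma mp_sd_pow {k : ℕ} (m : ℕ) (f : C(X, Y)) (c : Ch k X) :
    mp f ((sd ^ m) c) = (sd ^ m) (mp f c) := by
  induction m with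
  | zero => simp
  | succ m ih => rw [pow_succ', Module.End.mul_apply, mp_nat, ih, pow_succ', Module.End.mul_apply]

lemma IsCyc.sd_pow {k : ℕ} {c : Ch k X} (hc : IsCyc c) (m : ℕ) : IsCyc ((sd ^ m) c) := by
  cases k with
  | zero => trivial
  | succ k => rw [isCyc_succ, bd_sd_pow, (isCyc_succ c).1 hc, map_zero]

/-- A cycle is homologous to its subdivisions. -/
lemma exists_bd_sd_pow {k : ℕ} {c : Ch k X} (hc : IsCyc c) (m : ℕ) :
    ∃ e, bd e = (sd ^ m) c - c := by
  induction m with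
  | zero => exact ⟨0, by simp⟩
  | succ m ih =>
    obtain ⟨e, he⟩ := ih
    -- The difference of subdivision and identity is a natural chain map which vanishes in degree
    -- zero.
    obtain ⟨e', he'⟩ := exists_bd_nat (fun k => sdIdent k - ident k)
      (by rw [sdIdent, Sd_zero, affCh_vert, sub_self])
      (fun k => by rw [map_sub, bd_sdIdent, nat_sub, nat_id]) (hc.sd_pow m)
    refine ⟨e' + e, ?_⟩
    rw [map_add, he, he', nat_sub, nat_id, pow_succ', Module.End.mul_apply]
    abel

end Subdivision

end

/-! ### Subdivision makes simplices small -/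

section

open CategoryTheory AlgebraicTopology Simplicial
section Mesh

variable {E : Type} [NormedAddCommGroup E] [NormedSpace ℝ E] {K : Set E} (hK : Convex ℝ K)

/-- Membership in a submodule of chains is preserved by a linear map if this holds on generators. -/
lemma map_mem_of_supported {α M : Type} [AddCommGroup M] {s : Set α} (f : (α →₀ ℤ) →ₗ[ℤ] M)
    {N : Submodule ℤ M} (h : ∀ a ∈ s, f (Finsupp.single a 1) ∈ N) {c : α →₀ ℤ}
    (hc : c ∈ Finsupp.supported ℤ ℤ s) : f c ∈ N := by
  rw [Finsupp.supported_eq_span_single] at hc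
  have : Submodule.span ℤ ((fun i => Finsupp.single i (1 : ℤ)) '' s) ≤ N.comap f :=
    Submodule.span_le.2 (by rintro _ ⟨a, ha, rfl⟩; exact h a ha)
  exact this hc

lemma single_mem_supported {α : Type} {s : Set α} {a : α} (ha : a ∈ s) (n : ℤ) :
    Finsupp.single a n ∈ Finsupp.supported ℤ ℤ s :=
  Finsupp.single_mem_supported ℤ n ha

lemma bary_mem_convexHull {j : ℕ} (v : Fin (j + 1) → K) (t : Δs j) :
    (aff hK v t : E) ∈ convexHull ℝ (Set.range fun i => (v i : E)) := by
  rw [aff_apply]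
  exact (convex_convexHull ℝ _).sum_mem (fun i _ => stdSimplex.zero_le t i)
    (stdSimplex.sum_eq_one t) fun i _ => subset_convexHull ℝ _ ⟨i, rfl⟩

/-- The barycenter averages `j + 2` vertices. In its difference from a given vertex that vertex
contributes zero, leaving `j + 1` terms of size at most `D / (j + 2)`. Convexity of balls passes
from vertices to the hull. -/
lemma dist_bary_le {j : ℕ} (v : Fin (j + 2) → K) {D : ℝ} (hD : ∀ i i', dist (v i) (v i') ≤ D)
    {p : E} (hp : p ∈ convexHull ℝ (Set.range fun i => (v i : E))) :
    dist (bary hK v : E) p ≤ (j + 1) / (j + 2) * D := by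
  have hsub : convexHull ℝ (Set.range fun i => (v i : E)) ⊆
      Metric.closedBall (bary hK v : E) ((j + 1) / (j + 2) * D) := by
    refine convexHull_min ?_ (convex_closedBall _ _)
    rintro _ ⟨i, rfl⟩
    have hb : (bary hK v : E) = ∑ l, ((j : ℝ) + 2)⁻¹ • (v l : E) := by
      rw [bary, aff_apply]
      refine Finset.sum_congr rfl fun l _ => ?_
      congr 1
      refine (stdSimplex.barycenter_apply l).trans ?_
      rw [Fintype.card_fin]
      push_cast
      ring
    have hj : (j : ℝ) + 2 ≠ 0 := by positivity
    rw [Metric.mem_closedBall, dist_comm, dist_eq_norm, hb]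
    have : ∑ l, ((j : ℝ) + 2)⁻¹ • (v l : E) - (v i : E) =
        ∑ l, ((j : ℝ) + 2)⁻¹ • ((v l : E) - v i) := by
      simp only [smul_sub, Finset.sum_sub_distrib]
      congr 1
      rw [Finset.sum_const, Finset.card_univ, Fintype.card_fin, ← Nat.cast_smul_eq_nsmul ℝ,
        smul_smul]
      push_cast
      rw [mul_inv_cancel₀ hj, one_smul]
    rw [this]
    refine (norm_sum_le _ _).trans ?_
    rw [← Finset.add_sum_erase _ _ (Finset.mem_univ i)]
    simp only [sub_self, smul_zero, norm_zero, zero_add]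
    refine (Finset.sum_le_card_nsmul _ _ (((j : ℝ) + 2)⁻¹ * D) fun l _ => ?_).trans ?_
    · rw [norm_smul, Real.norm_of_nonneg (by positivity)]
      have := hD l i
      rw [Subtype.dist_eq, dist_eq_norm] at this
      gcongr
    · rw [Finset.card_erase_of_mem (Finset.mem_univ i), Finset.card_univ, Fintype.card_fin,
        nsmul_eq_mul]
      push_cast [Nat.add_sub_cancel]
      refine le_of_eq ?_
      field_simp
  have := hsub hp
  rwa [Metric.mem_closedBall, dist_comm] at this

/-- The factor by which subdivision shrinks a simplex of dimension `j`. -/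
def shrink (j : ℕ) : ℝ := j / (j + 1)

/-- The affine simplices spanned by points of the hull of `v` with mesh at most `D`. -/
def meshSet {j : ℕ} (S : Set E) (D : ℝ) : Set (Fin (j + 1) → K) :=
  {w | (∀ i, (w i : E) ∈ S) ∧ ∀ i i', dist (w i) (w i') ≤ D}

/-- A simplex of the subdivision joins the barycenter to a simplex of a subdivided face. Edges at
the barycenter are bounded by `dist_bary_le`, the others by induction, as `shrink` is increasing. -/
lemma Sd_single_mem {j : ℕ} (v : Fin (j + 1) → K) {D : ℝ} (hD : ∀ i i', dist (v i) (v i') ≤ D) :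
    Sd hK j (Finsupp.single v 1) ∈ Finsupp.supported ℤ ℤ
      (meshSet (K := K) (j := j) (convexHull ℝ (Set.range fun i => (v i : E))) (shrink j * D)) := by
  induction j with
  | zero =>
    refine single_mem_supported ?_ _
    refine ⟨fun i => subset_convexHull ℝ _ ⟨i, rfl⟩, fun i i' => ?_⟩
    obtain rfl : i = i' := (Fin.fin_one_eq_zero i).trans (Fin.fin_one_eq_zero i').symm
    simp [shrink]
  | succ j ih =>
    have hD0 : 0 ≤ D := dist_nonneg.trans (hD 0 0)
    rw [Sd_single, abd_single, map_sum, map_sum]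
    refine Submodule.sum_mem _ fun i _ => ?_
    rw [map_zsmul, map_zsmul]
    refine Submodule.smul_mem _ _ ?_
    refine map_mem_of_supported _ ?_ (ih (fun l => v (i.succAbove l)) fun l l' => hD _ _)
    rintro w ⟨hw1, hw2⟩
    have hw1 : ∀ l, (w l : E) ∈ convexHull ℝ (Set.range fun i => (v i : E)) := fun l =>
      convexHull_mono (by rintro _ ⟨m, rfl⟩; exact ⟨_, rfl⟩) (hw1 l)
    have hs : shrink j ≤ shrink (j + 1) := by
      rw [shrink, shrink, div_le_div_iff₀ (by positivity) (by positivity)]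
      push_cast
      nlinarith
    have hs' : shrink (j + 1) = (j + 1) / (j + 2) := by
      rw [shrink]; push_cast; ring
    rw [acone_single]
    refine single_mem_supported ?_ _
    refine ⟨fun l => ?_, fun l l' => ?_⟩
    · refine Fin.cases ?_ (fun l => ?_) l
      · exact bary_mem_convexHull hK v _
      · simpa using hw1 l
    · have hb (l) : dist (bary hK v) (w l) ≤ shrink (j + 1) * D := by
        rw [hs', Subtype.dist_eq]
        exact dist_bary_le hK v hD (hw1 l)
      refine Fin.cases ?_ (fun l => ?_) l <;> refine Fin.cases ?_ (fun l' => ?_) l'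
      · simp only [Fin.cons_zero, dist_self]
        rw [hs']
        positivity
      · simpa using hb l'
      · simpa [dist_comm] using hb l
      · simp only [Fin.cons_succ]
        exact (hw2 l l').trans (by gcongr)

lemma Sd_pow_single_mem {j : ℕ} (v : Fin (j + 1) → K) {D : ℝ}
    (hD : ∀ i i', dist (v i) (v i') ≤ D) (m : ℕ) :
    ((Sd hK j : Module.End ℤ (AC j K)) ^ m) (Finsupp.single v 1) ∈ Finsupp.supported ℤ ℤ
      (meshSet (K := K) (j := j) Set.univ (shrink j ^ m * D)) := by
  induction m with
  | zero =>
    refine single_mem_supported ?_ _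
    exact ⟨fun _ => trivial, by simpa using hD⟩
  | succ m ih =>
    rw [pow_succ' (Sd hK j : Module.End ℤ (AC j K)), Module.End.mul_apply]
    refine map_mem_of_supported _ (fun w hw => ?_) ih
    refine Finsupp.supported_mono ?_ (Sd_single_mem hK w hw.2)
    intro w' hw'
    refine ⟨fun _ => trivial, fun i i' => (hw'.2 i i').trans (le_of_eq ?_)⟩
    ring

variable {X : Type} [TopologicalSpace X]

/-- The singular simplices contained in `U` or in `V`. -/
def smallSimp (k : ℕ) (U V : Set X) : Set (Simp k X) := {σ | Set.range σ ⊆ U ∨ Set.range σ ⊆ V}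

lemma sd_mem_small {k : ℕ} {U V : Set X} {c : Ch k X}
    (hc : c ∈ Finsupp.supported ℤ ℤ (smallSimp k U V)) (m : ℕ) :
    (sd ^ m) c ∈ Finsupp.supported ℤ ℤ (smallSimp k U V) := by
  induction m with
  | zero => exact hc
  | succ m ih =>
    rw [pow_succ', Module.End.mul_apply]
    refine map_mem_of_supported _ (fun σ hσ => ?_) ih
    rw [nat_single]
    refine map_mem_of_supported (s := Set.univ) (mp σ) (fun τ _ => ?_) (by simp)
    rw [mp_single]
    refine single_mem_supported ?_ _
    refine hσ.imp (fun h => ?_) fun h => ?_ <;>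
      exact (by rintro _ ⟨t, rfl⟩; exact h ⟨_, rfl⟩)

/-- Every chain can be subdivided so that each simplex lies in one of two open sets that cover
the space. -/
lemma exists_sd_mem_small {k : ℕ} {U V : Set X} (hU : IsOpen U) (hV : IsOpen V)
    (hUV : U ∪ V = Set.univ) (c : Ch k X) :
    ∃ m, (sd ^ m) c ∈ Finsupp.supported ℤ ℤ (smallSimp k U V) := by
  induction c using Finsupp.induction_linear with
  | zero => exact ⟨0, by simp⟩
  | add c c' h h' =>
    obtain ⟨m, hm⟩ := h
    obtain ⟨m', hm'⟩ := h'
    refine ⟨m + m', ?_⟩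
    rw [map_add]
    refine Submodule.add_mem _ ?_ ?_
    · rw [add_comm, pow_add, Module.End.mul_apply]
      exact sd_mem_small hm _
    · rw [pow_add, Module.End.mul_apply]
      exact sd_mem_small hm' _
  | single σ n =>
    have hσ : Finsupp.single σ n = n • mp σ (ident k) := by simp
    set hS := convex_stdSimplex ℝ (Fin (k + 1))
    -- A Lebesgue number for the preimages of the two sets in the simplex.
    obtain ⟨δ, hδ, hδ'⟩ := lebesgue_number_lemma_of_metric (s := (Set.univ : Set (Δs k)))
      (c := fun b : Bool => σ ⁻¹' (if b then U else V)) isCompact_univ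
      (fun b => by cases b <;> [exact hV.preimage σ.continuous; exact hU.preimage σ.continuous])
      (fun t _ => by
        have : σ t ∈ U ∪ V := hUV ▸ trivial
        rcases this with h | h
        · exact Set.mem_iUnion.2 ⟨true, h⟩
        · exact Set.mem_iUnion.2 ⟨false, h⟩)
    obtain ⟨D, hD⟩ : ∃ D, ∀ i i', dist (vert k i) (vert k i') ≤ D :=
      ⟨Metric.diam (Set.univ : Set (Δs k)), fun i i' =>
        Metric.dist_le_diam_of_mem isCompact_univ.isBounded trivial trivial⟩
    have hs0 : 0 ≤ shrink k := by rw [shrink]; positivity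
    have hs1 : shrink k < 1 := by
      rw [shrink, div_lt_one (by positivity)]; linarith
    obtain ⟨m, hm⟩ : ∃ m : ℕ, shrink k ^ m * D < δ := by
      have := (tendsto_pow_atTop_nhds_zero_of_lt_one hs0 hs1).mul_const D
      rw [zero_mul] at this
      exact ((this.eventually (gt_mem_nhds hδ))).exists
    refine ⟨m, ?_⟩
    have hpow (m : ℕ) (c : AC k (stdSimplex ℝ (Fin (k + 1)))) : (sd ^ m) (affCh hS c) =
        affCh hS (((Sd hS k : Module.End ℤ _) ^ m) c) := by
      induction m with
      | zero => rfl
      | succ m ih =>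
        rw [pow_succ', Module.End.mul_apply, ih, nat_sdIdent_affCh, pow_succ',
          Module.End.mul_apply]
    rw [hσ, map_zsmul, ← mp_sd_pow, ← affCh_vert, hpow]
    refine Submodule.smul_mem _ _ ?_
    refine map_mem_of_supported (mp σ ∘ₗ affCh hS) (fun w hw => ?_) (Sd_pow_single_mem hS _ hD m)
    rw [LinearMap.comp_apply, affCh_single, mp_single]
    refine single_mem_supported ?_ _
    obtain ⟨b, hb⟩ := hδ' (w 0) trivial
    have hball (t) : σ (aff hS w t) ∈ if b then U else V := by
      refine hb (show _ ∈ Metric.ball _ _ from ?_)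
      rw [Metric.mem_ball, Subtype.dist_eq]
      -- All vertices are within `δ` of the first one, hence so is the whole affine simplex.
      have h1 : convexHull ℝ (Set.range fun i => (w i : Fin (k + 1) → ℝ)) ⊆
          Metric.ball (w 0 : Fin (k + 1) → ℝ) δ := by
        refine convexHull_min ?_ (convex_ball _ _)
        rintro _ ⟨i, rfl⟩
        have := hw.2 i 0
        rw [Subtype.dist_eq] at this
        exact this.trans_lt hm
      exact h1 (bary_mem_convexHull hS w t)
    cases b with
    | true => exact Or.inl (by rintro _ ⟨t, rfl⟩; exact hball t)
    | false => exact Or.inr (by rintro _ ⟨t, rfl⟩; simpa using hball t)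

end Mesh

end

/-! ### Mayer-Vietoris on chains -/

section

open CategoryTheory AlgebraicTopology Simplicial Topology
section MayerVietoris

variable {A U M X Y : Type} [TopologicalSpace A] [TopologicalSpace U] [TopologicalSpace M]
  [TopologicalSpace X] [TopologicalSpace Y]

lemma exists_lift_simp {f : C(Y, X)} (hf : IsEmbedding f) {k : ℕ} {σ : Simp k X}
    (hσ : Set.range σ ⊆ Set.range f) : ∃ τ : Simp k Y, f.comp τ = σ := by
  choose τ hτ using fun t => hσ ⟨t, rfl⟩
  have hc : f ∘ τ = σ := funext hτ
  exact ⟨⟨τ, hf.continuous_iff.2 (hc ▸ σ.continuous)⟩, ContinuousMap.ext hτ⟩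

lemma mp_injective {f : C(Y, X)} (hf : Function.Injective f) {k : ℕ} :
    Function.Injective (mp f (k := k)) :=
  Finsupp.mapDomain_injective fun _ _ h => ContinuousMap.ext fun t =>
    hf (congrArg (fun ρ : Simp k X => ρ t) h)

/-- The singular simplices contained in a set. -/
def simpIn (k : ℕ) (U : Set X) : Set (Simp k X) := {σ | Set.range σ ⊆ U}

lemma exists_mp_eq {f : C(Y, X)} (hf : IsEmbedding f) {k : ℕ} {c : Ch k X}
    (hc : c ∈ Finsupp.supported ℤ ℤ (simpIn k (Set.range f))) :
    ∃ c', mp f c' = c := by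
  refine map_mem_of_supported LinearMap.id (N := LinearMap.range (mp f)) (fun σ hσ => ?_) hc
  obtain ⟨τ, rfl⟩ := exists_lift_simp hf hσ
  exact ⟨Finsupp.single τ 1, by simp⟩

lemma mp_mem_supported (f : C(Y, X)) {k : ℕ} (c : Ch k Y) :
    mp f c ∈ Finsupp.supported ℤ ℤ (simpIn k (Set.range f)) := by
  refine map_mem_of_supported (s := Set.univ) (mp f) (fun τ _ => ?_) (by simp)
  rw [mp_single]
  refine single_mem_supported ?_ _
  rintro _ ⟨t, rfl⟩
  exact ⟨_, rfl⟩

lemma IsCyc.of_mp {f : C(Y, X)} (hf : Function.Injective f) {k : ℕ} {c : Ch k Y}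
    (hc : IsCyc (ConePoint.mp f c)) : IsCyc c := by
  cases k with
  | zero => trivial
  | succ k =>
    rw [isCyc_succ, bd_mp] at hc
    exact mp_injective hf (hc.trans (map_zero _).symm)

/-- A space `X` covered by two open subspaces `U` and `M` with intersection `A`. -/
structure MVSquare (A U M X : Type) [TopologicalSpace A] [TopologicalSpace U] [TopologicalSpace M]
    [TopologicalSpace X] where
  /-- the inclusion of `U` -/
  f : C(U, X)
  /-- the inclusion of `M` -/
  g : C(M, X)
  /-- the inclusion of the intersection in `U` -/
  a : C(A, U)
  /-- the inclusion of the intersection in `M` -/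
  b : C(A, M)
  hf : IsOpenEmbedding f
  hg : IsOpenEmbedding g
  comm : f.comp a = g.comp b
  emb : IsEmbedding (f.comp a)
  range_inter : Set.range f ∩ Set.range g ⊆ Set.range (f.comp a)
  cover : Set.range f ∪ Set.range g = Set.univ

namespace MVSquare

variable (S : MVSquare A U M X)

lemma a_injective : Function.Injective S.a := fun _ _ h =>
  S.emb.injective (congrArg S.f h)

/-- A chain that comes from both sides is supported on simplices lying in both open sets, that is,
in the intersection. -/
lemma exists_pullback {k : ℕ} {u : Ch k U} {v : Ch k M} (h : mp S.f u = mp S.g v) :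
    ∃ w, mp S.a w = u ∧ mp S.b w = v := by
  obtain ⟨w, hw⟩ := exists_mp_eq S.emb (c := mp S.f u) (by
    have h1 := mp_mem_supported S.f u
    have h2 := mp_mem_supported S.g v
    rw [← h] at h2
    rw [Finsupp.mem_supported] at *
    exact fun σ hσ => (Set.subset_inter (h1 hσ) (h2 hσ)).trans S.range_inter)
  refine ⟨w, mp_injective S.hf.injective ?_, mp_injective S.hg.injective ?_⟩
  · rw [← mp_comp, hw]
  · rw [← mp_comp, ← S.comm, hw, h]

lemma exists_split {k : ℕ} (c : Ch k X) : ∃ m u v, (sd ^ m) c = mp S.f u + mp S.g v := by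
  obtain ⟨m, hm⟩ := exists_sd_mem_small S.hf.isOpen_range S.hg.isOpen_range S.cover c
  have : smallSimp k (Set.range S.f) (Set.range S.g) =
    simpIn k (Set.range S.f) ∪ simpIn k (Set.range S.g) := rfl
  rw [this, Finsupp.supported_union, Submodule.mem_sup] at hm
  obtain ⟨c₁, h₁, c₂, h₂, h⟩ := hm
  obtain ⟨u, rfl⟩ := exists_mp_eq S.hf.isEmbedding h₁
  obtain ⟨v, rfl⟩ := exists_mp_eq S.hg.isEmbedding h₂
  exact ⟨m, u, v, h.symm⟩

/-- A cycle of `M` that bounds in `X` is homologous to a cycle of the intersection which bounds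
in `U`. -/
lemma exists_cyc {k : ℕ} {c : Ch k M} (hc : IsCyc c) {e : Ch (k + 1) X} (he : bd e = mp S.g c) :
    ∃ z : Ch k A, IsCyc z ∧ (∃ p, bd p = mp S.a z) ∧ ∃ q, bd q = mp S.b z - c := by
  obtain ⟨m, e₁, e₂, h⟩ := S.exists_split e
  have h1 := congrArg bd h
  rw [bd_sd_pow, he, map_add, bd_mp, bd_mp, ← mp_sd_pow] at h1
  -- After subdivision the filling splits into a part in `U` and a part in `M`. The boundary of the
  -- first part is supported in both, and this is the cycle sought.
  obtain ⟨z, hz₁, hz₂⟩ := S.exists_pullback (u := bd e₁) (v := (sd ^ m) c - bd e₂) (by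
    rw [map_sub, h1]; abel)
  obtain ⟨q, hq⟩ := exists_bd_sd_pow hc m
  refine ⟨z, IsCyc.of_mp S.a_injective (hz₁ ▸ isCyc_bd e₁), ⟨e₁, hz₁.symm⟩, q - e₂, ?_⟩
  rw [map_sub, hq, hz₂]
  abel

/-- If the homology of `X` in degree `k + 1` is zero, then a `k`-cycle of the intersection that
bounds in `U` and in `M` is a boundary. -/
lemma exists_bd {k : ℕ} (hX : ∀ c : Ch (k + 1) X, bd c = 0 → ∃ e, bd e = c) {z : Ch k A}
    {p : Ch (k + 1) U} (hp : bd p = mp S.a z) {q : Ch (k + 1) M} (hq : bd q = mp S.b z) :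
    ∃ w, bd w = z := by
  have hz : IsCyc z := IsCyc.of_mp S.a_injective (hp ▸ isCyc_bd p)
  -- The two fillings glue to a cycle of `X`. Splitting a chain that bounds it corrects them so that
  -- they agree in `X`, and hence come from the intersection.
  obtain ⟨e, he⟩ := hX (mp S.f p - mp S.g q) (by
    rw [map_sub, bd_mp, bd_mp, hp, hq, ← mp_comp, ← mp_comp, S.comm, sub_self])
  obtain ⟨m, e₁, e₂, h⟩ := S.exists_split e
  have h1 := congrArg bd h
  rw [bd_sd_pow, he, map_add, bd_mp, bd_mp, map_sub, ← mp_sd_pow, ← mp_sd_pow] at h1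
  obtain ⟨w, hw, -⟩ := S.exists_pullback (u := (sd ^ m) p - bd e₁) (v := (sd ^ m) q + bd e₂) (by
    rw [map_sub, map_add, sub_eq_iff_eq_add, add_assoc, add_comm (mp S.g (bd e₂)), ← h1]
    abel)
  obtain ⟨e', he'⟩ := exists_bd_sd_pow hz m
  refine ⟨w - e', ?_⟩
  have h2 : bd w = (sd ^ m) z := mp_injective S.a_injective (by
    rw [← bd_mp, hw, map_sub, bd_bd, sub_zero, bd_sd_pow, hp, mp_sd_pow])
  rw [map_sub, he', h2, sub_sub_cancel]

end MVSquare

end MayerVietoris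

end

/-! ### Homology of a product with a circle -/

section

open CategoryTheory AlgebraicTopology Simplicial Topology
section CircleBundle

variable {X Y : Type} [TopologicalSpace X] [TopologicalSpace Y]

instance (k : ℕ) : LocallyPathConnectedSpace (Δs k) :=
  (convex_stdSimplex ℝ (Fin (k + 1))).locallyPathConnectedSpace

lemma prismOp_congr {f g f' g' : C(X, Y)} (F : f.Homotopy g) (F' : f'.Homotopy g')
    (h : ∀ p, F p = F' p) {k : ℕ} (c : Ch k X) : prismOp F k c = prismOp F' k c := by
  obtain rfl : f = f' := ContinuousMap.ext fun x => by simpa using h (0, x)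
  obtain rfl : g = g' := ContinuousMap.ext fun x => by simpa using h (1, x)
  obtain rfl : F = F' := ContinuousMap.Homotopy.ext h
  rfl

lemma postHom_apply {Z : Type} [TopologicalSpace Z] {f g : C(X, Y)} (F : f.Homotopy g) (q : C(Y, Z))
    (p : unitInterval × X) : postHom F q p = q (F p) := rfl

variable (Y) in
/-- The covering of `Y × S¹` by `Y × ℝ`. -/
def coverMap : C(Y × ℝ, Y × Circle) :=
  ⟨fun p => (p.1, Circle.exp (2 * Real.pi * p.2)), by fun_prop⟩

variable (Y) in
/-- The deck transformations of the covering of `Y × S¹` by `Y × ℝ`. -/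
def shift (n : ℤ) : C(Y × ℝ, Y × ℝ) := ⟨fun p => (p.1, p.2 + n), by fun_prop⟩

lemma coverMap_shift (n : ℤ) : (coverMap Y).comp (shift Y n) = coverMap Y := by
  ext p
  · rfl
  · change ((Circle.exp (2 * Real.pi * (p.2 + n)) : Circle) : ℂ) =
      (Circle.exp (2 * Real.pi * p.2) : Circle)
    congr 1
    exact Circle.exp_eq_exp.2 ⟨n, by ring⟩

/-- Simplices lift through the covering, and two lifts differ by a deck transformation. Hence the
chains of `Y × S¹` are the coinvariants of those of `Y × ℝ`, and `shift - 1` is injective on the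
latter: a short exact sequence that replaces a spectral sequence. -/
lemma exists_lift_circle {k : ℕ} (σ : Simp k (Y × Circle)) :
    ∃ τ : Simp k (Y × ℝ), (coverMap Y).comp τ = σ := by
  let a₀ : Δs k := vert k 0
  obtain ⟨t₀, ht₀⟩ := Circle.exp_surjective (σ a₀).2
  obtain ⟨F, ⟨-, hF⟩, -⟩ := Circle.isCoveringMap_exp.existsUnique_continuousMap_lifts
    (⟨fun t => (σ t).2, by fun_prop⟩ : C(Δs k, Circle)) a₀ t₀ ht₀
  refine ⟨⟨fun t => ((σ t).1, F t / (2 * Real.pi)), by fun_prop⟩, ContinuousMap.ext fun t => ?_⟩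
  refine Prod.ext rfl ?_
  change Circle.exp (2 * Real.pi * (F t / (2 * Real.pi))) = (σ t).2
  rw [mul_div_cancel₀ _ (by positivity)]
  exact congrFun hF t

lemma exists_shift_eq {k : ℕ} {σ τ : Simp k (Y × ℝ)}
    (h : (coverMap Y).comp σ = (coverMap Y).comp τ) : ∃ n, σ = (shift Y n).comp τ := by
  have h1 (t) : (σ t).1 = (τ t).1 :=
    congrArg (Prod.fst : Y × Circle → Y) (DFunLike.congr_fun h t)
  have h2 (t) : Circle.exp (2 * Real.pi * (σ t).2) = Circle.exp (2 * Real.pi * (τ t).2) :=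
    congrArg (Prod.snd : Y × Circle → Circle) (DFunLike.congr_fun h t)
  let a₀ : Δs k := vert k 0
  obtain ⟨n, hn⟩ := Circle.exp_eq_exp.1 (h2 a₀)
  have huniq := Circle.isCoveringMap_exp.existsUnique_continuousMap_lifts
    (⟨fun t => Circle.exp (2 * Real.pi * (σ t).2), by fun_prop⟩ : C(Δs k, Circle)) a₀
    (2 * Real.pi * (σ a₀).2) rfl
  refine ⟨n, ContinuousMap.ext fun t => Prod.ext (h1 t) ?_⟩
  have := huniq.unique (y₁ := ⟨fun t => 2 * Real.pi * (σ t).2, by fun_prop⟩)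
    (y₂ := ⟨fun t => 2 * Real.pi * ((τ t).2 + n), by fun_prop⟩) ⟨rfl, rfl⟩
    ⟨by change 2 * Real.pi * ((τ a₀).2 + n) = _; rw [hn]; ring, by
      funext t
      change Circle.exp (2 * Real.pi * ((τ t).2 + n)) = Circle.exp (2 * Real.pi * (σ t).2)
      rw [h2]
      exact Circle.exp_eq_exp.2 ⟨n, by ring⟩⟩
  have h3 : 2 * Real.pi * (σ t).2 = 2 * Real.pi * ((τ t).2 + n) := DFunLike.congr_fun this t
  exact mul_left_cancel₀ (by positivity) h3

/-- The kernel of the covering map on chains is generated by the differences of translates. -/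
lemma exists_shift_sub {k : ℕ} {c : Ch k (Y × ℝ)} (hc : mp (coverMap Y) c = 0) :
    ∃ w, mp (shift Y 1) w - w = c := by
  let N := LinearMap.range (mp (shift Y 1) - LinearMap.id (R := ℤ) (M := Ch k (Y × ℝ)))
  have h1 (τ : Simp k (Y × ℝ)) (n : ℤ) :
      Finsupp.single ((shift Y n).comp τ) 1 - Finsupp.single τ 1 ∈ N := by
    have h0 (n : ℤ) : Finsupp.single ((shift Y (n + 1)).comp τ) 1 -
        Finsupp.single ((shift Y n).comp τ) 1 ∈ N := by
      refine ⟨Finsupp.single ((shift Y n).comp τ) 1, ?_⟩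
      rw [LinearMap.sub_apply, mp_single, LinearMap.id_apply]
      congr 2
      ext t
      · rfl
      · change (τ t).2 + n + ((1 : ℤ) : ℝ) = (τ t).2 + ((n + 1 : ℤ) : ℝ)
        push_cast; ring
    induction n with
    | zero =>
      have : (shift Y 0).comp τ = τ := by ext t <;> simp [shift]
      rw [this, sub_self]
      exact N.zero_mem
    | succ n ih => simpa using N.add_mem (h0 n) ih
    | pred n ih =>
      have := N.sub_mem ih (h0 (-(n : ℤ) - 1))
      simpa using this
  -- Replacing each simplex by a chosen lift of its image changes the chain only by differences of
  -- translates; if the image chain is zero nothing remains.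
  choose s hs using exists_lift_circle (Y := Y) (k := k)
  have key : c - Finsupp.lmapDomain ℤ ℤ s (mp (coverMap Y) c) ∈ N := by
    refine map_mem_of_supported (s := Set.univ)
      (LinearMap.id - Finsupp.lmapDomain ℤ ℤ s ∘ₗ mp (coverMap Y)) (fun τ _ => ?_) (by simp)
    obtain ⟨n, hn⟩ := exists_shift_eq (σ := τ) (τ := s ((coverMap Y).comp τ)) (hs _).symm
    have := h1 (s ((coverMap Y).comp τ)) n
    rw [← hn] at this
    simpa using this
  rw [hc, map_zero, sub_zero] at key
  exact key

lemma exists_cover_eq {k : ℕ} (c : Ch k (Y × Circle)) : ∃ c', mp (coverMap Y) c' = c := by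
  refine map_mem_of_supported (s := Set.univ) LinearMap.id (N := LinearMap.range (mp (coverMap Y)))
    (fun σ _ => ?_) (by simp)
  obtain ⟨τ, rfl⟩ := exists_lift_circle σ
  exact ⟨Finsupp.single τ 1, by simp⟩

/-- There are no nonzero invariant chains on `Y × ℝ`. -/
lemma eq_zero_of_shift_eq {k : ℕ} {c : Ch k (Y × ℝ)} (hc : mp (shift Y 1) c = c) : c = 0 := by
  by_contra h0
  obtain ⟨τ, hτ⟩ := Finsupp.ne_iff.1 h0
  have hinj : Function.Injective fun σ : Simp k (Y × ℝ) => (shift Y 1).comp σ := fun σ σ' h => by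
    refine ContinuousMap.ext fun t => ?_
    have := DFunLike.congr_fun h t
    have h1 := congrArg Prod.fst this
    have h2 := congrArg Prod.snd this
    exact Prod.ext h1 (add_right_cancel h2)
  have h1 (σ : Simp k (Y × ℝ)) : c ((shift Y 1).comp σ) = c σ := by
    conv_lhs => rw [← hc]
    exact Finsupp.mapDomain_apply hinj c σ
  have h2 (n : ℕ) : c ((shift Y n).comp τ) ≠ 0 := by
    induction n with
    | zero =>
      have : (shift Y (0 : ℕ)).comp τ = τ := by ext t <;> simp [shift]
      rw [this]
      exact hτ
    | succ n ih =>
      rw [← h1] at ih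
      convert ih using 2
      ext t
      · rfl
      · change (τ t).2 + (((n + 1 : ℕ) : ℤ) : ℝ) = (τ t).2 + ((n : ℤ) : ℝ) + ((1 : ℤ) : ℝ)
        push_cast; ring
  -- A finitely supported function cannot be constant and nonzero on the infinite orbit of a
  -- simplex.
  refine Set.infinite_of_injective_forall_mem (f := fun n : ℕ => (shift Y n).comp τ)
    (fun n m h => ?_) (s := (c.support : Set (Simp k (Y × ℝ))))
    (fun n => by simpa using h2 n) c.support.finite_toSet
  have : (τ (vert k 0)).2 + ((n : ℤ) : ℝ) = (τ (vert k 0)).2 + ((m : ℤ) : ℝ) :=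
    congrArg Prod.snd (DFunLike.congr_fun h (vert k 0))
  exact_mod_cast add_left_cancel this

variable (Y) in
/-- The section `y ↦ (y, 1)` of `Y × S¹`. -/
def circleSection : C(Y, Y × Circle) := ⟨fun y => (y, 1), by fun_prop⟩

variable (Y) in
/-- The universal loop of maps from `Y`. -/
def circleLoop : (circleSection Y).Homotopy (circleSection Y) where
  toFun p := (p.2, Circle.exp (2 * Real.pi * p.1))
  continuous_toFun := by fun_prop
  map_zero_left y := by simp [circleSection]
  map_one_left y := by simp [circleSection]

variable (Y) in
/-- The section of `Y × ℝ` at height `n`. -/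
def lineSection (n : ℤ) : C(Y, Y × ℝ) := ⟨fun y => (y, n), by fun_prop⟩

variable (Y) in
/-- The lift of the universal loop to `Y × ℝ`. -/
def lineHomotopy : (lineSection Y 0).Homotopy (lineSection Y 1) where
  toFun p := (p.2, p.1)
  continuous_toFun := by fun_prop
  map_zero_left y := by simp [lineSection]
  map_one_left y := by simp [lineSection]

lemma mp_coverMap_prismOp {k : ℕ} (c : Ch k Y) :
    mp (coverMap Y) (prismOp (lineHomotopy Y) k c) = prismOp (circleLoop Y) k c := by
  rw [mp_prismOp]
  refine prismOp_congr _ _ (fun p => ?_) c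
  rw [postHom_apply]
  rfl

lemma bd_prismOp_line {k : ℕ} {c : Ch k Y} (hc : IsCyc c) :
    bd (prismOp (lineHomotopy Y) k c) =
      mp (lineSection Y 0) c - mp (shift Y 1) (mp (lineSection Y 0) c) := by
  rw [bd_prismOp _ hc, ← mp_comp]
  congr 3
  ext y
  · rfl
  · simp [shift, lineSection]

/-- The projection of `Y × ℝ` to `Y`. -/
abbrev lineProj : C(Y × ℝ, Y) := ⟨Prod.fst, continuous_fst⟩

/-- The projection of `Y × S¹` to `Y`. -/
abbrev circleProj : C(Y × Circle, Y) := ⟨Prod.fst, continuous_fst⟩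

lemma lineSection_homotopic :
    ((lineSection Y 0).comp lineProj).Homotopic (ContinuousMap.id (Y × ℝ)) :=
  ⟨{toFun := fun p => (p.2.1, (p.1 : ℝ) * p.2.2)
    continuous_toFun := by fun_prop
    map_zero_left := fun y => by simp [lineSection]
    map_one_left := fun y => by simp}⟩

lemma lineProj_lineSection {k : ℕ} (c : Ch k Y) : mp lineProj (mp (lineSection Y 0) c) = c := by
  rw [← mp_comp]
  exact mp_id c

/-- Sweeping around the circle is injective on homology. -/
lemma exists_bd_of_circleLoop {k : ℕ} {c : Ch k Y} (hc : IsCyc c) {e : Ch (k + 1 + 1) (Y × Circle)}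
    (he : bd e = prismOp (circleLoop Y) k c) : ∃ e', bd e' = c := by
  obtain ⟨e, rfl⟩ := exists_cover_eq e
  obtain ⟨w, hw⟩ := exists_shift_sub (c := prismOp (lineHomotopy Y) k c - bd e) (by
    rw [map_sub, mp_coverMap_prismOp, ← bd_mp, he, sub_self])
  have h1 := congrArg bd hw
  rw [map_sub, map_sub, bd_bd, sub_zero, bd_prismOp_line hc, bd_mp] at h1
  -- Taking boundaries shows that `bd w + s(c)` is invariant under the shift, where `s` is the zero
  -- section. So it vanishes, and projecting to `Y` exhibits `-w` as a filling of `c`.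
  have h2 := eq_zero_of_shift_eq (c := bd w + mp (lineSection Y 0) c) (by
    rw [map_add]
    rw [sub_eq_sub_iff_add_eq_add] at h1
    rw [h1, add_comm])
  refine ⟨-mp lineProj w, ?_⟩
  have h3 := congrArg (mp lineProj) h2
  rw [map_add, lineProj_lineSection, map_zero] at h3
  rw [map_neg, bd_mp]
  exact neg_eq_of_add_eq_zero_right h3

/-- A cycle of `Y × S¹` whose projection to `Y` bounds is swept out by a cycle of `Y`. -/
lemma exists_circleLoop {k : ℕ} {c : Ch (k + 1) (Y × Circle)} (hc : bd c = 0)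
    {p : Ch (k + 1 + 1) Y} (hp : bd p = mp circleProj c) :
    ∃ x : Ch k Y, IsCyc x ∧ ∃ e, bd e = c - prismOp (circleLoop Y) k x := by
  obtain ⟨c, rfl⟩ := exists_cover_eq c
  -- The boundary of the lifted cycle is a translate difference of a cycle `w`; the projection of
  -- `w`, up to sign, is the cycle that sweeps out `c`.
  obtain ⟨w, hw⟩ := exists_shift_sub (c := bd c) (by rw [← bd_mp, hc])
  have hwc : IsCyc w := by
    cases k with
    | zero => trivial
    | succ k =>
      rw [isCyc_succ]
      refine eq_zero_of_shift_eq ?_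
      rw [← sub_eq_zero, ← bd_mp, ← map_sub, hw, bd_bd]
  have hxc : IsCyc (mp lineProj w) := hwc.mp _
  obtain ⟨e₁, he₁⟩ := exists_bd_of_homotopic (lineSection_homotopic (Y := Y)) hwc
  rw [mp_comp, mp_id] at he₁
  set x := mp lineProj w with hx
  refine ⟨-x, hxc.neg, ?_⟩
  have hxc' : IsCyc (-x) := hxc.neg
  -- The lifted cycle is closed up: the strip over `x` and the translates of a homology from `w` to
  -- the zero section cancel its boundary, while downstairs only the swept cycle is subtracted.
  let c' := c - prismOp (lineHomotopy Y) k (-x) + (mp (shift Y 1) e₁ - e₁)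
  have hq : mp (coverMap Y) c' = mp (coverMap Y) c - prismOp (circleLoop Y) k (-x) := by
    simp only [c']
    rw [map_add, map_sub, map_sub, mp_coverMap_prismOp, ← mp_comp, coverMap_shift, sub_self,
      add_zero]
  have hc' : bd c' = 0 := by
    simp only [c']
    rw [map_add, map_sub, map_sub, bd_prismOp_line hxc', bd_mp, he₁, ← hw]
    simp only [map_neg, map_sub]
    abel
  obtain ⟨e₂, he₂⟩ := exists_bd_of_homotopic (lineSection_homotopic (Y := Y)) (c := c') hc'
  rw [mp_comp, mp_id] at he₂
  have hpr : mp lineProj c' = mp circleProj (mp (coverMap Y) c') := by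
    rw [← mp_comp]
    rfl
  -- The projection of the swept cycle is the prism of a constant homotopy, hence a boundary. As the
  -- projection of `c` bounds as well, so does that of `c'`, and `Y × ℝ` has the homology of `Y`.
  obtain ⟨e₃, he₃⟩ := exists_bd_prismOp_refl hxc'
  have hpr' : mp circleProj (prismOp (circleLoop Y) k (-x)) =
      prismOp (ContinuousMap.Homotopy.refl (ContinuousMap.id Y)) k (-x) := by
    rw [mp_prismOp]
    exact prismOp_congr _ _ (fun p => rfl) _
  rw [hq, map_sub, ← hp, hpr', ← he₃, ← map_sub] at hpr
  rw [hpr, ← bd_mp, eq_sub_iff_add_eq, ← eq_sub_iff_add_eq', ← map_sub] at he₂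
  refine ⟨mp (coverMap Y) (mp (lineSection Y 0) (p - e₃) - e₂), ?_⟩
  rw [bd_mp, ← he₂, hq]

/-- The homology of `X` is zero in degrees above `m`. -/
def AcyclicAbove (m : ℕ) (X : Type) [TopologicalSpace X] : Prop :=
  ∀ k, m ≤ k → ∀ c : Ch (k + 1) X, bd c = 0 → ∃ e, bd e = c

lemma acyclicAbove_of_contractible [ContractibleSpace X] : AcyclicAbove 0 X :=
  fun _ _ c hc => exists_bd_of_contractible c hc

/-- Only the composite on `X` must be homotopic to the identity: a cycle is filled in `Y` and the
filling is carried back. -/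
lemma AcyclicAbove.of_retract {m : ℕ} (hY : AcyclicAbove m Y) (f : C(X, Y)) (g : C(Y, X))
    (h : (g.comp f).Homotopic (ContinuousMap.id X)) : AcyclicAbove m X := fun k hk c hc => by
  obtain ⟨e, he⟩ := hY k hk (mp f c) (by rw [bd_mp, hc, map_zero])
  obtain ⟨e', he'⟩ := exists_bd_of_homotopic h (c := c) hc
  refine ⟨mp g e - e', ?_⟩
  rw [map_sub, bd_mp, he, he', mp_comp, mp_id, sub_sub_cancel]

/-- The projection of a cycle bounds, so the cycle is swept out by a cycle one degree lower. The
latter bounds too, and sweeping its filling finishes the argument. -/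
lemma AcyclicAbove.prod_circle {m : ℕ} (hY : AcyclicAbove m Y) :
    AcyclicAbove (m + 1) (Y × Circle) := fun k hk c hc => by
  obtain ⟨k, rfl⟩ : ∃ l, k = l + 1 := ⟨k - 1, by omega⟩
  obtain ⟨p, hp⟩ := hY (k + 1) (by omega) (mp circleProj c) (by rw [bd_mp, hc, map_zero])
  obtain ⟨x, hx, e, he⟩ := exists_circleLoop hc hp
  obtain ⟨y, rfl⟩ := hY k (by omega) x hx
  refine ⟨e - prismOp (circleLoop Y) _ y, ?_⟩
  rw [map_sub, he, bd_prismOp_succ]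
  simp

lemma acyclicAbove_torus (m : ℕ) : AcyclicAbove m (Fin m → Circle) := by
  induction m with
  | zero => exact acyclicAbove_of_contractible
  | succ m ih =>
    refine ih.prod_circle.of_retract ⟨fun θ => (fun i => θ i.succ, θ 0), by fun_prop⟩
      ⟨fun p => Fin.cons p.2 p.1, ?_⟩ ?_
    · refine continuous_pi fun i => Fin.cases ?_ (fun i => ?_) i
      · simpa using continuous_snd
      · simp only [Fin.cons_succ]; fun_prop
    · refine (show ∀ h : C(Fin (m + 1) → Circle, Fin (m + 1) → Circle), h = .id _ →
        h.Homotopic (.id _) from fun h hh => hh ▸ .refl _) _ ?_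
      refine ContinuousMap.ext fun θ => funext fun i => ?_
      refine Fin.cases ?_ (fun i => ?_) i <;> rfl

end CircleBundle

end

/-! ### The Gysin sequence -/

section

open CategoryTheory AlgebraicTopology Simplicial Topology
section Gysin

variable {V A U M X Y : Type} [TopologicalSpace V] [TopologicalSpace A] [TopologicalSpace U]
  [TopologicalSpace M] [TopologicalSpace X] [TopologicalSpace Y]

/-- A space `X` covered by the complement `M` of a closed subspace `V` and by a neighbourhood `U`
of `V`, such that `U` retracts to `V` and `U ∩ M` to a trivial circle bundle over `V`. -/
structure GysinSquare (V A U M X : Type) [TopologicalSpace V] [TopologicalSpace A]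
    [TopologicalSpace U] [TopologicalSpace M] [TopologicalSpace X] extends MVSquare A U M X where
  /-- the inclusion of the circle bundle -/
  j : C(V × Circle, A)
  /-- the retraction to the circle bundle -/
  q : C(A, V × Circle)
  /-- the inclusion of the base -/
  s : C(V, U)
  /-- the retraction to the base -/
  π : C(U, V)
  q_j : q.comp j = .id _
  j_q : (j.comp q).Homotopic (.id _)
  s_π : (s.comp π).Homotopic (.id _)
  π_a_j : (π.comp a).comp j = circleProj

namespace GysinSquare

variable (S : GysinSquare V A U M X)

/-- Exactness of the Gysin sequence at the homology of the complement. -/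
lemma exists_sweep_eq {k : ℕ} {f₀ : C(V, M)}
    (F : TopCat.Homotopy (TopCat.ofHom f₀) (TopCat.ofHom f₀))
    (hF : ∀ p, F p = S.b (S.j (circleLoop V p))) (α : HZ (k + 1) (TopCat.of M))
    (hα : pushforward (k + 1) (TopCat.ofHom S.g) α = 0) : ∃ β, sweep F k β = α := by
  obtain ⟨c, hc⟩ := exists_rep α
  obtain ⟨e, he⟩ := (hc.pushforward S.g).eq_zero_iff.1 hα
  obtain ⟨z, hz, ⟨p, hp⟩, ⟨q, hq⟩⟩ := S.exists_cyc hc.isCyc he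
  obtain ⟨e₁, he₁⟩ := exists_bd_of_homotopic S.j_q hz
  rw [mp_comp, mp_id] at he₁
  -- The cycle `z` of the punctured neighbourhood bounds in `U`, so its image in the base bounds.
  -- Retracted to the circle bundle it is therefore swept out by a cycle `x`.
  obtain ⟨x, hx, e₂, he₂⟩ := exists_circleLoop (c := mp S.q z) (hz.mp _)
    (p := mp S.π p + mp S.π (mp S.a e₁)) (by
      rw [← S.π_a_j, map_add, bd_mp, hp, bd_mp, bd_mp, he₁, mp_comp, mp_comp, map_sub, map_sub]
      abel)
  obtain ⟨β, hβ⟩ := hx.exists_rep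
  refine ⟨β, (hβ.sweep F).unique (hc.congr (mp S.b (mp S.j e₂ - e₁) - q) ?_)⟩
  have hP : mp S.b (mp S.j (prismOp (circleLoop V) k x)) = prismOp (f := f₀) (g := f₀) F k x := by
    rw [mp_prismOp, mp_prismOp]
    refine prismOp_congr _ _ (fun p => ?_) x
    rw [postHom_apply, postHom_apply]
    exact (hF p).symm
  rw [map_sub, hq, bd_mp, map_sub, he₁, bd_mp, he₂, map_sub, map_sub, map_sub, map_sub, hP]
  abel

/-- If the homology of `X` in degree `k + 2` is zero, then the tube map is injective. -/
lemma sweep_injective {k : ℕ} {f₀ : C(V, M)}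
    (F : TopCat.Homotopy (TopCat.ofHom f₀) (TopCat.ofHom f₀))
    (hF : ∀ p, F p = S.b (S.j (circleLoop V p)))
    (hX : ∀ c : Ch (k + 1 + 1) X, bd c = 0 → ∃ e, bd e = c) (β : HZ k (TopCat.of V))
    (hβ0 : sweep F k β = 0) : β = 0 := by
  obtain ⟨x, hx⟩ := exists_rep β
  obtain ⟨p, hp⟩ := (hx.sweep F).eq_zero_iff.1 hβ0
  have hP : mp S.b (mp S.j (prismOp (circleLoop V) k x)) = prismOp (f := f₀) (g := f₀) F k x := by
    rw [mp_prismOp, mp_prismOp]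
    refine prismOp_congr _ _ (fun p => ?_) x
    rw [postHom_apply, postHom_apply]
    exact (hF p).symm
  have hcyc : bd (prismOp (circleLoop V) k x) = 0 := by rw [bd_prismOp _ hx.isCyc, sub_self]
  obtain ⟨e₃, he₃⟩ := exists_bd_prismOp_refl hx.isCyc
  -- Over the base the circles collapse, so the swept cycle bounds in `U`. It also bounds in `M` by
  -- hypothesis, so Mayer-Vietoris makes it bound in the circle bundle up to retraction.
  have hpr : mp S.π (mp S.a (mp S.j (prismOp (circleLoop V) k x))) = bd e₃ := by
    rw [← mp_comp, ← mp_comp, S.π_a_j, mp_prismOp, he₃]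
    exact prismOp_congr _ _ (fun p => rfl) _
  obtain ⟨e₄, he₄⟩ := exists_bd_of_homotopic S.s_π
    (c := mp S.a (mp S.j (prismOp (circleLoop V) k x))) (by
      rw [isCyc_succ, bd_mp, bd_mp, hcyc, map_zero, map_zero])
  rw [mp_comp, mp_id, hpr] at he₄
  obtain ⟨w, hw⟩ := S.exists_bd hX (z := mp S.j (prismOp (circleLoop V) k x))
    (p := mp S.s e₃ - e₄) (q := p) (by rw [map_sub, he₄, bd_mp]; abel) (by rw [hp, hP])
  refine hx.eq_zero_iff.2 (exists_bd_of_circleLoop hx.isCyc (e := mp S.q w) ?_)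
  rw [bd_mp, hw, ← mp_comp, S.q_j, mp_id]

end GysinSquare

/-- The loops in a homotopy of loops of maps sweep out the same classes. -/
lemma sweep_eq_of_homotopic {k : ℕ} {f₀ f₁ : C(X, Y)}
    (F : TopCat.Homotopy (TopCat.ofHom f₀) (TopCat.ofHom f₀))
    (G : TopCat.Homotopy (TopCat.ofHom f₁) (TopCat.ofHom f₁))
    {F' G' : C(X × Circle, Y)} (hF : ∀ p, F p = F' (circleLoop X p))
    (hG : ∀ p, G p = G' (circleLoop X p)) (h : F'.Homotopic G') (β : HZ k (TopCat.of X)) :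
    sweep F k β = sweep G k β := by
  obtain ⟨x, hx⟩ := exists_rep β
  have h1 : prismOp (f := f₀) (g := f₀) F k x = mp F' (prismOp (circleLoop X) k x) := by
    rw [mp_prismOp]
    exact prismOp_congr _ _ (fun p => hF p) x
  have h2 : prismOp (f := f₁) (g := f₁) G k x = mp G' (prismOp (circleLoop X) k x) := by
    rw [mp_prismOp]
    exact prismOp_congr _ _ (fun p => hG p) x
  obtain ⟨e, he⟩ := exists_bd_of_homotopic h (c := prismOp (circleLoop X) k x) (by
    rw [isCyc_succ, bd_prismOp _ hx.isCyc, sub_self])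
  rw [← h1, ← h2] at he
  exact ((hx.sweep F).congr e he).unique (hx.sweep G)

/-- Sweeping commutes with pushforward from the parameter space. -/
lemma sweep_pushforward {V : Type} [TopologicalSpace V] {k : ℕ} {f₀ : C(X, Y)} {f₁ : C(V, Y)}
    (F : TopCat.Homotopy (TopCat.ofHom f₀) (TopCat.ofHom f₀))
    (G : TopCat.Homotopy (TopCat.ofHom f₁) (TopCat.ofHom f₁)) (i : C(V, X))
    (h : ∀ t v, G (t, v) = F (t, i v)) (β : HZ k (TopCat.of V)) :
    sweep F k (pushforward k (TopCat.ofHom i) β) = sweep G k β := by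
  obtain ⟨x, hx⟩ := exists_rep β
  refine ((hx.pushforward i).sweep F).unique ?_
  rw [prismOp_mp, prismOp_congr (preHom i F) (f' := f₁) (g' := f₁) G (fun p => (h p.1 p.2).symm)]
  exact hx.sweep G

end Gysin

end

/-! ### Differentials and algebraic elements -/

section

section Kaehler
open scoped TensorProduct

/-- In characteristic zero `H1Cotangent` of `K` over `L` vanishes, so `K ⊗ Ω[L⁄k]` injects into
`Ω[K⁄k]`. -/
lemma D_eq_zero_of_D_algebraMap_eq_zero {k L K : Type} [Field k] [Field L] [CharZero L] [Field K]
    [Algebra k L] [Algebra k K] [Algebra L K] [IsScalarTower k L K]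
    [Algebra.EssFiniteType k K] {x : L}
    (hx : KaehlerDifferential.D k K (algebraMap L K x) = 0) :
    KaehlerDifferential.D k L x = 0 := by
  have : Algebra.EssFiniteType L K := Algebra.EssFiniteType.of_comp k L K
  have hinj : Function.Injective (KaehlerDifferential.mapBaseChange k L K) := by
    rw [injective_iff_map_eq_zero]
    intro x hx
    obtain ⟨y, rfl⟩ := (Algebra.H1Cotangent.exact_δ_mapBaseChange k L K x).1 hx
    rw [Subsingleton.elim y 0, map_zero]
  have h1 : (1 : K) ⊗ₜ[L] KaehlerDifferential.D k L x = 0 := by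
    apply hinj
    simpa using hx
  simpa using h1

/-- All differentials of the simple extension `k(q)` vanish, so it is unramified, hence separable
algebraic. -/
lemma isAlgebraic_of_D_eq_zero {k K : Type} [Field k] [CharZero k] [Field K] [Algebra k K]
    [Algebra.EssFiniteType k K] {q : K} (h : KaehlerDifferential.D k K q = 0) :
    IsAlgebraic k q := by
  let L := IntermediateField.adjoin k {q}
  have : CharZero L := charZero_of_injective_algebraMap (algebraMap k L).injective
  have hall : ∀ x (hx : x ∈ L), KaehlerDifferential.D k K x = 0 := by
    intro x hx
    induction hx using IntermediateField.adjoin_induction with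
    | mem x hx => rw [hx]; exact h
    | algebraMap x => simp
    | add x y _ _ hx hy => simp [hx, hy]
    | inv x _ hx =>
      have h1 := (KaehlerDifferential.D k K).leibniz_inv x
      rw [h1, hx, smul_zero]
    | mul x y _ _ hx hy => simp [hx, hy]
  have : Algebra.EssFiniteType k L :=
    IntermediateField.essFiniteType_iff.2 ⟨{q}, by simp [L]⟩
  have hu : Algebra.FormallyUnramified k L := by
    refine ⟨⟨fun a b => ?_⟩⟩
    have hz : ∀ c : Ω[L⁄k], c = 0 := by
      intro c
      have := KaehlerDifferential.span_range_derivation k L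
      have hc : c ∈ (⊤ : Submodule L Ω[L⁄k]) := trivial
      rw [← this] at hc
      refine Submodule.span_induction ?_ rfl ?_ ?_ hc
      · rintro _ ⟨x, rfl⟩
        exact D_eq_zero_of_D_algebraMap_eq_zero (K := K) (hall _ x.2)
      · intro _ _ _ _ h1 h2; rw [h1, h2, add_zero]
      · intro _ _ _ h1; rw [h1, smul_zero]
    rw [hz a, hz b]
  have : Algebra.IsSeparable k L := Algebra.FormallyUnramified.isSeparable k L
  have := Algebra.IsIntegral.isIntegral (R := k) (⟨q, IntermediateField.mem_adjoin_simple_self k q⟩ : L)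
  exact (this.isAlgebraic.algHom (IntermediateField.val L))

end Kaehler

end

/-! ### Finiteness of critical values -/

section

section CriticalValues
open AddMonoidAlgebra

variable {d : ℕ}

/-- The operator `z_i ∂/∂z_i` on Laurent polynomials. -/
def eulerOp (i : Fin d) (Q : Laurent d) : Laurent d :=
  Q.coeff.sum fun m a => single m (a * (m i : ℂ))

lemma eulerOp_add (i : Fin d) (P Q : Laurent d) :
    eulerOp i (P + Q) = eulerOp i P + eulerOp i Q := by
  unfold eulerOp
  rw [coeff_add, Finsupp.sum_add_index']
  · intro m; rw [zero_mul, single_zero]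
  · intro m a b; rw [add_mul, single_add]

lemma eulerOp_single (i : Fin d) (m : Fin d → ℤ) (a : ℂ) :
    eulerOp i (single m a) = single m (a * (m i : ℂ)) := by
  unfold eulerOp
  rw [coeff_single, Finsupp.sum_single_index (by rw [zero_mul, single_zero])]

lemma eulerOp_zero (i : Fin d) : eulerOp i (0 : Laurent d) = 0 := by
  simp [eulerOp]

lemma eval_add (P Q : Laurent d) (z : Cd d) : eval (P + Q) z = eval P z + eval Q z := by
  unfold eval
  rw [coeff_add, Finsupp.sum_add_index']
  · intro m; rw [zero_mul]
  · intro m a b; rw [add_mul]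

lemma eval_single (m : Fin d → ℤ) (a : ℂ) (z : Cd d) :
    eval (single m a) z = a * ∏ i, z i ^ m i := by
  unfold eval
  rw [coeff_single, Finsupp.sum_single_index (by rw [zero_mul])]

lemma eval_zero (z : Cd d) : eval (0 : Laurent d) z = 0 := by
  simp [eval]

lemma eval_perturb (Q : Laurent d) (c : ℂ) (z : Cd d) : eval (perturb Q c) z = eval Q z - c := by
  have h := eval_add (perturb Q c) (single 0 c) z
  rw [eval_single, perturb, sub_add_cancel] at h
  simp only [Pi.zero_apply, zpow_zero, Finset.prod_const_one, mul_one] at h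
  rw [h, perturb, add_sub_cancel_right]

/-- Evaluation at a point of the algebraic torus, as an algebra homomorphism. -/
def evalHom {z : Cd d} (hz : z ∈ cstar d) : Laurent d →ₐ[ℂ] ℂ :=
  AddMonoidAlgebra.lift ℂ ℂ (Fin d → ℤ)
    { toFun := fun m => ∏ i, z i ^ (m.toAdd i)
      map_one' := by simp
      map_mul' := fun m m' => by
        rw [← Finset.prod_mul_distrib]
        exact Finset.prod_congr rfl fun i _ => zpow_add₀ (hz i) _ _ }

lemma evalHom_apply {z : Cd d} (hz : z ∈ cstar d) (Q : Laurent d) : evalHom hz Q = eval Q z := by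
  induction Q using AddMonoidAlgebra.induction_linear with
  | zero => rw [map_zero, eval_zero]
  | add P Q hP hQ => rw [map_add, hP, hQ, eval_add]
  | single m a =>
    rw [eval_single, evalHom, AddMonoidAlgebra.lift_single]
    rfl

/-- The curve that scales the `i`-th coordinate of `z` by `1 + t`. -/
def scaleCoord (z : Cd d) (i : Fin d) (t : ℂ) : Cd d :=
  z + t • EuclideanSpace.single i (z i)

lemma hasDerivAt_eval_scaleCoord (z : Cd d) (i : Fin d) (Q : Laurent d) :
    HasDerivAt (fun t => eval Q (scaleCoord z i t)) (eval (eulerOp i Q) z) 0 := by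
  induction Q using AddMonoidAlgebra.induction_linear with
  | zero => simpa [eval_zero, eulerOp_zero] using hasDerivAt_const (0 : ℂ) (0 : ℂ)
  | add P Q hP hQ =>
    rw [eulerOp_add, eval_add]
    exact (hP.add hQ).congr_of_eventuallyEq (.of_forall fun t => eval_add _ _ _)
  | single m a =>
    have h : (fun t => eval (single m a) (scaleCoord z i t)) =
        fun t => (a * ∏ j, z j ^ m j) * (1 + t) ^ m i := by
      funext t
      rw [eval_single, mul_assoc]
      congr 1
      have : ∀ j, (scaleCoord z i t) j ^ m j = z j ^ m j * (if j = i then (1 + t) ^ m i else 1) := by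
        intro j
        by_cases hj : j = i
        · subst hj
          rw [if_pos rfl, ← mul_zpow]
          simp only [scaleCoord, PiLp.add_apply, PiLp.smul_apply, PiLp.single_apply,
            if_true, smul_eq_mul]
          ring
        · simp [scaleCoord, hj]
      rw [Finset.prod_congr rfl fun j _ => this j, Finset.prod_mul_distrib]
      simp
    rw [h, eulerOp_single, eval_single]
    have h1 : HasDerivAt (fun t : ℂ => (1 + t) ^ m i) (m i : ℂ) 0 := by
      have := (hasDerivAt_zpow (m i) (1 + 0 : ℂ) (Or.inl (by simp))).comp_const_add 1 0
      simpa using this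
    convert! h1.const_mul (a * ∏ j, z j ^ m j) using 1
    ring

lemma eval_eulerOp_eq_zero {Q : Laurent d} {z : Cd d} (hz : z ∈ cstar d)
    (h : fderiv ℂ (eval Q) z = 0) (i : Fin d) : eval (eulerOp i Q) z = 0 := by
  have h1 := hasDerivAt_eval_scaleCoord z i Q
  have h2 : HasFDerivAt (eval Q) (fderiv ℂ (eval Q) z) (scaleCoord z i 0) := by
    rw [scaleCoord, zero_smul, add_zero]
    exact (analyticAt_eval Q hz).differentiableAt.hasFDerivAt
  have h3 : HasDerivAt (scaleCoord z i) (EuclideanSpace.single i (z i)) 0 := by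
    have := ((hasDerivAt_id (0 : ℂ)).smul_const (EuclideanSpace.single i (z i))).const_add z
    rwa [one_smul] at this
  have h4 := h2.comp_hasDerivAt (0 : ℂ) h3
  rw [h] at h4
  simpa using h1.unique h4

/-- The logarithmic derivative of monomials. -/
def logDer {M : Type} [AddCommGroup M] [Module (Laurent d) M] [Module ℂ M]
    (δ : Derivation ℂ (Laurent d) M) : (Fin d → ℤ) →+ M where
  toFun m := (single (-m) 1 : Laurent d) • δ (single m 1)
  map_zero' := by
    have : (single 0 1 : Laurent d) = 1 := rfl
    rw [this, δ.map_one_eq_zero, smul_zero]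
  map_add' m m' := by
    have h : (single (m + m') 1 : Laurent d) = single m 1 * single m' 1 := by
      rw [single_mul_single, mul_one]
    rw [h, δ.leibniz, smul_add, smul_smul, smul_smul, single_mul_single, single_mul_single,
      mul_one, neg_add_rev, neg_add_cancel_right, add_comm (-m') (-m), neg_add_cancel_right,
      add_comm]

/-- On the torus the forms `dz_i / z_i` generate the differentials, with the Euler operators as
coefficients. -/
lemma derivation_eq_sum {M : Type} [AddCommGroup M] [Module (Laurent d) M] [Module ℂ M]
    [IsScalarTower ℂ (Laurent d) M]
    (δ : Derivation ℂ (Laurent d) M) (Q : Laurent d) :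
    δ Q = ∑ i, eulerOp i Q • logDer δ (Pi.single i 1) := by
  induction Q using AddMonoidAlgebra.induction_linear with
  | zero => simp [eulerOp_zero]
  | add P Q hP hQ => simp only [map_add, hP, hQ, eulerOp_add, add_smul, Finset.sum_add_distrib]
  | single m a =>
    have h1 : logDer δ m = ∑ i, m i • logDer δ (Pi.single i 1) := by
      conv_lhs => rw [← Finset.univ_sum_single m, map_sum]
      refine Finset.sum_congr rfl fun i _ => ?_
      rw [← map_zsmul, ← Pi.single_smul, smul_eq_mul, mul_one]
    have h2 : δ (single m a) = (single m a : Laurent d) • logDer δ m := by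
      change _ = (single m a : Laurent d) • (single (-m) 1 : Laurent d) • δ (single m 1)
      rw [smul_smul, single_mul_single, add_neg_cancel, mul_one]
      have h3 : (single m a : Laurent d) = a • single m 1 := by rw [smul_single, smul_eq_mul, mul_one]
      have h4 : (single 0 a : Laurent d) = a • (1 : Laurent d) := by
        rw [show (1 : Laurent d) = single 0 1 from rfl, smul_single, smul_eq_mul, mul_one]
      rw [h3, δ.map_smul, h4, smul_assoc, one_smul]
    rw [h2, h1, Finset.smul_sum]
    refine Finset.sum_congr rfl fun i _ => ?_
    rw [eulerOp_single, ← Int.cast_smul_eq_zsmul (Laurent d), smul_smul]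
    congr 1
    rw [show ((m i : ℤ) : Laurent d) = single 0 (m i : ℂ) from ?_, single_mul_single, add_zero]
    rw [← map_intCast (algebraMap ℂ (Laurent d))]
    rfl

/-- A function constant along the zero set of an ideal containing its derivatives. -/
lemma exists_sub_algebraMap_mem (Q : Laurent d) {P : Ideal (Laurent d)} (hP : P.IsPrime)
    (hQ : ∀ i, eulerOp i Q ∈ P) : ∃ c : ℂ, Q - algebraMap ℂ (Laurent d) c ∈ P := by
  let K := FractionRing (Laurent d ⧸ P)
  have : Algebra.FiniteType ℂ (Laurent d) := inferInstance
  have : Algebra.EssFiniteType ℂ K := inferInstance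
  have hinj : ∀ f : Laurent d, algebraMap (Laurent d) K f = 0 → f ∈ P := by
    intro f hf
    rw [IsScalarTower.algebraMap_apply (Laurent d) (Laurent d ⧸ P) K] at hf
    exact Ideal.Quotient.eq_zero_iff_mem.1
      ((IsFractionRing.injective (Laurent d ⧸ P) K) (hf.trans (map_zero _).symm))
  -- All Euler derivatives of `Q` die in the function field of the component, so the differential of
  -- `Q` vanishes there.
  have hD : KaehlerDifferential.D ℂ K (algebraMap (Laurent d) K Q) = 0 := by
    have h := derivation_eq_sum ((KaehlerDifferential.D ℂ K).compAlgebraMap (Laurent d)) Q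
    refine h.trans (Finset.sum_eq_zero fun i _ => ?_)
    rw [← algebraMap_smul K, IsScalarTower.algebraMap_apply (Laurent d) (Laurent d ⧸ P) K]
    rw [show algebraMap (Laurent d) (Laurent d ⧸ P) (eulerOp i Q) = 0 from
      Ideal.Quotient.eq_zero_iff_mem.2 (hQ i), map_zero, zero_smul]
  have halg := isAlgebraic_of_D_eq_zero hD
  -- An element algebraic over the algebraically closed field `ℂ` is a constant.
  obtain ⟨c, hc⟩ : ∃ c, algebraMap ℂ K c = algebraMap (Laurent d) K Q := by
    have hs := IsAlgClosed.splits (minpoly ℂ (algebraMap (Laurent d) K Q))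
    have h1 := minpoly.degree_eq_one_iff.1 (IsAlgClosed.degree_eq_one_of_irreducible ℂ
      (minpoly.irreducible halg.isIntegral))
    exact h1
  refine ⟨c, hinj _ ?_⟩
  rw [map_sub, ← hc, ← IsScalarTower.algebraMap_apply, sub_self]

/-- A Laurent polynomial has finitely many critical values on the algebraic torus. -/
lemma finite_criticalValues (Q : Laurent d) :
    Set.Finite {c : ℂ | ∃ z ∈ cstar d, fderiv ℂ (eval Q) z = 0 ∧ eval Q z = c} := by
  have : IsNoetherianRing (Laurent d) := Algebra.FiniteType.isNoetherianRing ℂ _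
  let J : Ideal (Laurent d) := Ideal.span (Set.range fun i => eulerOp i Q)
  have hfin := J.finite_minimalPrimes_of_isNoetherianRing (Laurent d)
  have hc : ∀ P ∈ J.minimalPrimes, ∃ c : ℂ, Q - algebraMap ℂ (Laurent d) c ∈ P := fun P hP =>
    exists_sub_algebraMap_mem Q hP.1.1 fun i => hP.1.2 (Ideal.subset_span ⟨i, rfl⟩)
  choose! c hc using hc
  refine (hfin.image c).subset ?_
  rintro _ ⟨z, hz, hd, rfl⟩
  -- The kernel of evaluation at a critical point contains `J`, hence one of the finitely many
  -- minimal primes over it, on whose zero set `Q` is constant.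
  have hJ : J ≤ RingHom.ker (evalHom hz).toRingHom := by
    rw [Ideal.span_le]
    rintro _ ⟨i, rfl⟩
    refine (evalHom_apply hz _).trans ?_
    exact eval_eulerOp_eq_zero hz hd i
  have : (RingHom.ker (evalHom hz).toRingHom).IsPrime := RingHom.ker_isPrime _
  obtain ⟨P, hP, hPJ⟩ := Ideal.exists_minimalPrimes_le hJ
  refine ⟨P, hP, ?_⟩
  have : evalHom hz (Q - algebraMap ℂ (Laurent d) (c P)) = 0 := hPJ (hc P hP)
  rw [map_sub, AlgHom.commutes, evalHom_apply, sub_eq_zero] at this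
  exact this.symm

end CriticalValues

end

/-! ### Tubular neighbourhoods from the gradient -/

section

section NormalForm
open Topology

variable {d : ℕ}

lemma inner_gradient (Q : Laurent d) (z a : Cd d) :
    inner ℂ (gradient (eval Q) z) a = fderiv ℂ (eval Q) z a := by
  rw [gradient, InnerProductSpace.toDual_symm_apply]

lemma gradient_ne_zero {Q : Laurent d} {z : Cd d} (h : fderiv ℂ (eval Q) z ≠ 0) :
    gradient (eval Q) z ≠ 0 := by
  intro h0
  apply h
  ext a
  rw [← inner_gradient, h0, inner_zero_left]
  rfl

lemma fderiv_gradient_ne_zero {Q : Laurent d} {z : Cd d} (h : fderiv ℂ (eval Q) z ≠ 0) :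
    fderiv ℂ (eval Q) z (gradient (eval Q) z) ≠ 0 := by
  rw [← inner_gradient]
  exact inner_self_ne_zero.2 (gradient_ne_zero h)

lemma exists_lipschitzOnWith_gradient (Q : Laurent d) {z : Cd d} (hz : z ∈ cstar d) :
    ∃ K, ∃ s ∈ 𝓝 z, LipschitzOnWith K (gradient (eval Q)) s := by
  obtain ⟨K, s, hs, h⟩ :=
    (analyticAt_eval Q hz).fderiv.hasStrictFDerivAt.exists_lipschitzOnWith
  refine ⟨K, s, hs, ?_⟩
  have := (InnerProductSpace.toDual ℂ (Cd d)).symm.lipschitz.comp_lipschitzOnWith h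
  rwa [one_mul] at this

lemma continuousAt_gradient (Q : Laurent d) {z : Cd d} (hz : z ∈ cstar d) :
    ContinuousAt (gradient (eval Q)) z :=
  (InnerProductSpace.toDual ℂ (Cd d)).symm.continuous.continuousAt.comp
    (analyticAt_eval Q hz).fderiv.continuousAt

/-- The map `(z, w) ↦ (z + w ∇Q(z), Q(z))`. -/
def normalMap (Q : Laurent d) (p : Cd d × ℂ) : Cd d × ℂ :=
  (p.1 + p.2 • gradient (eval Q) p.1, eval Q p.1)

/-- The gradient depends antiholomorphically on the point. At `w = 0` the factor `w` absorbs its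
variation, so a local Lipschitz bound is enough for a complex strict derivative. -/
lemma hasStrictFDerivAt_smul_gradient (Q : Laurent d) {z : Cd d} (hz : z ∈ cstar d) :
    HasStrictFDerivAt (𝕜 := ℂ) (fun p : Cd d × ℂ => p.2 • gradient (eval Q) p.1)
      ((ContinuousLinearMap.snd ℂ (Cd d) ℂ).smulRight (gradient (eval Q) z)) (z, 0) := by
  obtain ⟨K, s, hs, hK⟩ := exists_lipschitzOnWith_gradient Q hz
  refine .of_isLittleO (Asymptotics.IsLittleO.of_bound fun ε hε => ?_)
  have e1 : ∀ᶠ p : Cd d × ℂ in 𝓝 (z, 0), p.1 ∈ s := continuous_fst.continuousAt.eventually hs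
  have e2 : ∀ᶠ p : Cd d × ℂ in 𝓝 (z, 0), ‖gradient (eval Q) p.1 - gradient (eval Q) z‖ < ε / 2 := by
    have : ContinuousAt (fun p : Cd d × ℂ => ‖gradient (eval Q) p.1 - gradient (eval Q) z‖)
        (z, 0) :=
      ((ContinuousAt.comp (x := ((z, 0) : Cd d × ℂ)) (continuousAt_gradient Q hz)
        continuous_fst.continuousAt).sub continuousAt_const).norm
    exact this.eventually_lt continuousAt_const (by simpa using half_pos hε)
  have e3 : ∀ᶠ p : Cd d × ℂ in 𝓝 (z, 0), ‖p.2‖ * K < ε / 2 := by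
    have : ContinuousAt (fun p : Cd d × ℂ => ‖p.2‖ * (K : ℝ)) (z, 0) := by fun_prop
    exact this.eventually_lt continuousAt_const (by simpa using half_pos hε)
  have e := (e1.and (e2.and e3))
  rw [nhds_prod_eq]
  filter_upwards [e.prod_mk e] with p hp
  obtain ⟨⟨a1, a2, -⟩, b1, -, b3⟩ := hp
  have key : p.1.2 • gradient (eval Q) p.1.1 - p.2.2 • gradient (eval Q) p.2.1 -
      ((ContinuousLinearMap.snd ℂ (Cd d) ℂ).smulRight (gradient (eval Q) z)) (p.1 - p.2) =
      (p.1.2 - p.2.2) • (gradient (eval Q) p.1.1 - gradient (eval Q) z) +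
        p.2.2 • (gradient (eval Q) p.1.1 - gradient (eval Q) p.2.1) := by
    simp only [ContinuousLinearMap.smulRight_apply, ContinuousLinearMap.coe_snd', Prod.snd_sub]
    module
  rw [key]
  have h1 : ‖p.1.2 - p.2.2‖ ≤ ‖p.1 - p.2‖ := norm_snd_le (p.1 - p.2)
  have h2 : ‖p.1.1 - p.2.1‖ ≤ ‖p.1 - p.2‖ := norm_fst_le (p.1 - p.2)
  have h3 := hK.norm_sub_le a1 b1
  refine (norm_add_le _ _).trans ?_
  rw [norm_smul, norm_smul]
  have h4 : ‖p.1.2 - p.2.2‖ * ‖gradient (eval Q) p.1.1 - gradient (eval Q) z‖ ≤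
      ‖p.1 - p.2‖ * (ε / 2) := by gcongr
  have h5 : ‖p.2.2‖ * ‖gradient (eval Q) p.1.1 - gradient (eval Q) p.2.1‖ ≤
      (ε / 2) * ‖p.1 - p.2‖ := by
    calc _ ≤ ‖p.2.2‖ * (K * ‖p.1 - p.2‖) := by gcongr; exact h3.trans (by gcongr)
      _ = (‖p.2.2‖ * K) * ‖p.1 - p.2‖ := by ring
      _ ≤ _ := by gcongr
  linarith

/-- Near a regular point `v`, the map `normalMap Q` is a local homeomorphism at `(v, 0)`. -/
lemma exists_openPartialHomeomorph_normalMap (Q : Laurent d) {z : Cd d} (hz : z ∈ cstar d)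
    (h : fderiv ℂ (eval Q) z ≠ 0) :
    ∃ e : OpenPartialHomeomorph (Cd d × ℂ) (Cd d × ℂ), (z, 0) ∈ e.source ∧
      (e : Cd d × ℂ → Cd d × ℂ) = normalMap Q := by
  let D : Cd d × ℂ →L[ℂ] Cd d × ℂ :=
    (ContinuousLinearMap.fst ℂ (Cd d) ℂ +
      (ContinuousLinearMap.snd ℂ (Cd d) ℂ).smulRight (gradient (eval Q) z)).prod
    ((fderiv ℂ (eval Q) z).comp (ContinuousLinearMap.fst ℂ (Cd d) ℂ))
  -- The derivative is `(a, w) ↦ (a + w ∇Q, dQ a)`. It is injective because `dQ(∇Q) = ‖∇Q‖²` is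
  -- nonzero at a regular point.
  have hinj : Function.Injective (D : Cd d × ℂ →ₗ[ℂ] Cd d × ℂ) := by
    rw [injective_iff_map_eq_zero]
    rintro ⟨a, w⟩ haw
    have h1 : a + w • gradient (eval Q) z = 0 := congrArg Prod.fst haw
    have h2 : fderiv ℂ (eval Q) z a = 0 := congrArg Prod.snd haw
    have h3 := congrArg (fderiv ℂ (eval Q) z) h1
    rw [map_add, h2, zero_add, map_smul, map_zero, smul_eq_mul] at h3
    have hw : w = 0 := (mul_eq_zero.1 h3).resolve_right (fderiv_gradient_ne_zero h)
    rw [hw, zero_smul, add_zero] at h1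
    rw [h1, hw]
    rfl
  let D' : (Cd d × ℂ) ≃L[ℂ] (Cd d × ℂ) := (LinearEquiv.ofInjectiveEndo _ hinj).toContinuousLinearEquiv
  have hD : (D' : Cd d × ℂ →L[ℂ] Cd d × ℂ) = D := by
    ext p <;> rfl
  have hs : HasStrictFDerivAt (normalMap Q) (D' : Cd d × ℂ →L[ℂ] Cd d × ℂ) (z, 0) := by
    rw [hD]
    refine HasStrictFDerivAt.prodMk ?_ ?_
    · exact hasStrictFDerivAt_fst.add (hasStrictFDerivAt_smul_gradient Q hz)
    · exact HasStrictFDerivAt.comp (x := ((z, 0) : Cd d × ℂ))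
        (analyticAt_eval Q hz).hasStrictFDerivAt hasStrictFDerivAt_fst
  exact ⟨hs.toOpenPartialHomeomorph _, hs.mem_toOpenPartialHomeomorph_source, rfl⟩

/-- On the box of size `s` around `(v, 0)`, the map `normalMap Q` is an open embedding. -/
structure IsNormalBox (Q : Laurent d) (v : Cd d) (s : ℝ) : Prop where
  ball_subset : Metric.ball v s ⊆ cstar d
  mem_cstar : ∀ p ∈ Metric.ball v s ×ˢ Metric.ball (0 : ℂ) s, (normalMap Q p).1 ∈ cstar d
  injOn : Set.InjOn (normalMap Q) (Metric.ball v s ×ˢ Metric.ball (0 : ℂ) s)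
  isOpen_image : ∀ O : Set (Cd d × ℂ), IsOpen O → O ⊆ Metric.ball v s ×ˢ Metric.ball (0 : ℂ) s →
    IsOpen (normalMap Q '' O)

lemma IsNormalBox.shrink {Q : Laurent d} {v v' : Cd d} {s s' : ℝ} (h : IsNormalBox Q v s)
    (hs : s' + dist v' v ≤ s) : IsNormalBox Q v' s' := by
  have h1 : Metric.ball v' s' ⊆ Metric.ball v s := Metric.ball_subset_ball' hs
  have h2 : Metric.ball (0 : ℂ) s' ⊆ Metric.ball (0 : ℂ) s :=
    Metric.ball_subset_ball (by linarith [dist_nonneg (x := v') (y := v)])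
  have h3 := Set.prod_mono h1 h2
  exact ⟨h1.trans h.ball_subset, fun p hp => h.mem_cstar p (h3 hp), h.injOn.mono h3,
    fun O hO hOs => h.isOpen_image O hO (hOs.trans h3)⟩

lemma exists_isNormalBox (Q : Laurent d) {z : Cd d} (hz : z ∈ cstar d)
    (h : fderiv ℂ (eval Q) z ≠ 0) : ∃ s > 0, IsNormalBox Q z s := by
  obtain ⟨e, he, hee⟩ := exists_openPartialHomeomorph_normalMap Q hz h
  have hc : ContinuousAt (normalMap Q) (z, 0) := by
    rw [← hee]; exact e.continuousAt he
  have n1 : e.source ∈ 𝓝 ((z, 0) : Cd d × ℂ) := e.open_source.mem_nhds he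
  have n2 : ∀ᶠ p : Cd d × ℂ in 𝓝 (z, 0), p.1 ∈ cstar d :=
    continuous_fst.continuousAt.eventually (isOpen_cstar.mem_nhds hz)
  have n3 : ∀ᶠ p : Cd d × ℂ in 𝓝 (z, 0), (normalMap Q p).1 ∈ cstar d := by
    have : ContinuousAt (fun p => (normalMap Q p).1) (z, 0) := continuous_fst.continuousAt.comp hc
    refine this.eventually (isOpen_cstar.mem_nhds ?_)
    simpa [normalMap] using hz
  obtain ⟨s, hs, hsub⟩ := Metric.mem_nhds_iff.1 (Filter.inter_mem n1 (Filter.inter_mem n2 n3))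
  rw [← ball_prod_same] at hsub
  refine ⟨s, hs, ⟨fun v hv => ?_, fun p hp => (hsub hp).2.2, ?_, fun O hO hOs => ?_⟩⟩
  · exact (hsub (Set.mk_mem_prod hv (Metric.mem_ball_self hs))).2.1
  · rw [← hee]
    exact e.injOn.mono fun p hp => (hsub hp).1
  · rw [← hee]
    exact e.isOpen_image_of_subset_source hO fun p hp => (hsub (hOs hp)).1

/-- The largest size at most `1` of a normal box around `v`. -/
def boxSize (Q : Laurent d) (v : Cd d) : ℝ := sSup {s | s ≤ 1 ∧ IsNormalBox Q v s}

lemma isNormalBox_zero (Q : Laurent d) (v : Cd d) : IsNormalBox Q v 0 := by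
  refine ⟨?_, ?_, ?_, fun O _ hO => ?_⟩
  · simp
  · simp
  · simp
  · have : O = ∅ := by simpa using hO
    simp [this]

lemma bddAbove_boxSize (Q : Laurent d) (v : Cd d) : BddAbove {s | s ≤ 1 ∧ IsNormalBox Q v s} :=
  ⟨1, fun _ hs => hs.1⟩

lemma boxSize_nonneg (Q : Laurent d) (v : Cd d) : 0 ≤ boxSize Q v :=
  le_csSup (bddAbove_boxSize Q v) ⟨zero_le_one, isNormalBox_zero Q v⟩

lemma boxSize_pos (Q : Laurent d) {z : Cd d} (hz : z ∈ cstar d)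
    (h : fderiv ℂ (eval Q) z ≠ 0) : 0 < boxSize Q z := by
  obtain ⟨s, hs, hb⟩ := exists_isNormalBox Q hz h
  refine (lt_min hs one_pos).trans_le (le_csSup (bddAbove_boxSize Q z) ⟨min_le_right s 1, ?_⟩)
  exact hb.shrink (by simp)

lemma isNormalBox_of_lt {Q : Laurent d} {v : Cd d} {s : ℝ} (h : s < boxSize Q v) :
    IsNormalBox Q v s := by
  obtain ⟨s', hs', hlt⟩ := exists_lt_of_lt_csSup
    (show Set.Nonempty {s | s ≤ 1 ∧ IsNormalBox Q v s} from ⟨0, zero_le_one, isNormalBox_zero Q v⟩) h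
  exact hs'.2.shrink (by simpa using hlt.le)

/-- A box around one centre contains a box around a nearby centre that is smaller by the distance.
So the optimal size is 1-Lipschitz, which yields a continuous radius without partitions of unity. -/
lemma boxSize_le_add (Q : Laurent d) (v v' : Cd d) : boxSize Q v ≤ boxSize Q v' + dist v v' := by
  refine csSup_le ⟨0, zero_le_one, isNormalBox_zero Q v⟩ fun s hs => ?_
  rw [← sub_le_iff_le_add]
  refine le_csSup (bddAbove_boxSize Q v') ⟨by linarith [hs.1, dist_nonneg (x := v) (y := v')], ?_⟩
  exact hs.2.shrink (by rw [dist_comm v' v]; linarith)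

lemma continuous_boxSize (Q : Laurent d) : Continuous (boxSize Q) :=
  (LipschitzWith.of_le_add (boxSize_le_add Q)).continuous

/-- The radius of the normal disc at `v`. -/
def discRadius (Q : Laurent d) (v : Cd d) : ℝ := boxSize Q v / (4 * (1 + ‖gradient (eval Q) v‖))

/-- The factor `1 + ‖∇Q‖` in the radius bounds at once the parameter `w` and the displacement `w ∇Q`
by a quarter of the box. -/
lemma discRadius_mul_le (Q : Laurent d) (v : Cd d) :
    discRadius Q v * ‖gradient (eval Q) v‖ ≤ boxSize Q v / 4 := by
  have h := boxSize_nonneg Q v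
  have hn := norm_nonneg (gradient (eval Q) v)
  rw [discRadius, div_mul_eq_mul_div, div_le_div_iff₀ (by positivity) (by positivity)]
  nlinarith [mul_nonneg h hn]

lemma discRadius_le (Q : Laurent d) (v : Cd d) : discRadius Q v ≤ boxSize Q v / 4 := by
  have h := boxSize_nonneg Q v
  have hn := norm_nonneg (gradient (eval Q) v)
  rw [discRadius, div_le_div_iff₀ (by positivity) (by positivity)]
  nlinarith [mul_nonneg h hn]

/-- The smooth zero set of a Laurent polynomial has a tubular neighbourhood which is openly
embedded. -/
lemma exists_tubularNhd {Q : Laurent d} (hQ : ∀ z ∈ variety Q, fderiv ℂ (eval Q) z ≠ 0) :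
    ∃ N : TubularNhd Q, ∀ O : Set (variety Q × ℂ), IsOpen O → (∀ p ∈ O, ‖p.2‖ < N.radius p.1) →
      IsOpen ((fun p : variety Q × ℂ => (p.1 : Cd d) + p.2 • gradient (eval Q) (p.1 : Cd d)) '' O) := by
  have hpos : ∀ v : variety Q, 0 < boxSize Q v := fun v => boxSize_pos Q v.2.1 (hQ v v.2)
  have hcont : Continuous fun v : variety Q => discRadius Q v := by
    refine ((continuous_boxSize Q).comp continuous_subtype_val).div
      (continuous_const.mul (continuous_const.add (continuous_gradient Q).norm)) fun v => ?_
    positivity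
  have hmem : ∀ (v : variety Q) (w : ℂ), ‖w‖ ≤ discRadius Q v → ‖w‖ < 3 / 4 * boxSize Q v :=
    fun v w hw => by linarith [discRadius_le Q v, hpos v]
  have hbox : ∀ v : variety Q, IsNormalBox Q v (3 / 4 * boxSize Q v) := fun v =>
    isNormalBox_of_lt (by linarith [hpos v])
  have hself : ∀ (v : variety Q) (w : ℂ), ‖w‖ ≤ discRadius Q v →
      ((v : Cd d), w) ∈ Metric.ball (v : Cd d) (3 / 4 * boxSize Q v) ×ˢ
        Metric.ball (0 : ℂ) (3 / 4 * boxSize Q v) := fun v w hw =>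
    ⟨Metric.mem_ball_self (by linarith [hpos v]), by simpa using hmem v w hw⟩
  have hinj : ∀ (v v' : variety Q) (w w' : ℂ), boxSize Q v' ≤ boxSize Q v →
      ‖w‖ ≤ discRadius Q v → ‖w'‖ ≤ discRadius Q v' →
      (v : Cd d) + w • gradient (eval Q) (v : Cd d) =
      (v' : Cd d) + w' • gradient (eval Q) (v' : Cd d) → v = v' ∧ w = w' := by
    intro v v' w w' hle hw hw' he
    have h1 : ‖w • gradient (eval Q) (v : Cd d)‖ ≤ boxSize Q v / 4 := by
      rw [norm_smul]
      exact (by gcongr : _ ≤ discRadius Q v * _).trans (discRadius_mul_le Q v)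
    have h2 : ‖w' • gradient (eval Q) (v' : Cd d)‖ ≤ boxSize Q v' / 4 := by
      rw [norm_smul]
      exact (by gcongr : _ ≤ discRadius Q v' * _).trans (discRadius_mul_le Q v')
    -- Each displacement is at most a quarter of the larger box, so the centres differ by at most
    -- half of it. Both points then lie in the box of size three quarters around `v`, where
    -- `normalMap Q` is injective.
    have h3 : dist (v' : Cd d) v < 3 / 4 * boxSize Q v := by
      have : (v' : Cd d) - v = w • gradient (eval Q) (v : Cd d) -
          w' • gradient (eval Q) (v' : Cd d) := by
        rw [sub_eq_sub_iff_add_eq_add, ← he, add_comm]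
      rw [dist_eq_norm, this]
      linarith [norm_sub_le (w • gradient (eval Q) (v : Cd d))
        (w' • gradient (eval Q) (v' : Cd d)), hpos v]
    have h4 : ‖w'‖ < 3 / 4 * boxSize Q v := (hmem v' w' hw').trans_le (by linarith)
    have h5 := (hbox v).injOn (hself v w hw)
      (show ((v' : Cd d), w') ∈ _ from ⟨h3, by simpa using h4⟩)
      (Prod.ext he (by simp only [normalMap]; rw [v.2.2, v'.2.2]))
    exact ⟨Subtype.ext (congrArg Prod.fst h5), congrArg Prod.snd h5⟩
  refine ⟨⟨⟨fun v => discRadius Q v, hcont⟩, fun v => ?_, fun v w hw => ?_,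
    fun v v' w w' hw hw' he => ?_⟩, fun O hO hOr => ?_⟩
  · exact div_pos (hpos v) (by positivity)
  · exact (hbox v).mem_cstar _ (hself v w hw)
  · rcases le_total (boxSize Q (v' : Cd d)) (boxSize Q (v : Cd d)) with h | h
    · exact hinj v v' w w' h hw hw' he
    · have := hinj v' v w' w h hw' hw he.symm
      exact ⟨this.1.symm, this.2.symm⟩
  · rw [isOpen_iff_mem_nhds]
    rintro _ ⟨⟨v, w⟩, hp, rfl⟩
    obtain ⟨O', hO', hOO'⟩ := (Topology.IsInducing.subtypeVal.prodMap Topology.IsInducing.id).isOpen_iff.1 hO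
    let box := Metric.ball (v : Cd d) (3 / 4 * boxSize Q v) ×ˢ
        Metric.ball (0 : ℂ) (3 / 4 * boxSize Q v)
    have hopen := (hbox v).isOpen_image (O' ∩ box)
      (hO'.inter (Metric.isOpen_ball.prod Metric.isOpen_ball)) Set.inter_subset_right
    have hmem' : normalMap Q ((v : Cd d), w) ∈ normalMap Q '' (O' ∩ box) := by
      refine ⟨_, ⟨?_, hself v w (hOr _ hp).le⟩, rfl⟩
      rw [← hOO'] at hp
      exact hp
    have hn := hopen.mem_nhds hmem'
    have hcont2 : Continuous fun y : Cd d => (y, (0 : ℂ)) := by fun_prop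
    have hval : normalMap Q ((v : Cd d), w) =
        ((v : Cd d) + w • gradient (eval Q) (v : Cd d), 0) := by rw [normalMap, v.2.2]
    rw [hval] at hn
    -- For `y` near the given point, `(y, 0)` lies in the open image of the box. The second
    -- coordinate of `normalMap Q` is `Q` at the base point, so the base point of `y` lies on the
    -- zero set.
    filter_upwards [hcont2.continuousAt.preimage_mem_nhds hn] with y hy
    obtain ⟨⟨v', w'⟩, ⟨hv'O, hv'b⟩, hv'⟩ := hy
    have hz : v' ∈ variety Q := ⟨(hbox v).ball_subset hv'b.1, congrArg Prod.snd hv'⟩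
    refine ⟨(⟨v', hz⟩, w'), ?_, congrArg Prod.fst hv'⟩
    rw [← hOO']
    exact hv'O

end NormalForm

end

/-! ### The Gysin square of a tubular neighbourhood -/

section

open CategoryTheory
section Tube
open Topology

variable {d : ℕ} {Q : Laurent d}

/-- The point with normal coordinate `w` over `v`. -/
def normalPoint (Q : Laurent d) (p : variety Q × ℂ) : Cd d :=
  (p.1 : Cd d) + p.2 • gradient (eval Q) (p.1 : Cd d)

lemma continuous_normalPoint (Q : Laurent d) : Continuous (normalPoint Q) :=
  (continuous_subtype_val.comp continuous_fst).add
    (continuous_snd.smul ((continuous_gradient Q).comp continuous_fst))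

lemma normalPoint_zero (v : variety Q) : normalPoint Q (v, 0) = v := by
  simp [normalPoint]

namespace TubularNhd

variable (N : TubularNhd Q)

lemma normalPoint_mem_complement {v : variety Q} {w : ℂ} (hw : ‖w‖ ≤ N.radius v) (h0 : w ≠ 0) :
    normalPoint Q (v, w) ∈ complement Q := by
  refine ⟨N.mem_cstar v w hw, fun h => h0 ?_⟩
  exact (N.injective v ⟨_, N.mem_cstar v w hw, h⟩ w 0 hw
    (by simpa using (N.radius_pos _).le) (by simp)).2

/-- The tubular neighbourhood with a smaller radius. -/
def shrink (R : C(variety Q, ℝ)) (hR : ∀ v, 0 < R v) (hle : ∀ v, R v ≤ N.radius v) :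
    TubularNhd Q where
  radius := R
  radius_pos := hR
  mem_cstar v w hw := N.mem_cstar v w (hw.trans (hle v))
  injective v v' w w' hw hw' h := N.injective v v' w w' (hw.trans (hle v)) (hw'.trans (hle v')) h

/-- The embedding of the boundary circle bundle. -/
def circleMap : C(variety Q × Circle, complement Q) where
  toFun p := ⟨normalPoint Q (p.1, (N.radius p.1 : ℂ) * p.2), N.normalPoint_mem_complement
    (by rw [norm_mul, Circle.norm_coe, mul_one, Complex.norm_real,
      Real.norm_of_nonneg (N.radius_pos _).le])
    (mul_ne_zero (by exact_mod_cast (N.radius_pos _).ne') (Circle.coe_ne_zero _))⟩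
  continuous_toFun := by
    refine Continuous.subtype_mk ((continuous_normalPoint Q).comp ?_) _
    fun_prop

lemma loop_apply (p : unitInterval × variety Q) : N.loop p = N.circleMap (circleLoop _ p) := rfl

/-- Linear interpolation of the two radii keeps the circles positive in size and inside the larger
tube, hence in the complement of the zero set. -/
lemma tube_shrink (R : C(variety Q, ℝ)) (hR : ∀ v, 0 < R v) (hle : ∀ v, R v ≤ N.radius v)
    (k : ℕ) (β : HZ k (TopCat.of (variety Q))) :
    N.tube k β = (N.shrink R hR hle).tube k β := by
  refine sweep_eq_of_homotopic N.loop (N.shrink R hR hle).loop N.loop_apply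
    (N.shrink R hR hle).loop_apply ⟨?_⟩ β
  have hpos : ∀ (t : unitInterval) (v : variety Q),
      0 < (1 - (t : ℝ)) * N.radius v + t * R v := by
    intro t v
    have h1 := hle v
    have h2 := hR v
    nlinarith [t.2.1, t.2.2]
  have hle' : ∀ (t : unitInterval) (v : variety Q),
      (1 - (t : ℝ)) * N.radius v + t * R v ≤ N.radius v := by
    intro t v
    nlinarith [t.2.1, hle v]
  exact
    { toFun := fun p => ⟨normalPoint Q (p.2.1,
          (((1 - (p.1 : ℝ)) * N.radius p.2.1 + p.1 * R p.2.1 : ℝ) : ℂ) * p.2.2),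
        N.normalPoint_mem_complement
          (by rw [norm_mul, Circle.norm_coe, mul_one, Complex.norm_real,
                Real.norm_of_nonneg (hpos _ _).le]; exact hle' _ _)
          (mul_ne_zero (by exact_mod_cast (hpos _ _).ne') (Circle.coe_ne_zero _))⟩
      continuous_toFun := by
        refine Continuous.subtype_mk ((continuous_normalPoint Q).comp ?_) _
        fun_prop
      map_zero_left := fun v => by
        apply Subtype.ext
        simp [circleMap]
      map_one_left := fun v => by
        apply Subtype.ext
        simp [circleMap, shrink] }

/-- The tube operator does not depend on the tubular neighbourhood. -/
lemma tube_eq (N N' : TubularNhd Q) (k : ℕ) (β : HZ k (TopCat.of (variety Q))) :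
    N.tube k β = N'.tube k β := by
  let R : C(variety Q, ℝ) := N.radius ⊓ N'.radius
  have hR : ∀ v, 0 < R v := fun v => lt_min (N.radius_pos v) (N'.radius_pos v)
  rw [N.tube_shrink R hR (fun v => min_le_left _ _) k β,
    N'.tube_shrink R hR (fun v => min_le_right _ _) k β]
  rfl

section Square

variable {T : Type} [TopologicalSpace T] (ι : C(T, variety Q))

/-- The open disc bundle over `T`. -/
abbrev Disc : Type := {p : T × ℂ // ‖p.2‖ < N.radius (ι p.1)}

/-- The open disc bundle over `T`, without its zero section. -/
abbrev PuncturedDisc : Type := {p : T × ℂ // p.2 ≠ 0 ∧ ‖p.2‖ < N.radius (ι p.1)}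

/-- The complement of `V`, together with the points of `T`. -/
abbrev partialComplement {T : Type} [TopologicalSpace T] (ι : C(T, variety Q)) : Set (Cd d) :=
  complement Q ∪ Set.range fun t => (ι t : Cd d)

/-- The embedding of the open disc bundle. -/
def discMap : C(N.Disc ι, partialComplement ι) where
  toFun p := ⟨normalPoint Q (ι p.1.1, p.1.2), by
    by_cases h : p.1.2 = 0
    · exact Or.inr ⟨p.1.1, by rw [h, normalPoint_zero]⟩
    · exact Or.inl (N.normalPoint_mem_complement p.2.le h)⟩
  continuous_toFun := by
    refine Continuous.subtype_mk ((continuous_normalPoint Q).comp ?_) _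
    fun_prop

/-- The embedding of the punctured disc bundle. -/
def puncturedDiscMap : C(N.PuncturedDisc ι, complement Q) where
  toFun p := ⟨normalPoint Q (ι p.1.1, p.1.2), N.normalPoint_mem_complement p.2.2.le p.2.1⟩
  continuous_toFun := by
    refine Continuous.subtype_mk ((continuous_normalPoint Q).comp ?_) _
    fun_prop

/-- The inclusion of the complement. -/
def complementMap {T : Type} [TopologicalSpace T] (ι : C(T, variety Q)) :
    C(complement Q, partialComplement ι) where
  toFun p := ⟨p.1, Or.inl p.2⟩

variable {ι}

lemma isOpenEmbedding_discMap (hι : IsOpenEmbedding ι)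
    (hN : ∀ O : Set (variety Q × ℂ), IsOpen O → (∀ p ∈ O, ‖p.2‖ < N.radius p.1) →
      IsOpen (normalPoint Q '' O)) : IsOpenEmbedding (N.discMap ι) := by
  refine .of_continuous_injective_isOpenMap (N.discMap ι).continuous (fun p q h => ?_) ?_
  · have h1 := N.injective _ _ _ _ p.2.le q.2.le (congrArg Subtype.val h)
    exact Subtype.ext (Prod.ext (hι.injective h1.1) h1.2)
  · intro O hO
    have ho : IsOpen {p : T × ℂ | ‖p.2‖ < N.radius (ι p.1)} :=
      isOpen_lt (by fun_prop) (by fun_prop)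
    have h1 : IsOpenMap fun p : N.Disc ι => (ι p.1.1, p.1.2) :=
      (hι.isOpenMap.prodMap IsOpenMap.id).comp ho.isOpenMap_subtype_val
    have h2 := hN _ (h1 O hO) (by rintro _ ⟨p, -, rfl⟩; exact p.2)
    refine ⟨_, h2, ?_⟩
    ext y
    constructor
    · rintro ⟨_, ⟨p, hp, rfl⟩, h⟩
      exact ⟨p, hp, Subtype.ext h⟩
    · rintro ⟨p, hp, rfl⟩
      exact ⟨_, ⟨p, hp, rfl⟩, rfl⟩

lemma isOpen_complement (Q : Laurent d) : IsOpen (complement Q) := by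
  rw [isOpen_iff_mem_nhds]
  intro z hz
  have h1 := isOpen_cstar.mem_nhds hz.1
  have h2 := (analyticAt_eval Q hz.1).continuousAt.eventually_ne hz.2
  filter_upwards [h1, h2] with y a b using ⟨a, b⟩

lemma norm_half_radius (v : variety Q) (θ : Circle) :
    ‖((N.radius v / 2 : ℝ) : ℂ) * θ‖ = N.radius v / 2 := by
  rw [norm_mul, Circle.norm_coe, mul_one, Complex.norm_real,
    Real.norm_of_nonneg (by linarith [N.radius_pos v])]

/-- The half-radius circle bundle in the punctured disc bundle. -/
def circleToDisc (ι : C(T, variety Q)) : C(T × Circle, N.PuncturedDisc ι) where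
  toFun p := ⟨(p.1, ((N.radius (ι p.1) / 2 : ℝ) : ℂ) * p.2),
    mul_ne_zero (by exact_mod_cast (half_pos (N.radius_pos _)).ne') (Circle.coe_ne_zero _), by
      rw [norm_half_radius]; linarith [N.radius_pos (ι p.1)]⟩
  continuous_toFun := by
    refine Continuous.subtype_mk ?_ _
    fun_prop

/-- The radial projection to the circle bundle. -/
def discToCircle (ι : C(T, variety Q)) : C(N.PuncturedDisc ι, T × Circle) where
  toFun p := (p.1.1, ⟨p.1.2 / ‖p.1.2‖, by
    refine mem_sphere_zero_iff_norm.2 ?_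
    rw [norm_div, Complex.norm_real, norm_norm, div_self (norm_ne_zero_iff.2 p.2.1)]⟩)
  continuous_toFun := by
    refine Continuous.prodMk (by fun_prop) (Continuous.subtype_mk ?_ _)
    refine Continuous.div (by fun_prop) (by fun_prop) fun p => ?_
    exact_mod_cast norm_ne_zero_iff.2 p.2.1

/-- A nonzero normal vector is rescaled by a positive factor, from half the radius to its own
length, never leaving the punctured disc. -/
lemma homotopic_circleToDisc (ι : C(T, variety Q)) :
    ((N.circleToDisc ι).comp (N.discToCircle ι)).Homotopic (.id _) := by
  have key : ∀ (t : unitInterval) (p : N.PuncturedDisc ι),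
      0 < (1 - (t : ℝ)) * (N.radius (ι p.1.1) / 2) / ‖p.1.2‖ + t := by
    intro t p
    have h1 := N.radius_pos (ι p.1.1)
    have h2 := norm_pos_iff.2 p.2.1
    have h3 : 0 ≤ 1 - (t : ℝ) := by linarith [t.2.2]
    rcases t.2.1.eq_or_lt with h | h
    · rw [← h]; simp only [sub_zero, one_mul, add_zero]; positivity
    · have : 0 ≤ (1 - (t : ℝ)) * (N.radius (ι p.1.1) / 2) / ‖p.1.2‖ := by positivity
      linarith
  refine ⟨?_⟩
  exact
    { toFun := fun p => ⟨(p.2.1.1,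
        (((1 - (p.1 : ℝ)) * (N.radius (ι p.2.1.1) / 2) / ‖p.2.1.2‖ + p.1 : ℝ) : ℂ) * p.2.1.2), by
          refine ⟨mul_ne_zero (by exact_mod_cast (key _ _).ne') p.2.2.1, ?_⟩
          have h1 := N.radius_pos (ι p.2.1.1)
          have h2 := norm_pos_iff.2 p.2.2.1
          rw [norm_mul, Complex.norm_real, Real.norm_of_nonneg (key _ _).le, add_mul,
            div_mul_cancel₀ _ h2.ne']
          have h3 : (1 - (p.1 : ℝ)) * (N.radius (ι p.2.1.1) / 2) ≤
            (1 - (p.1 : ℝ)) * N.radius (ι p.2.1.1) := by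
              have : 0 ≤ 1 - (p.1 : ℝ) := by linarith [p.1.2.2]
              gcongr; linarith
          have h4 := p.2.2.2
          rcases p.1.2.1.eq_or_lt with h | h
          · rw [← h]; simp only [sub_zero, one_mul, zero_mul, add_zero]; linarith
          · nlinarith⟩
      continuous_toFun := by
        refine Continuous.subtype_mk ?_ _
        refine Continuous.prodMk (by fun_prop) (Continuous.mul ?_ (by fun_prop))
        refine Complex.continuous_ofReal.comp (Continuous.add ?_ (by fun_prop))
        exact Continuous.div (by fun_prop) (by fun_prop) fun p => norm_ne_zero_iff.2 p.2.2.1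
      map_zero_left := fun p => by
        apply Subtype.ext
        refine Prod.ext rfl ?_
        simp only [circleToDisc, discToCircle, ContinuousMap.comp_apply, ContinuousMap.coe_mk,
          Set.Icc.coe_zero]
        push_cast
        ring
      map_one_left := fun p => by
        apply Subtype.ext
        simp }

variable (hι : IsOpenEmbedding ι)
  (hN : ∀ O : Set (variety Q × ℂ), IsOpen O → (∀ p ∈ O, ‖p.2‖ < N.radius p.1) →
    IsOpen (normalPoint Q '' O))

/-- The square formed by the disc bundle over `T` and the complement. -/
def gysinSquare : GysinSquare T (N.PuncturedDisc ι) (N.Disc ι) (complement Q)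
    (partialComplement ι) where
  f := N.discMap ι
  g := complementMap ι
  a := ⟨fun p => ⟨p.1, p.2.2⟩, by fun_prop⟩
  b := N.puncturedDiscMap ι
  hf := N.isOpenEmbedding_discMap hι hN
  hg := .of_continuous_injective_isOpenMap (complementMap ι).continuous
    (fun p q h => Subtype.ext (congrArg (fun x : partialComplement ι => (x : Cd d)) h))
    fun O hO => by
      refine ⟨Subtype.val '' O, (isOpen_complement Q).isOpenMap_subtype_val O hO, ?_⟩
      ext y
      constructor
      · rintro ⟨p, hp, h⟩
        exact ⟨p, hp, Subtype.ext h⟩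
      · rintro ⟨p, hp, rfl⟩
        exact ⟨p, hp, rfl⟩
  comm := rfl
  emb := by
    refine (N.isOpenEmbedding_discMap hι hN).isEmbedding.comp ?_
    exact (IsEmbedding.subtypeVal.of_comp (by fun_prop) continuous_subtype_val)
  range_inter := by
    rintro _ ⟨⟨p, rfl⟩, ⟨y, hy⟩⟩
    refine ⟨⟨p.1, fun h => ?_, p.2⟩, rfl⟩
    have h1 : (y : Cd d) = normalPoint Q (ι p.1.1, p.1.2) := congrArg Subtype.val hy
    rw [h, normalPoint_zero] at h1
    exact y.2.2 (h1 ▸ (ι p.1.1).2.2)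
  cover := by
    rw [Set.eq_univ_iff_forall]
    rintro ⟨z, hz | ⟨t, rfl⟩⟩
    · exact Or.inr ⟨⟨z, hz⟩, rfl⟩
    · exact Or.inl ⟨⟨(t, 0), by simpa using N.radius_pos _⟩, Subtype.ext (normalPoint_zero _)⟩
  j := N.circleToDisc ι
  q := N.discToCircle ι
  s := ⟨fun t => ⟨(t, 0), by simpa using N.radius_pos _⟩, by fun_prop⟩
  π := ⟨fun p => p.1.1, by fun_prop⟩
  q_j := by
    ext p
    · rfl
    · have h1 := N.radius_pos (ι p.1)
      have h2 := N.norm_half_radius (ι p.1) p.2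
      simp only [circleToDisc, discToCircle, ContinuousMap.comp_apply, ContinuousMap.coe_mk, h2,
        ContinuousMap.id_apply]
      rw [mul_div_cancel_left₀]
      exact_mod_cast (half_pos h1).ne'
  j_q := N.homotopic_circleToDisc ι
  s_π := ⟨{ toFun := fun p => ⟨(p.2.1.1, (p.1 : ℂ) * p.2.1.2), by
              rw [norm_mul, Complex.norm_real, Real.norm_of_nonneg p.1.2.1]
              refine lt_of_le_of_lt ?_ p.2.2
              exact mul_le_of_le_one_left (norm_nonneg _) p.1.2.2⟩
            continuous_toFun := by
              refine Continuous.subtype_mk ?_ _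
              fun_prop
            map_zero_left := fun p => by
              apply Subtype.ext
              simp
            map_one_left := fun p => by
              apply Subtype.ext
              simp }⟩
  π_a_j := rfl

/-- The tubular neighbourhood of half the radius. -/
def half : TubularNhd Q :=
  N.shrink ⟨fun v => N.radius v / 2, by fun_prop⟩ (fun v => half_pos (N.radius_pos v))
    fun v => half_le_self (N.radius_pos v).le

/-- The tube of half the radius is the one swept in the Gysin square, as its circles lie inside the
open disc bundle. -/
lemma b_j_circleLoop (p : unitInterval × T) :
    N.half.loop (p.1, ι p.2) = (N.gysinSquare hι hN).b ((N.gysinSquare hι hN).j (circleLoop T p)) :=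
  rfl

end Square

end TubularNhd

end Tube

end

/-! ### The intersection class -/

section

open CategoryTheory
section IntersectionClass
open Topology

lemma pushforward_eq_of_homotopic {X Y : Type} [TopologicalSpace X] [TopologicalSpace Y]
    {f g : C(X, Y)} (h : f.Homotopic g) {k : ℕ} (a : HZ k (TopCat.of X)) :
    pushforward k (TopCat.ofHom f) a = pushforward k (TopCat.ofHom g) a := by
  obtain ⟨c, hc⟩ := exists_rep a
  obtain ⟨e, he⟩ := exists_bd_of_homotopic h hc.isCyc
  exact ((hc.pushforward f).congr e he).unique (hc.pushforward g)

lemma pushforward_comp_apply {X Y Z : TopCat.{0}} (f : X ⟶ Y) (g : Y ⟶ Z) {k : ℕ} (a : HZ k X) :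
    pushforward k g (pushforward k f a) = pushforward k (f ≫ g) a := by
  rw [pushforward, pushforward, pushforward, Functor.map_comp]
  rfl

variable {d : ℕ}

/-- The algebraic torus retracts to the compact torus. -/
lemma acyclicAbove_cstar {S : Set (Cd d)} (hS : S = cstar d) : AcyclicAbove d S := by
  subst hS
  have key : ∀ (t : unitInterval) (z : ℂ), z ≠ 0 → 0 < (1 - (t : ℝ)) / ‖z‖ + t := by
    intro t z hz
    have h2 := norm_pos_iff.2 hz
    have h3 : 0 ≤ 1 - (t : ℝ) := by linarith [t.2.2]
    rcases t.2.1.eq_or_lt with h | h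
    · rw [← h]; simpa using hz
    · have : 0 ≤ (1 - (t : ℝ)) / ‖z‖ := by positivity
      linarith
  refine (acyclicAbove_torus d).of_retract
    ⟨fun z i => ⟨(z : Cd d) i / ‖(z : Cd d) i‖, ?_⟩, ?_⟩
    ⟨fun θ => ⟨WithLp.toLp 2 fun i => (θ i : ℂ), fun i => Circle.coe_ne_zero _⟩, ?_⟩ ⟨?_⟩
  · refine mem_sphere_zero_iff_norm.2 ?_
    rw [norm_div, Complex.norm_real, norm_norm, div_self (norm_ne_zero_iff.2 (z.2 i))]
  · refine continuous_pi fun i => Continuous.subtype_mk ?_ _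
    refine Continuous.div (by fun_prop) (by fun_prop) fun z => ?_
    exact_mod_cast norm_ne_zero_iff.2 (z.2 i)
  · exact Continuous.subtype_mk (by fun_prop) _
  · exact
    { toFun := fun p => ⟨WithLp.toLp 2 fun i =>
          (((1 - (p.1 : ℝ)) / ‖(p.2 : Cd d) i‖ + p.1 : ℝ) : ℂ) * (p.2 : Cd d) i, fun i =>
            mul_ne_zero (Complex.ofReal_ne_zero.2 (key p.1 _ (p.2.2 i)).ne') (p.2.2 i)⟩
      continuous_toFun := by
        refine Continuous.subtype_mk ?_ _
        refine (PiLp.continuous_toLp 2 _).comp (continuous_pi fun i => ?_)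
        refine Continuous.mul (Complex.continuous_ofReal.comp (Continuous.add ?_ (by fun_prop)))
          (by fun_prop)
        exact Continuous.div (by fun_prop) (by fun_prop) fun z => norm_ne_zero_iff.2 (z.2.2 i)
      map_zero_left := fun z => by
        apply Subtype.ext
        ext i
        simp only [Set.Icc.coe_zero, sub_zero, add_zero, one_div]
        push_cast
        rw [mul_comm, ← div_eq_mul_inv]
        rfl
      map_one_left := fun z => by
        apply Subtype.ext
        ext i
        simp }

/-- With the whole zero set as base, the space covered by the Gysin square is the full algebraic
torus, which has no homology above degree `n + 1`. -/
lemma tube_injective {n : ℕ} {Q : Laurent (n + 1)}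
    (hQ : ∀ z ∈ variety Q, fderiv ℂ (eval Q) z ≠ 0) (N : TubularNhd Q)
    {β β' : HZ n (TopCat.of (variety Q))} (h : N.tube n β = N.tube n β') : β = β' := by
  obtain ⟨N₀, hN₀⟩ := exists_tubularNhd hQ
  rw [N.tube_eq N₀.half, N.tube_eq N₀.half, ← sub_eq_zero, ← map_sub] at h
  rw [← sub_eq_zero]
  have hι : IsOpenEmbedding (ContinuousMap.id (variety Q)) := IsOpenEmbedding.id
  refine (N₀.gysinSquare hι hN₀).sweep_injective N₀.half.loop
    (fun p => N₀.b_j_circleLoop hι hN₀ p) ?_ _ h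
  refine acyclicAbove_cstar ?_ (n + 1) le_rfl
  ext z
  constructor
  · rintro (hz | ⟨v, rfl⟩)
    · exact hz.1
    · exact v.2.1
  · intro hz
    by_cases h0 : eval Q z = 0
    · exact Or.inr ⟨⟨z, hz, h0⟩, rfl⟩
    · exact Or.inl ⟨hz, h0⟩

lemma logMod_torusMap (θ : Fin d → Circle) (u : Fin d → ℝ) :
    (WithLp.toLp 2 fun i => (Real.exp (u i) : ℂ) * (θ i : ℂ)) ∈ cstar d ∧
    logMod (WithLp.toLp 2 fun i => (Real.exp (u i) : ℂ) * (θ i : ℂ)) = u := by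
  refine ⟨fun i => by simp [Complex.exp_ne_zero], ?_⟩
  funext i
  simp only [logMod, norm_mul, Circle.norm_coe, mul_one, Complex.norm_real, Real.norm_eq_abs,
    Real.abs_exp, Real.log_exp]

/-- If the tori over a path from `x` to `y` meet the smooth zero set only in an open set `W`, then
the intersection class is supported on `W`. -/
theorem exists_intersectionClass {n : ℕ} {Q : Laurent (n + 1)}
    (hQ : ∀ z ∈ variety Q, fderiv ℂ (eval Q) z ≠ 0) {x y : Fin (n + 1) → ℝ} (hx : x ∉ amoeba Q)
    (hy : y ∉ amoeba Q) {W S : Set (Cd (n + 1))} (hW : IsOpen W)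
    (hWS : ∀ z ∈ variety Q, z ∈ W → z ∈ S)
    (hγ : JoinedIn {u | ∀ z ∈ variety Q, logMod z = u → z ∈ W} x y) :
    ∃ I : HZ n (TopCat.of (variety Q)),
      (∀ J, IsIntersectionClass Q x y J ↔ J = I) ∧ IsSupportedOn I S := by
  obtain ⟨γ, hγ⟩ := hγ
  obtain ⟨N, hN⟩ := exists_tubularNhd hQ
  let T := {v : variety Q // (v : Cd (n + 1)) ∈ W}
  let ι : C(T, variety Q) := ⟨Subtype.val, continuous_subtype_val⟩
  have hι : IsOpenEmbedding ι := (hW.preimage continuous_subtype_val).isOpenEmbedding_subtypeVal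
  let sq := N.gysinSquare hι hN
  let α := torusOver Q x hx - torusOver Q y hy
  -- The tori over the path meet the zero set only in `W`, so the homotopy stays in the complement
  -- together with the points of `T`.
  have hhom : (sq.g.comp (torusMap Q x hx).hom).Homotopic (sq.g.comp (torusMap Q y hy).hom) :=
    ⟨{ toFun := fun p => ⟨WithLp.toLp 2 fun i => (Real.exp (γ p.1 i) : ℂ) * (p.2 i : ℂ), by
          obtain ⟨h1, h2⟩ := logMod_torusMap p.2 (γ p.1)
          by_cases h0 : eval Q (WithLp.toLp 2 fun i => (Real.exp (γ p.1 i) : ℂ) * (p.2 i : ℂ)) = 0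
          · exact Or.inr ⟨⟨⟨_, h1, h0⟩, hγ p.1 _ ⟨h1, h0⟩ h2⟩, rfl⟩
          · exact Or.inl ⟨h1, h0⟩⟩
       continuous_toFun := by
          refine Continuous.subtype_mk ?_ _
          refine (PiLp.continuous_toLp 2 _).comp (continuous_pi fun i => ?_)
          refine Continuous.mul (Complex.continuous_ofReal.comp
            (Real.continuous_exp.comp ?_)) (by fun_prop)
          exact (continuous_apply i).comp (γ.continuous.comp continuous_fst)
       map_zero_left := fun θ => by
          apply Subtype.ext
          simp only [γ.source]
          rfl
       map_one_left := fun θ => by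
          apply Subtype.ext
          simp only [γ.target]
          rfl }⟩
  have hα : pushforward (n + 1) (TopCat.ofHom sq.g) α = 0 := by
    have h := pushforward_eq_of_homotopic hhom (torusClass (n + 1))
    rw [map_sub, sub_eq_zero, torusOver, torusOver, pushforward_comp_apply,
      pushforward_comp_apply]
    exact h
  let G : TopCat.Homotopy (TopCat.ofHom ι ≫ N.half.section₀)
    (TopCat.ofHom ι ≫ N.half.section₀) := preHom ι N.half.loop
  have hG : ∀ t v, G (t, v) = N.half.loop (t, ι v) := fun t v => rfl
  obtain ⟨β, hβ⟩ := sq.exists_sweep_eq G (fun p => (hG _ _).trans (N.b_j_circleLoop hι hN p)) α hα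
  -- Sweeping over `T` is the tube of the class pushed forward to the whole zero set.
  have htube : N.half.tube n (pushforward n (TopCat.ofHom ι) β) = α := by
    rw [← hβ]
    exact sweep_pushforward N.half.loop G ι hG β
  refine ⟨pushforward n (TopCat.ofHom ι) β, fun J => ⟨?_, ?_⟩, ?_⟩
  · rintro ⟨hx', hy', N', h⟩
    refine tube_injective hQ N.half ?_
    rw [htube, ← N'.tube_eq, ← h]
  · rintro rfl
    exact ⟨hx, hy, N.half, htube.symm⟩
  · let j : C(T, {v : variety Q // (v : Cd (n + 1)) ∈ S}) :=
      ⟨fun v => ⟨v.1, hWS v.1 v.1.2 v.2⟩, by fun_prop⟩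
    refine ⟨pushforward n (TopCat.ofHom j) β, ?_⟩
    rw [pushforward_comp_apply]
    rfl

end IntersectionClass

end

/-! ### Amoebas and compactness -/

section

section Amoeba
open Topology

variable {d : ℕ}

/-- The point with logarithmic coordinates `x` and phase `θ`. -/
def polarPoint (x : Fin d → ℝ) (θ : Fin d → Circle) : Cd d :=
  WithLp.toLp 2 fun i => (Real.exp (x i) : ℂ) * (θ i : ℂ)

lemma polarPoint_mem_cstar (x : Fin d → ℝ) (θ : Fin d → Circle) : polarPoint x θ ∈ cstar d :=
  fun i => by simp [polarPoint, Complex.exp_ne_zero]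

lemma logMod_polarPoint (x : Fin d → ℝ) (θ : Fin d → Circle) : logMod (polarPoint x θ) = x :=
  (logMod_torusMap θ x).2

lemma exists_polarPoint_eq {z : Cd d} (hz : z ∈ cstar d) :
    ∃ θ, polarPoint (logMod z) θ = z := by
  refine ⟨fun i => ⟨z i / ‖z i‖, mem_sphere_zero_iff_norm.2 ?_⟩, ?_⟩
  · rw [norm_div, Complex.norm_real, norm_norm, div_self (norm_ne_zero_iff.2 (hz i))]
  · ext i
    have h : (‖z i‖ : ℂ) ≠ 0 := by exact_mod_cast norm_ne_zero_iff.2 (hz i)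
    simp only [polarPoint, logMod]
    rw [Real.exp_log (norm_pos_iff.2 (hz i)), mul_div_cancel₀ _ h]

lemma continuous_polarPoint :
    Continuous fun p : (Fin d → ℝ) × (Fin d → Circle) => polarPoint p.1 p.2 := by
  unfold polarPoint
  fun_prop

lemma continuous_eval_polarPoint (Q : Laurent d) :
    Continuous fun p : (Fin d → ℝ) × (Fin d → Circle) => eval Q (polarPoint p.1 p.2) := by
  rw [continuous_iff_continuousAt]
  intro p
  exact ContinuousAt.comp (f := fun p : (Fin d → ℝ) × (Fin d → Circle) => polarPoint p.1 p.2)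
    (analyticAt_eval Q (polarPoint_mem_cstar p.1 p.2)).continuousAt
    continuous_polarPoint.continuousAt

lemma mem_amoeba_iff {Q : Laurent d} {x : Fin d → ℝ} :
    x ∈ amoeba Q ↔ ∃ θ, eval Q (polarPoint x θ) = 0 := by
  constructor
  · rintro ⟨z, ⟨hz, h0⟩, rfl⟩
    obtain ⟨θ, hθ⟩ := exists_polarPoint_eq hz
    exact ⟨θ, by rw [hθ, h0]⟩
  · rintro ⟨θ, hθ⟩
    exact ⟨_, ⟨polarPoint_mem_cstar x θ, hθ⟩, logMod_polarPoint x θ⟩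

/-- The amoeba is the projection, along the compact torus of phases, of a closed set. -/
lemma isClosed_amoeba (Q : Laurent d) : IsClosed (amoeba Q) := by
  have h : amoeba Q = Prod.fst '' {p : (Fin d → ℝ) × (Fin d → Circle) |
      eval Q (polarPoint p.1 p.2) = 0} := by
    ext x
    rw [mem_amoeba_iff]
    constructor
    · rintro ⟨θ, hθ⟩
      exact ⟨(x, θ), hθ, rfl⟩
    · rintro ⟨⟨x, θ⟩, hθ, rfl⟩
      exact ⟨θ, hθ⟩
  rw [h]
  exact isClosedMap_fst_of_compactSpace _
    (isClosed_eq (continuous_eval_polarPoint Q) continuous_const)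

/-- Over a compact set off the amoeba, the modulus of `Q` is bounded below. -/
lemma exists_le_norm_eval {Q : Laurent d} {K : Set (Fin d → ℝ)} (hK : IsCompact K)
    (h : ∀ x ∈ K, x ∉ amoeba Q) :
    ∃ δ > 0, ∀ x ∈ K, ∀ θ, δ ≤ ‖eval Q (polarPoint x θ)‖ := by
  have hK' : IsCompact (K ×ˢ (Set.univ : Set (Fin d → Circle))) := hK.prod isCompact_univ
  obtain ⟨δ, hδ, hle⟩ := hK'.exists_forall_le' (f := fun p : (Fin d → ℝ) × (Fin d → Circle) =>
    ‖eval Q (polarPoint p.1 p.2)‖) (a := 0) (continuous_eval_polarPoint Q).norm.continuousOn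
    fun p hp => norm_pos_iff.2 fun h0 => h p.1 hp.1 (mem_amoeba_iff.2 ⟨p.2, h0⟩)
  exact ⟨δ, hδ, fun x hx θ => hle (x, θ) ⟨hx, trivial⟩⟩

/-- A zero of `Q - c` has `|Q| = |c|`, which is excluded once `|c|` is below the minimum of `|Q|`
over `K`. -/
lemma exists_notMem_amoeba_perturb {Q : Laurent d} {K : Set (Fin d → ℝ)} (hK : IsCompact K)
    (h : ∀ x ∈ K, x ∉ amoeba Q) :
    ∃ δ > 0, ∀ c : ℂ, ‖c‖ < δ → ∀ x ∈ K, x ∉ amoeba (perturb Q c) := by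
  obtain ⟨δ, hδ, hle⟩ := exists_le_norm_eval hK h
  refine ⟨δ, hδ, fun c hc x hx hxa => ?_⟩
  obtain ⟨θ, hθ⟩ := mem_amoeba_iff.1 hxa
  rw [eval_perturb, sub_eq_zero] at hθ
  exact (hle x hx θ).not_gt (hθ ▸ hc)

end Amoeba

/-! ### Winding numbers along one-parameter subgroups -/

section Winding
open Polynomial

lemma circleIntegral_sub_inv {a : ℂ} {R : ℝ} (hR : 0 < R) (ha : ‖a‖ ≠ R) :
    CircleIntegrable (fun z => 1 / (z - a)) 0 R ∧
      (∮ z in C(0, R), 1 / (z - a)) = 2 * Real.pi * Complex.I * (if ‖a‖ < R then 1 else 0) := by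
  have hne : ∀ z ∈ Metric.sphere (0 : ℂ) R, z - a ≠ 0 := by
    intro z hz h
    rw [sub_eq_zero] at h
    rw [mem_sphere_zero_iff_norm, h] at hz
    exact ha hz
  refine ⟨ContinuousOn.circleIntegrable hR.le
    (continuousOn_const.div (by fun_prop) hne), ?_⟩
  simp only [one_div]
  by_cases h : ‖a‖ < R
  · rw [if_pos h, circleIntegral.integral_sub_inv_of_mem_ball (by simpa using h), mul_one]
  · rw [if_neg h, mul_zero]
    have hgt : R < ‖a‖ := lt_of_le_of_ne (not_lt.1 h) ha.symm
    refine Complex.circleIntegral_eq_zero_of_differentiable_on_off_countable hR.le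
      Set.countable_empty ?_ ?_
    · refine ContinuousOn.inv₀ (by fun_prop) fun z hz h0 => ?_
      rw [sub_eq_zero] at h0
      rw [mem_closedBall_zero_iff, h0] at hz
      linarith
    · intro z hz
      have hz1 : ‖z‖ < R := by simpa using hz.1
      refine DifferentiableAt.inv (by fun_prop) fun h0 => ?_
      rw [sub_eq_zero] at h0
      rw [h0] at hz1
      linarith

lemma circleIntegral_multiset_sum (S : Multiset ℂ) {R : ℝ} (hR : 0 < R)
    (hS : ∀ a ∈ S, ‖a‖ ≠ R) :
    CircleIntegrable (fun z => (S.map fun a => 1 / (z - a)).sum) 0 R ∧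
      (∮ z in C(0, R), (S.map fun a => 1 / (z - a)).sum) =
        2 * Real.pi * Complex.I * (S.countP fun a => ‖a‖ < R) := by
  induction S using Multiset.induction_on with
  | empty =>
    simp only [Multiset.map_zero, Multiset.sum_zero, Multiset.countP_zero, Nat.cast_zero, mul_zero]
    exact ⟨(continuousOn_const).circleIntegrable hR.le, by simp [circleIntegral]⟩
  | cons a S ih =>
    obtain ⟨h1, h2⟩ := ih fun b hb => hS b (Multiset.mem_cons_of_mem hb)
    obtain ⟨h3, h4⟩ := circleIntegral_sub_inv hR (hS a (Multiset.mem_cons_self a S))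
    simp only [Multiset.map_cons, Multiset.sum_cons]
    refine ⟨h3.add h1, ?_⟩
    rw [circleIntegral.integral_add h3 h1, h2, h4, Multiset.countP_cons]
    split_ifs <;> push_cast <;> ring

/-- The argument principle for polynomials. -/
lemma circleIntegral_derivative_div {p : ℂ[X]} {R : ℝ} (hR : 0 < R)
    (hp : ∀ z : ℂ, ‖z‖ = R → p.eval z ≠ 0) :
    (∮ z in C(0, R), p.derivative.eval z / p.eval z) =
      2 * Real.pi * Complex.I * (p.roots.countP fun a => ‖a‖ < R) := by
  rw [← (circleIntegral_multiset_sum p.roots hR fun a ha h =>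
    hp a h (Polynomial.isRoot_of_mem_roots ha)).2]
  refine circleIntegral.integral_congr hR.le fun z hz => ?_
  exact (IsAlgClosed.splits p).eval_derivative_div_eval_of_ne_zero
    (hp z (mem_sphere_zero_iff_norm.1 hz))

variable {d : ℕ}

/-- The action of the one-parameter subgroup of the algebraic torus with weights `m`. -/
def weightAct (m : Fin d → ℤ) (s : ℂ) (z : Cd d) : Cd d := WithLp.toLp 2 fun i => z i * s ^ m i

/-- The derivative of `Q` along the one-parameter subgroup with weights `m`. -/
def evalWeight (m : Fin d → ℤ) (Q : Laurent d) (z : Cd d) : ℂ :=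
  ∑ i, (m i : ℂ) * eval (eulerOp i Q) z

/-- Along an orbit of a one-parameter subgroup, a Laurent polynomial is a polynomial up to a power
of the parameter. -/
lemma exists_polynomial_weightAct (m : Fin d → ℤ) (Q : Laurent d) (z : Cd d) :
    ∃ N₀ : ℕ, ∀ N ≥ N₀, ∃ p : ℂ[X], ∀ s : ℂ, s ≠ 0 →
      p.eval s = s ^ N * eval Q (weightAct m s z) ∧
      s * p.derivative.eval s = s ^ N * evalWeight m Q (weightAct m s z) + N * p.eval s := by
  induction Q using AddMonoidAlgebra.induction_linear with
  | zero => exact ⟨0, fun N _ => ⟨0, fun s _ => by simp [eval_zero, evalWeight, eulerOp_zero]⟩⟩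
  | add P Q hP hQ =>
    obtain ⟨N₁, h₁⟩ := hP
    obtain ⟨N₂, h₂⟩ := hQ
    -- The exponent must serve both summands, which is why every sufficiently large `N` is allowed.
    refine ⟨max N₁ N₂, fun N hN => ?_⟩
    obtain ⟨p, hp⟩ := h₁ N (le_of_max_le_left hN)
    obtain ⟨q, hq⟩ := h₂ N (le_of_max_le_right hN)
    refine ⟨p + q, fun s hs => ?_⟩
    obtain ⟨a1, a2⟩ := hp s hs
    obtain ⟨b1, b2⟩ := hq s hs
    have hE : evalWeight m (P + Q) (weightAct m s z) = evalWeight m P (weightAct m s z) +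
        evalWeight m Q (weightAct m s z) := by
      simp only [evalWeight, eulerOp_add, eval_add, mul_add, Finset.sum_add_distrib]
    rw [Polynomial.derivative_add, Polynomial.eval_add, Polynomial.eval_add, eval_add, hE]
    exact ⟨by rw [a1, b1]; ring, by linear_combination a2 + b2⟩
  | single k a =>
    -- The monomial has weight `∑ m_i k_i` under the subgroup. This choice of `N` makes the shifted
    -- exponent nonnegative.
    refine ⟨(∑ i, m i * k i).natAbs, fun N hN => ?_⟩
    obtain ⟨e, he⟩ : ∃ e : ℕ, (e : ℤ) = N + ∑ i, m i * k i :=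
      ⟨(N + ∑ i, m i * k i).toNat, by omega⟩
    have hmon : ∀ s : ℂ, s ≠ 0 → s ^ N * ∏ i, (weightAct m s z) i ^ k i =
        (∏ i, z i ^ k i) * s ^ e := by
      intro s hs
      have h1 : ∏ i, (weightAct m s z) i ^ k i = (∏ i, z i ^ k i) * s ^ (∑ i, m i * k i) := by
        have h2 : s ^ (∑ i, m i * k i) = ∏ i, s ^ (m i * k i) := by
          induction (Finset.univ : Finset (Fin d)) using Finset.induction_on with
          | empty => simp
          | insert i t hi ih => rw [Finset.sum_insert hi, Finset.prod_insert hi, zpow_add₀ hs, ih]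
        rw [h2, ← Finset.prod_mul_distrib]
        refine Finset.prod_congr rfl fun i _ => ?_
        simp only [weightAct]
        rw [mul_zpow, zpow_mul]
      rw [h1, ← zpow_natCast s e, he, zpow_add₀ hs, zpow_natCast]
      ring
    have hd : ∀ s : ℂ, evalWeight m (AddMonoidAlgebra.single k a) (weightAct m s z) =
        ((e : ℂ) - N) * (a * ∏ i, (weightAct m s z) i ^ k i) := by
      intro s
      have : ((e : ℤ) : ℂ) = N + ∑ i, (m i : ℂ) * k i := by rw [he]; push_cast; ring
      rw [show (e : ℂ) = ((e : ℤ) : ℂ) by simp, this, add_sub_cancel_left, evalWeight,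
        Finset.sum_mul]
      refine Finset.sum_congr rfl fun i _ => ?_
      rw [eulerOp_single, eval_single]
      ring
    refine ⟨C (a * ∏ i, z i ^ k i) * X ^ e, fun s hs => ?_⟩
    have h := hmon s hs
    constructor
    · rw [eval_single]
      simp only [Polynomial.eval_mul, Polynomial.eval_C, Polynomial.eval_pow, Polynomial.eval_X]
      linear_combination -a * h
    · rw [hd s]
      have hs' : s * (C (a * ∏ i, z i ^ k i) * X ^ e).derivative.eval s =
          e * (a * ∏ i, z i ^ k i) * s ^ e := by
        rw [Polynomial.derivative_C_mul_X_pow]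
        simp only [Polynomial.eval_mul, Polynomial.eval_C, Polynomial.eval_pow, Polynomial.eval_X]
        rcases e.eq_zero_or_pos with h0 | h0
        · rw [h0]; simp
        · obtain ⟨e', rfl⟩ : ∃ e', e = e' + 1 := ⟨e - 1, by omega⟩
          rw [Nat.add_sub_cancel, pow_succ]
          ring
      rw [hs']
      simp only [Polynomial.eval_mul, Polynomial.eval_C, Polynomial.eval_pow, Polynomial.eval_X]
      linear_combination ((N : ℂ) - e) * a * h

/-- The winding number, up to the factor `2π`, of `Q` along a circle orbit in the torus over `x`. -/
def winding (m : Fin d → ℤ) (Q : Laurent d) (θ : Fin d → Circle) (x : Fin d → ℝ) : ℂ :=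
  ∫ φ in (0 : ℝ)..2 * Real.pi, evalWeight m Q (polarPoint x fun i => θ i * Circle.exp φ ^ m i) /
    eval Q (polarPoint x fun i => θ i * Circle.exp φ ^ m i)

/-- A shift by `t m` in logarithmic space with a rotation by `φ m` is the action of `s = e^{t +
iφ}`, so the orbit circles over the line become concentric circles in `s`. -/
lemma polarPoint_add_smul (m : Fin d → ℤ) (x : Fin d → ℝ) (θ : Fin d → Circle) (t φ : ℝ) :
    (polarPoint (x + t • fun i => (m i : ℝ)) fun i => θ i * Circle.exp φ ^ m i) =
      weightAct m (circleMap 0 (Real.exp t) φ) (polarPoint x θ) := by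
  ext i
  simp only [polarPoint, weightAct, circleMap, Pi.add_apply, Pi.smul_apply, smul_eq_mul, zero_add,
    Circle.coe_mul, Circle.coe_zpow, Circle.coe_exp]
  rw [mul_zpow, ← Complex.ofReal_zpow, ← Real.rpow_intCast, ← Real.exp_mul, Real.exp_add]
  push_cast
  ring

/-- On the circle `|s| = e^t` the integrand is `s p'/p - N`. The argument principle turns the
winding number into the number of roots of `p` inside, minus `N`. -/
lemma winding_eq {m : Fin d → ℤ} {Q : Laurent d} {θ : Fin d → Circle} {x : Fin d → ℝ} {N : ℕ}
    {p : ℂ[X]} (hp : ∀ s : ℂ, s ≠ 0 →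
      p.eval s = s ^ N * eval Q (weightAct m s (polarPoint x θ)) ∧
      s * p.derivative.eval s = s ^ N * evalWeight m Q (weightAct m s (polarPoint x θ)) +
        N * p.eval s) {t : ℝ}
    (ht : x + t • (fun i => (m i : ℝ)) ∉ amoeba Q) :
    (∀ z : ℂ, ‖z‖ = Real.exp t → p.eval z ≠ 0) ∧
    winding m Q θ (x + t • fun i => (m i : ℝ)) =
      2 * Real.pi * ((p.roots.countP fun a => ‖a‖ < Real.exp t : ℕ) - N : ℤ) := by
  have hne : ∀ φ, eval Q (weightAct m (circleMap 0 (Real.exp t) φ) (polarPoint x θ)) ≠ 0 := by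
    intro φ h
    rw [← polarPoint_add_smul] at h
    exact ht (mem_amoeba_iff.2 ⟨_, h⟩)
  have hs : ∀ φ, circleMap 0 (Real.exp t) φ ≠ 0 := fun φ =>
    circleMap_ne_center (Real.exp_pos t).ne'
  have hpc : ∀ φ, p.eval (circleMap 0 (Real.exp t) φ) ≠ 0 := fun φ => by
    rw [(hp _ (hs φ)).1]
    exact mul_ne_zero (pow_ne_zero _ (hs φ)) (hne φ)
  have h1 : ∀ z : ℂ, ‖z‖ = Real.exp t → p.eval z ≠ 0 := by
    intro z hz
    have hz' : z ∈ Metric.sphere (0 : ℂ) |Real.exp t| := by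
      rw [abs_of_pos (Real.exp_pos t)]; simpa using hz
    rw [← range_circleMap] at hz'
    obtain ⟨φ, rfl⟩ := hz'
    exact hpc φ
  refine ⟨h1, ?_⟩
  have h2 := circleIntegral_derivative_div (Real.exp_pos t) h1
  have h3 : winding m Q θ (x + t • fun i => (m i : ℝ)) =
      ∫ φ in (0 : ℝ)..2 * Real.pi, (-Complex.I * (deriv (circleMap 0 (Real.exp t)) φ •
        (p.derivative.eval (circleMap 0 (Real.exp t) φ) / p.eval (circleMap 0 (Real.exp t) φ))) -
          N) := by
    refine intervalIntegral.integral_congr fun φ _ => ?_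
    simp only [polarPoint_add_smul, deriv_circleMap, circleMap_zero, smul_eq_mul]
    rw [← circleMap_zero]
    obtain ⟨a1, a2⟩ := hp _ (hs φ)
    have hsN := pow_ne_zero N (hs φ)
    rw [show -Complex.I * (circleMap 0 (Real.exp t) φ * Complex.I * (p.derivative.eval
      (circleMap 0 (Real.exp t) φ) / p.eval (circleMap 0 (Real.exp t) φ))) =
      (circleMap 0 (Real.exp t) φ * p.derivative.eval (circleMap 0 (Real.exp t) φ)) /
        p.eval (circleMap 0 (Real.exp t) φ) by
          linear_combination (-(circleMap 0 (Real.exp t) φ * (p.derivative.eval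
            (circleMap 0 (Real.exp t) φ) / p.eval (circleMap 0 (Real.exp t) φ)))) * Complex.I_mul_I,
      a2, add_div, mul_div_cancel_right₀ _ (hpc φ), add_sub_cancel_right, a1,
      mul_div_mul_left _ _ hsN]
  rw [h3, intervalIntegral.integral_sub, intervalIntegral.integral_const_mul,
    intervalIntegral.integral_const]
  · change -Complex.I * (∮ z in C(0, Real.exp t), p.derivative.eval z / p.eval z) - _ = _
    rw [h2, sub_zero, Complex.real_smul]
    push_cast
    linear_combination (-2 * Real.pi * (p.roots.countP fun a => ‖a‖ < Real.exp t : ℂ)) *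
      Complex.I_mul_I
  · refine Continuous.intervalIntegrable ?_ _ _
    simp only [deriv_circleMap]
    refine continuous_const.mul (Continuous.smul (f := fun φ => circleMap 0 (Real.exp t) φ *
      Complex.I) ((continuous_circleMap _ _).mul continuous_const) (Continuous.div ?_ ?_ hpc))
    · exact p.derivative.continuous.comp (continuous_circleMap _ _)
    · exact p.continuous.comp (continuous_circleMap _ _)
  · exact continuous_const.intervalIntegrable _ _

end Winding

end

/-! ### Convexity of the components -/

section

section Convex
open Topology

variable {d : ℕ}

lemma continuousOn_winding (m : Fin d → ℤ) (Q : Laurent d) (θ : Fin d → Circle) :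
    ContinuousOn (winding m Q θ) (amoeba Q)ᶜ := by
  rw [continuousOn_iff_continuous_domRestrict]
  have hgen : ∀ P : Laurent d, Continuous fun p : ↥(amoeba Q)ᶜ × ℝ =>
      eval P (polarPoint (p.1 : Fin d → ℝ) fun i => θ i * Circle.exp p.2 ^ m i) := fun P =>
    (continuous_eval_polarPoint P).comp
      (f := fun p : ↥(amoeba Q)ᶜ × ℝ =>
        ((p.1 : Fin d → ℝ), fun i => θ i * Circle.exp p.2 ^ m i)) (by fun_prop)
  have hweight : Continuous fun p : ↥(amoeba Q)ᶜ × ℝ =>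
      evalWeight m Q (polarPoint (p.1 : Fin d → ℝ) fun i => θ i * Circle.exp p.2 ^ m i) := by
    unfold evalWeight
    exact continuous_finsetSum _ fun i _ => continuous_const.mul (hgen _)
  have hdiv := hweight.div (hgen Q) fun p h => p.1.2 (mem_amoeba_iff.2 ⟨_, h⟩)
  exact intervalIntegral.continuous_parametric_intervalIntegral_of_continuous'
    (f := fun (x : ↥(amoeba Q)ᶜ) φ =>
      evalWeight m Q (polarPoint (x : Fin d → ℝ) fun i => θ i * Circle.exp φ ^ m i) /
      eval Q (polarPoint (x : Fin d → ℝ) fun i => θ i * Circle.exp φ ^ m i)) hdiv _ _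

lemma exists_int_winding {m : Fin d → ℤ} {Q : Laurent d} (θ : Fin d → Circle) {x : Fin d → ℝ}
    (hx : x ∉ amoeba Q) : ∃ k : ℤ, winding m Q θ x = 2 * Real.pi * k := by
  obtain ⟨N, hN⟩ := exists_polynomial_weightAct m Q (polarPoint x θ)
  obtain ⟨p, hp⟩ := hN N le_rfl
  have h := (winding_eq hp (t := 0) (by simpa using hx)).2
  rw [zero_smul, add_zero] at h
  exact ⟨_, h⟩

/-- A continuous function with values in a discrete set is constant on a preconnected set. -/
lemma winding_eq_of_isPreconnected (m : Fin d → ℤ) {Q : Laurent d} (θ : Fin d → Circle)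
    {B : Set (Fin d → ℝ)} (hB : IsPreconnected B) (hBQ : B ⊆ (amoeba Q)ᶜ) {x y : Fin d → ℝ}
    (hx : x ∈ B) (hy : y ∈ B) : winding m Q θ x = winding m Q θ y := by
  have hc : ContinuousOn (fun x => (winding m Q θ x).re / (2 * Real.pi)) B :=
    ((Complex.continuous_re.comp_continuousOn (continuousOn_winding m Q θ)).mono hBQ).div_const _
  have hmaps : Set.MapsTo (fun x => (winding m Q θ x).re / (2 * Real.pi)) B
      (Set.range ((↑) : ℤ → ℝ)) := by
    intro z hz
    obtain ⟨k, hk⟩ := exists_int_winding (m := m) θ (hBQ hz)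
    refine ⟨k, ?_⟩
    have : ((2 : ℂ) * Real.pi * k) = ((2 * Real.pi * k : ℝ) : ℂ) := by push_cast; ring
    simp only [hk, this, Complex.ofReal_re]
    field_simp
  have hd : IsDiscrete (Set.range ((↑) : ℤ → ℝ)) :=
    ⟨Int.isClosedEmbedding_coe_real.isEmbedding.toHomeomorph.symm.isEmbedding.discreteTopology⟩
  have h := hB.constant_of_mapsTo hd hc hmaps hx hy
  obtain ⟨k, hk⟩ := exists_int_winding (m := m) θ (hBQ hx)
  obtain ⟨l, hl⟩ := exists_int_winding (m := m) θ (hBQ hy)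
  have e : ∀ k : ℤ, ((2 : ℂ) * Real.pi * k).re = 2 * Real.pi * k := by
    intro k
    rw [show ((2 : ℂ) * Real.pi * k) = ((2 * Real.pi * k : ℝ) : ℂ) by push_cast; ring,
      Complex.ofReal_re]
  simp only [hk, hl, e] at h
  have hpi := Real.pi_pos
  field_simp at h
  rw [hk, hl]
  exact_mod_cast congrArg (fun r : ℝ => (2 * Real.pi * r : ℂ)) h

/-- A segment with integral direction and ends in a component of the complement of the amoeba does
not meet the amoeba. -/
lemma notMem_amoeba_of_int_direction {Q : Laurent d} {B : Set (Fin d → ℝ)} (hB : IsPreconnected B)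
    (hBQ : B ⊆ (amoeba Q)ᶜ) {x : Fin d → ℝ} (m : Fin d → ℤ) {t₀ t₁ : ℝ} (h₀ : t₀ < 0) (h₁ : 0 < t₁)
    (hx₀ : x + t₀ • (fun i => (m i : ℝ)) ∈ B) (hx₁ : x + t₁ • (fun i => (m i : ℝ)) ∈ B) :
    x ∉ amoeba Q := by
  intro hx
  obtain ⟨θ, hθ⟩ := mem_amoeba_iff.1 hx
  obtain ⟨N, hN⟩ := exists_polynomial_weightAct m Q (polarPoint x θ)
  obtain ⟨p, hp⟩ := hN N le_rfl
  obtain ⟨a₀, w₀⟩ := winding_eq hp (hBQ hx₀)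
  obtain ⟨a₁, w₁⟩ := winding_eq hp (hBQ hx₁)
  have hw := winding_eq_of_isPreconnected m θ hB hBQ hx₀ hx₁
  rw [w₀, w₁] at hw
  have hpi : (2 * Real.pi : ℂ) ≠ 0 := by
    exact_mod_cast (mul_pos two_pos Real.pi_pos).ne'
  have hcard := mul_left_cancel₀ hpi hw
  have hp0 : p ≠ 0 := by
    rintro rfl
    exact a₀ (Real.exp t₀ : ℂ) (by simp) (by simp)
  have h1 : p.eval 1 = 0 := by
    have := (hp 1 one_ne_zero).1
    rwa [show weightAct m 1 (polarPoint x θ) = polarPoint x θ by ext i; simp [weightAct], hθ,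
      mul_zero] at this
  have hmem : (1 : ℂ) ∈ p.roots := (Polynomial.mem_roots hp0).2 h1
  -- The zero over `x` is the root `s = 1`. It is inside the larger circle and outside the smaller
  -- one, so the two counts differ, against constancy of the winding number on `B`.
  have hlt : (p.roots.countP fun a => ‖a‖ < Real.exp t₀) <
      p.roots.countP fun a => ‖a‖ < Real.exp t₁ := by
    obtain ⟨S, hS⟩ := Multiset.exists_cons_of_mem hmem
    rw [hS, Multiset.countP_cons, Multiset.countP_cons, if_neg (by simpa using h₀.le),
      if_pos (by simpa using h₁), add_zero, Nat.lt_succ_iff, Multiset.countP_eq_card_filter,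
      Multiset.countP_eq_card_filter]
    refine Multiset.card_le_card (Multiset.monotone_filter_right _ fun a ha => ?_)
    exact ha.trans (Real.exp_lt_exp.2 (h₀.trans h₁))
  have : ((p.roots.countP fun a => ‖a‖ < Real.exp t₀ : ℕ) : ℤ) =
      (p.roots.countP fun a => ‖a‖ < Real.exp t₁ : ℕ) := by
    have := Int.cast_injective hcard
    linarith
  omega

lemma exists_int_direction (w : Fin d → ℝ) {ε : ℝ} (hε : 0 < ε) :
    ∃ (m : Fin d → ℤ) (D : ℝ), 0 < D ∧ ‖D⁻¹ • (fun i => (m i : ℝ)) - w‖ < ε := by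
  obtain ⟨n, hn⟩ := exists_nat_gt (ε⁻¹)
  have hn0 : (0 : ℝ) < n := (inv_pos.2 hε).trans hn
  refine ⟨fun i => ⌊(n : ℝ) * w i⌋, n, hn0, (pi_norm_lt_iff hε).2 fun i => ?_⟩
  simp only [Pi.sub_apply, Pi.smul_apply, smul_eq_mul, Real.norm_eq_abs]
  have h1 := Int.floor_le ((n : ℝ) * w i)
  have h2 := Int.lt_floor_add_one ((n : ℝ) * w i)
  have h3 : (n : ℝ)⁻¹ * ⌊(n : ℝ) * w i⌋ - w i = (n : ℝ)⁻¹ * (⌊(n : ℝ) * w i⌋ - n * w i) := by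
    field_simp
  rw [h3, abs_mul, abs_of_pos (inv_pos.2 hn0)]
  have h4 : |(⌊(n : ℝ) * w i⌋ : ℝ) - n * w i| ≤ 1 := by rw [abs_le]; constructor <;> linarith
  calc _ ≤ (n : ℝ)⁻¹ * 1 := by gcongr
    _ < ε := by rw [mul_one]; exact inv_lt_of_inv_lt₀ hε hn

lemma IsAmoebaComplementComponent.isOpen {Q : Laurent d} {B : Set (Fin d → ℝ)}
    (hB : IsAmoebaComplementComponent Q B) : IsOpen B := by
  obtain ⟨x, -, rfl⟩ := hB
  exact (isClosed_amoeba Q).isOpen_compl.connectedComponentIn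

lemma IsAmoebaComplementComponent.isPreconnected {Q : Laurent d} {B : Set (Fin d → ℝ)}
    (hB : IsAmoebaComplementComponent Q B) : IsPreconnected B := by
  obtain ⟨x, -, rfl⟩ := hB
  exact isPreconnected_connectedComponentIn

lemma IsAmoebaComplementComponent.subset {Q : Laurent d} {B : Set (Fin d → ℝ)}
    (hB : IsAmoebaComplementComponent Q B) : B ⊆ (amoeba Q)ᶜ := by
  obtain ⟨x, -, rfl⟩ := hB
  exact connectedComponentIn_subset _ _

lemma IsAmoebaComplementComponent.subset_of_isPreconnected {Q : Laurent d} {B S : Set (Fin d → ℝ)}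
    (hB : IsAmoebaComplementComponent Q B) (hS : IsPreconnected S) (hSQ : S ⊆ (amoeba Q)ᶜ)
    {x : Fin d → ℝ} (hxS : x ∈ S) (hxB : x ∈ B) : S ⊆ B := by
  obtain ⟨y, -, rfl⟩ := hB
  rw [connectedComponentIn_eq hxB]
  exact hS.subset_connectedComponentIn hxS hSQ

/-- The components of the complement of an amoeba are convex. -/
lemma IsAmoebaComplementComponent.convex {Q : Laurent d} {B : Set (Fin d → ℝ)}
    (hB : IsAmoebaComplementComponent Q B) : Convex ℝ B := by
  have hcompl : ∀ x ∈ B, ∀ y ∈ B, ∀ z ∈ openSegment ℝ x y, z ∉ amoeba Q := by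
    rintro x hx y hy z ⟨a, b, ha, hb, hab, rfl⟩
    obtain ⟨ε, hε, h1⟩ := Metric.isOpen_iff.1 hB.isOpen x hx
    obtain ⟨ε', hε', h2⟩ := Metric.isOpen_iff.1 hB.isOpen y hy
    -- Through `z` there is a line of rational direction so close to the segment that, `B` being
    -- open, points on either side of `z` still lie in `B`.
    obtain ⟨m, D, hD, hm⟩ := exists_int_direction (y - x) (lt_min hε hε')
    have hD' := inv_pos.2 hD
    refine notMem_amoeba_of_int_direction hB.isPreconnected hB.subset m (t₀ := -(b * D⁻¹))
      (t₁ := a * D⁻¹) (by nlinarith [mul_pos hb hD']) (mul_pos ha hD') (h1 ?_) (h2 ?_)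
    · rw [mem_ball_iff_norm]
      have e : a • x + b • y + -(b * D⁻¹) • (fun i => (m i : ℝ)) - x =
          -b • (D⁻¹ • (fun i => (m i : ℝ)) - (y - x)) := by
        obtain rfl : a = 1 - b := by linarith
        module
      rw [e, norm_smul, norm_neg, Real.norm_of_nonneg hb.le]
      calc _ ≤ 1 * _ := by gcongr; linarith
        _ < ε := by rw [one_mul]; exact hm.trans_le (min_le_left _ _)
    · rw [mem_ball_iff_norm]
      have e : a • x + b • y + (a * D⁻¹) • (fun i => (m i : ℝ)) - y =
          a • (D⁻¹ • (fun i => (m i : ℝ)) - (y - x)) := by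
        obtain rfl : b = 1 - a := by linarith
        module
      rw [e, norm_smul, Real.norm_of_nonneg ha.le]
      calc _ ≤ 1 * _ := by gcongr; linarith
        _ < ε' := by rw [one_mul]; exact hm.trans_le (min_le_right _ _)
  rw [convex_iff_segment_subset]
  intro x hx y hy
  refine hB.subset_of_isPreconnected (convex_segment x y).isPreconnected ?_
    (left_mem_segment ℝ x y) hx
  rw [← insert_endpoints_openSegment]
  rintro z (rfl | rfl | hz)
  · exact hB.subset hx
  · exact hB.subset hy
  · exact hcompl x hx y hy z hz

end Convex

end

/-! ### Heights, recession cones and small perturbations -/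

section

section Descent
open Topology

variable {d : ℕ}

lemma add_mem_closure_of_recessionCone {B : Set (Fin d → ℝ)} {u v : Fin d → ℝ}
    (hu : u ∈ closure B) (hv : v ∈ recessionCone B) : u + v ∈ closure B :=
  map_mem_closure (f := fun x => x + v) (by fun_prop) hu fun b hb => by
    simpa using hv b hb 1 zero_le_one

/-- The recession cone of an open convex set lies in its closed tangent cones. -/
lemma mem_closure_tangentCone {B : Set (Fin d → ℝ)} (hB : IsOpen B) (hconv : Convex ℝ B)
    {u v : Fin d → ℝ} (hu : u ∈ closure B) (hv : v ∈ recessionCone B) :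
    v ∈ closure (tangentCone B u) := by
  have h := map_mem_closure (f := fun b => b + v - u) (t := tangentCone B u) (by fun_prop) hu
    fun b hb => ?_
  · simpa using h
  · have hbv : b + v ∈ B := by simpa using hv b hb 1 zero_le_one
    have hlt : ∀ᶠ t : ℝ in 𝓝[>] 0, t ∈ Set.Ioo (0 : ℝ) 1 := Ioo_mem_nhdsGT one_pos
    change ∀ᶠ t : ℝ in 𝓝[>] 0, _
    filter_upwards [hlt] with t ht
    -- The half-open segment from a closure point to an interior point of a convex set lies in the
    -- interior.
    have h1 := hconv.combo_closure_interior_mem_interior hu (by rwa [hB.interior_eq] : b + v ∈ _)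
      (sub_nonneg.2 ht.2.le) ht.1 (by ring)
    rw [hB.interior_eq] at h1
    convert! h1 using 1
    module

/-- The point `u + v` lies in the closure of `B`, where the height is at least that of `u`; equality
is excluded since `v` is a nonzero vector of the closed tangent cone. -/
lemma dotProduct_neg_of_isSupporting {B : Set (Fin d → ℝ)} (hB : IsOpen B) (hconv : Convex ℝ B)
    {r u v : Fin d → ℝ} (hr : IsSupporting r B u) (hu : u ∈ closure B) (hv : v ∈ recessionCone B)
    (hv0 : v ≠ 0) : r ⬝ᵥ v < 0 := by
  have h1 := hr.1 _ (add_mem_closure_of_recessionCone hu hv)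
  rw [dotProduct_add] at h1
  have h2 : r ⬝ᵥ v ≠ 0 := fun h =>
    hv0 (hr.2 v (mem_closure_tangentCone hB hconv hu hv) h)
  exact lt_of_le_of_ne (by linarith) h2

lemma height_direction (r : Fin d → ℝ) (z : Cd d) :
    height (direction r) z = -((∑ j, |r j|)⁻¹ * (r ⬝ᵥ logMod z)) := by
  simp only [height, direction, dotProduct, logMod, Finset.mul_sum, Pi.smul_apply, smul_eq_mul,
    mul_assoc]

lemma logMod_expPoint (u : Fin d → ℝ) : logMod (expPoint u) = u := by
  funext i
  simp [logMod, expPoint]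

lemma continuousOn_logMod : ContinuousOn (logMod (d := d)) (cstar d) := by
  refine continuousOn_pi.2 fun i => ContinuousOn.log (by fun_prop) fun z hz => ?_
  exact norm_ne_zero_iff.2 (hz i)

/-- Over points close to `u`, the zero sets of small perturbations of `Q` are close to the zeros of
`Q` over `u`. -/
lemma exists_perturb_near {Q : Laurent d} {u : Fin d → ℝ} {O : Set (Cd d)} (hO : IsOpen O)
    (h : ∀ z ∈ variety Q, logMod z = u → z ∈ O) :
    ∃ η > 0, ∃ δ > 0, ∀ c : ℂ, ‖c‖ < δ → ∀ z ∈ variety (perturb Q c),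
      logMod z ∈ Metric.closedBall u η → z ∈ O := by
  have hpre : IsClosed {p : (Fin d → ℝ) × (Fin d → Circle) | polarPoint p.1 p.2 ∉ O} :=
    hO.isClosed_compl.preimage continuous_polarPoint
  have hF : IsClosed (Prod.fst '' {p : (Fin d → ℝ) × (Fin d → Circle) |
      polarPoint p.1 p.2 ∉ O ∧ eval Q (polarPoint p.1 p.2) = 0}) :=
    isClosedMap_fst_of_compactSpace _
      (hpre.inter (isClosed_eq (continuous_eval_polarPoint Q) continuous_const))
  -- The points over which `Q` has a zero outside `O` form a closed set, again by compactness of the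
  -- phases, and it misses `u`. Over a small ball `|Q|` is then bounded below outside `O`.
  have hu : u ∉ Prod.fst '' {p : (Fin d → ℝ) × (Fin d → Circle) |
      polarPoint p.1 p.2 ∉ O ∧ eval Q (polarPoint p.1 p.2) = 0} := by
    rintro ⟨⟨w, θ⟩, ⟨h1, h2⟩, rfl⟩
    exact h1 (h _ ⟨polarPoint_mem_cstar _ _, h2⟩ (logMod_polarPoint _ _))
  obtain ⟨η, hη, hsub⟩ := Metric.nhds_basis_closedBall.mem_iff.1 (hF.isOpen_compl.mem_nhds hu)
  have hK : IsCompact ((Metric.closedBall u η ×ˢ (Set.univ : Set (Fin d → Circle))) ∩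
      {p : (Fin d → ℝ) × (Fin d → Circle) | polarPoint p.1 p.2 ∉ O}) :=
    ((isCompact_closedBall u η).prod isCompact_univ).inter_right hpre
  obtain ⟨δ, hδ, hle⟩ := hK.exists_forall_le' (f := fun p : (Fin d → ℝ) × (Fin d → Circle) =>
    ‖eval Q (polarPoint p.1 p.2)‖) (a := 0) (continuous_eval_polarPoint Q).norm.continuousOn
    fun p hp => norm_pos_iff.2 fun h0 => hsub hp.1.1 ⟨p, ⟨hp.2, h0⟩, rfl⟩
  refine ⟨η, hη, δ, hδ, fun c hc z hz hzu => ?_⟩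
  by_contra hzO
  obtain ⟨θ, hθ⟩ := exists_polarPoint_eq hz.1
  have h0 := hz.2
  rw [eval_perturb, sub_eq_zero] at h0
  have := hle (logMod z, θ) ⟨⟨hzu, trivial⟩, by simpa only [Set.mem_ofPred_eq, hθ] using hzO⟩
  simp only [hθ, h0] at this
  exact this.not_gt hc

lemma fderiv_eval_perturb (Q : Laurent d) (c : ℂ) (z : Cd d) :
    fderiv ℂ (eval (perturb Q c)) z = fderiv ℂ (eval Q) z := by
  have : eval (perturb Q c) = fun z => eval Q z - c := funext fun z => eval_perturb Q c z
  rw [this, fderiv_sub_const]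

/-- The levels of small positive height are smooth. -/
lemma exists_regular_perturb (Q : Laurent d) :
    ∃ δ > 0, ∀ c : ℝ, 0 < c → c < δ → ∀ z ∈ variety (perturb Q c),
      fderiv ℂ (eval (perturb Q c)) z ≠ 0 := by
  have hfin := (finite_criticalValues Q).preimage (f := ((↑) : ℝ → ℂ))
    Complex.ofReal_injective.injOn
  -- The value `0` may itself be critical, so it is removed from the finite set to be avoided; only
  -- positive `c` are used.
  have hn : ((((↑) : ℝ → ℂ) ⁻¹'
      {c : ℂ | ∃ z ∈ cstar d, fderiv ℂ (eval Q) z = 0 ∧ eval Q z = c}) \ {0})ᶜ ∈ 𝓝 (0 : ℝ) :=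
    (hfin.subset Set.sdiff_subset).isClosed.isOpen_compl.mem_nhds (by simp)
  obtain ⟨δ, hδ, hsub⟩ := Metric.mem_nhds_iff.1 hn
  refine ⟨δ, hδ, fun c hc hcδ z hz h => ?_⟩
  have hmem := hsub (show c ∈ Metric.ball 0 δ by
    rw [mem_ball_zero_iff, Real.norm_of_nonneg hc.le]; exact hcδ)
  refine hmem ⟨⟨z, hz.1, by rwa [fderiv_eval_perturb] at h, ?_⟩, hc.ne'⟩
  have := hz.2
  rwa [eval_perturb, sub_eq_zero] at this

end Descent

end

end ConePoint

end

/-! ### The path from `x` to `y` -/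

theorem theorem6p5 {n : ℕ} (Q : Laurent (n + 1))
    (B B' : Set (Fin (n + 1) → ℝ))
    (hB : IsAmoebaComplementComponent Q B) (hB' : IsAmoebaComplementComponent Q B')
    (hBB' : IsDescending B B')
    (u : Fin (n + 1) → ℝ) (hu : u ∈ frontier B)
    (hsing : HasRealHyperbolicQuadraticSingularity Q (expPoint u))
    (huniq : {z | z ∈ variety Q ∧ logMod z = u} = {expPoint u})
    (r : Fin (n + 1) → ℝ) (hr : IsSupporting r B u)
    (x y : Fin (n + 1) → ℝ) (hx : x ∈ B) (hy : y ∈ B')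
    (ρ : ℝ) (hρ : 0 < ρ) :
    ∃ ε > 0, ∃ cs > 0, ∀ c : ℝ, 0 < c → c < cs →
      ∃ I : HZ n (TopCat.of (variety (perturb Q c))),
        (∀ J, IsIntersectionClass (perturb Q c) x y J ↔ J = I) ∧
        IsSupportedOn I (Metric.ball (expPoint u) ρ ∪
          {z | height (direction r) z ≤ height (direction r) (expPoint u) - ε}) := by
  obtain ⟨v, hv, hv0, hv'⟩ := hBB'
  have huB : u ∈ closure B := frontier_subset_closure hu
  have hrv := dotProduct_neg_of_isSupporting hB.isOpen hB.convex hr huB hv hv0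
  have hr0 : r ≠ 0 := by
    rintro rfl
    simp at hrv
  have hκ : 0 < (∑ j, |r j|)⁻¹ := by
    obtain ⟨j, hj⟩ := Function.ne_iff.1 hr0
    exact inv_pos.2 ((abs_pos.2 hj).trans_le
      (Finset.single_le_sum (f := fun j => |r j|) (fun i _ => abs_nonneg _) (Finset.mem_univ j)))
  obtain ⟨κ, hκd⟩ : ∃ κ, κ = (∑ j, |r j|)⁻¹ := ⟨_, rfl⟩
  simp only [height_direction, logMod_expPoint]
  rw [← hκd] at hκ ⊢
  obtain ⟨η, hη, δ, hδ, hnear⟩ := exists_perturb_near (Q := Q) (u := u)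
    (Metric.isOpen_ball (x := expPoint u) (ε := ρ)) (fun z hz hzu => by
      have : z ∈ ({expPoint u} : Set _) := huniq ▸ ⟨hz, hzu⟩
      rw [this]
      exact Metric.mem_ball_self hρ)
  have hrr : 0 < r ⬝ᵥ r := lt_of_le_of_ne
    (Finset.sum_nonneg fun i _ => mul_self_nonneg (r i)) (Ne.symm (mt dotProduct_self_eq_zero.1 hr0))
  have hnr : 0 < ‖r‖ := norm_pos_iff.2 hr0
  -- The largest `s` for which `u + s • r` stays in the closed ball of radius `η`.
  let s : ℝ := η / ‖r‖
  have hs : 0 < s := div_pos hη hnr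
  -- Half of the drop `κ s (r · r)` in height from `u` to `u + s • r`, so that this point is
  -- strictly below the level `h_* - ε`. It does not depend on `c`.
  let ε : ℝ := κ * (s * (r ⬝ᵥ r)) / 2
  have hε : 0 < ε := by positivity
  obtain ⟨x', hx'B, hx'⟩ := Metric.mem_closure_iff.1 huB η hη
  obtain ⟨t, ht0, ht⟩ : ∃ t : ℝ, 0 ≤ t ∧
      -- Since `r · v < 0`, moving from `y` along `-v` lowers the height without bound, and the
      -- recession cone of `B'` keeps the point in `B'`.
      -(κ * (r ⬝ᵥ (y + t • -v))) < -(κ * (r ⬝ᵥ u)) - ε := by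
    have hpos : 0 < κ * -(r ⬝ᵥ v) := mul_pos hκ (neg_pos.2 hrv)
    obtain ⟨t, ht⟩ := exists_gt (max 0 ((κ * (r ⬝ᵥ u) + ε - κ * (r ⬝ᵥ y)) / (κ * -(r ⬝ᵥ v))))
    refine ⟨t, ((le_max_left _ _).trans_lt ht).le, ?_⟩
    have h1 := (div_lt_iff₀ hpos).1 ((le_max_right _ _).trans_lt ht)
    rw [dotProduct_add, dotProduct_smul, dotProduct_neg, smul_eq_mul]
    linarith
  have hy' : y + t • -v ∈ B' := hv' y hy t ht0
  obtain ⟨δ₁, hδ₁, h₁⟩ := exists_notMem_amoeba_perturb (Q := Q) (K := segment ℝ x x')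
    (by rw [segment_eq_image]; exact isCompact_Icc.image (by fun_prop))
    fun z hz => hB.subset (hB.convex.segment_subset hx hx'B hz)
  obtain ⟨δ₂, hδ₂, h₂⟩ := exists_notMem_amoeba_perturb (Q := Q) (K := segment ℝ (y + t • -v) y)
    (by rw [segment_eq_image]; exact isCompact_Icc.image (by fun_prop))
    fun z hz => hB'.subset (hB'.convex.segment_subset hy' hy hz)
  obtain ⟨δ₃, hδ₃, h₃⟩ := exists_regular_perturb Q
  refine ⟨ε, hε, min (min δ δ₁) (min δ₂ δ₃), lt_min (lt_min hδ hδ₁) (lt_min hδ₂ hδ₃),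
    fun c hc0 hc => ?_⟩
  obtain ⟨⟨hcδ, hcδ₁⟩, hcδ₂, hcδ₃⟩ : (c < δ ∧ c < δ₁) ∧ c < δ₂ ∧ c < δ₃ := by
    simpa only [lt_min_iff] using hc
  have hnc : ‖(c : ℂ)‖ = c := by rw [Complex.norm_real, Real.norm_of_nonneg hc0.le]
  -- The height is continuous only on the algebraic torus, so the low region is intersected with it
  -- to obtain an open set.
  have hlow : IsOpen {z : Cd (n + 1) | z ∈ cstar (n + 1) ∧
      -(κ * (r ⬝ᵥ logMod z)) < -(κ * (r ⬝ᵥ u)) - ε} := by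
    have hcont : ContinuousOn (fun z : Cd (n + 1) => -(κ * (r ⬝ᵥ logMod z))) (cstar (n + 1)) := by
      have : Continuous fun w : Fin (n + 1) → ℝ => -(κ * (r ⬝ᵥ w)) := by
        unfold dotProduct
        fun_prop
      exact this.comp_continuousOn continuousOn_logMod
    exact hcont.isOpen_inter_preimage isOpen_cstar isOpen_Iio
  refine exists_intersectionClass (h₃ c hc0 hcδ₃)
    (h₁ c (hnc.trans_lt hcδ₁) x (left_mem_segment ℝ x x'))
    (h₂ c (hnc.trans_lt hcδ₂) y (right_mem_segment ℝ _ y))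
    ((Metric.isOpen_ball (x := expPoint u) (ε := ρ)).union hlow)
    (fun z _ hz => hz.imp id fun h => h.2.le) ?_
  have hu'' : u + s • r ∈ Metric.closedBall u η := by
    rw [mem_closedBall_iff_norm, add_sub_cancel_left, norm_smul, Real.norm_of_nonneg hs.le,
      div_mul_cancel₀ _ hnr.ne']
  -- In logarithmic coordinates the height is linear, so the low region is a half-space and its
  -- points can be joined within it.
  have hlowc : Convex ℝ {w : Fin (n + 1) → ℝ | -(κ * (r ⬝ᵥ w)) < -(κ * (r ⬝ᵥ u)) - ε} := by
    intro a ha b hb p q hp hq hpq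
    simp only [Set.mem_ofPred_eq, dotProduct_add, dotProduct_smul, smul_eq_mul] at ha hb ⊢
    obtain rfl : q = 1 - p := by linarith
    rcases hp.eq_or_lt with rfl | hp'
    · linarith
    · nlinarith [mul_nonneg hq (sub_pos.2 hb).le, mul_pos hp' (sub_pos.2 ha)]
  have j₁ : JoinedIn (segment ℝ x x') x x' :=
    ((convex_segment x x').isPathConnected ⟨x, left_mem_segment ℝ x x'⟩).joinedIn _
      (left_mem_segment ℝ x x') _ (right_mem_segment ℝ x x')
  have j₂ : JoinedIn (Metric.closedBall u η) x' (u + s • r) :=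
    ((convex_closedBall u η).isPathConnected ⟨u, Metric.mem_closedBall_self hη.le⟩).joinedIn _
      (by rw [Metric.mem_closedBall, dist_comm]; exact hx'.le) _ hu''
  have hmem : u + s • r ∈ {w : Fin (n + 1) → ℝ | -(κ * (r ⬝ᵥ w)) < -(κ * (r ⬝ᵥ u)) - ε} := by
    simp only [Set.mem_ofPred_eq, dotProduct_add, dotProduct_smul, smul_eq_mul]
    have : κ * (s * (r ⬝ᵥ r)) = 2 * ε := by ring
    linarith
  have j₃ := (hlowc.isPathConnected ⟨_, hmem⟩).joinedIn _ hmem _ ht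
  have j₄ : JoinedIn (segment ℝ (y + t • -v) y) (y + t • -v) y :=
    ((convex_segment _ _).isPathConnected ⟨y, right_mem_segment ℝ _ y⟩).joinedIn _
      (left_mem_segment ℝ _ y) _ (right_mem_segment ℝ _ y)
  -- The first and last pieces avoid the amoeba of `Q - c`. Over the second the zero set lies in the
  -- ball around `z_*`, and over the third it is low.
  refine ((j₁.mono ?_).trans (j₂.mono ?_)).trans ((j₃.mono ?_).trans (j₄.mono ?_))
  · rintro w hw z hz rfl
    exact absurd ⟨z, hz, rfl⟩ (h₁ c (hnc.trans_lt hcδ₁) _ hw)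
  · rintro w hw z hz rfl
    exact Or.inl (hnear c (hnc.trans_lt hcδ) z hz hw)
  · rintro w hw z hz rfl
    exact Or.inr ⟨hz.1, hw⟩
  · rintro w hw z hz rfl
    exact absurd ⟨z, hz, rfl⟩ (h₂ c (hnc.trans_lt hcδ₂) _ hw)
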